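/- Let $S=\{\infty\}\cup S_f$ with $S_f=\{p_1,\dots,p_s\}$ a finite (possibly empty) set of primes, let $\mathbb{Q}_S=\mathbb{R}\times\prod_{p\in S_f}\mathbb{Q}_p$, and let $\mathbb{Z}_S\subset\mathbb{Q}_S$ be the ring of diagonally embedded rationals $z$ with $|z|_p\le 1$ for all primes $p\notin S$. Let $dv$ be the product measure on $\mathbb{Q}_S^d$ of the Lebesgue measure on $\mathbb{R}$ and the Haar measures on $\mathbb{Q}_p$ with $\mu_p(\mathbb{Z}_p)=1$. Let $\mathrm{UL}_d(\mathbb{Q}_S)$ be the group of $g=(g_p)_{p\in S}\in\mathrm{GL}_d(\mathbb{Q}_S)$ with $\det g_\infty=1$ and $|\det g_p|_p=1$ for $p\in S_f$, and $\mathrm{UL}_d(\mathbb{Z}_S)=\mathrm{UL}_d(\mathbb{Q}_S)\cap M_d(\mathbb{Z}_S)$. Let $(G,\Gamma)$ be either $(\mathrm{UL}_d(\mathbb{Q}_S),\mathrm{UL}_d(\mathbb{Z}_S))$ or $(\mathrm{SL}_d(\mathbb{Q}_S),\mathrm{SL}_d(\mathbb{Z}_S))$, where $\mathrm{SL}_d(\mathbb{Q}_S)=\prod_{p\in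 S}\mathrm{SL}_d(\mathbb{Q}_p)$, let $m$ be the $G$-invariant Borel probability measure on $G/\Gamma$, and identify $g\Gamma\in G/\Gamma$ with the $S$-lattice $\Lambda=g\mathbb{Z}_S^d$ in $\mathbb{Q}_S^d$. Put $$\mathbb{N}_S=\{q\in\mathbb{Z}_{\ge1}:\gcd(q,p_1\cdots p_s)=1\},\qquad \mathbb{P}_S=\{p_1^{m_1}\cdots p_s^{m_s}:m_1,\dots,m_s\in\mathbb{Z}_{\ge 0}\}.$$ Let $d\ge 3$ and let $f:\mathbb{Q}_S^d\to\mathbb{R}_{\ge 0}$ be a continuous (bounded) function of compact support. Then the sum $\widetilde f(\Lambda)=\sum_{v\in\Lambda\setminus\{0\}}f(v)$ has only finitely many nonzero terms for each $\Lambda\in G/\Gamma$, the function $\widetilde f^{\,2}$ is $m$-integrable, the series below converges, and $$\int_{G/\Gamma}\widetilde f^{\,2}\,dm=\Big(\int_{\mathbb{Q}_S^d}f\,dv\Big)^2+\sum_{q\in\mathbb{N}_S}\ \sum_{\mathfrak p\in\mathbb{P}_S}\ \sum_{\substack{w\in\mathbb{Z}\setminus\{0\}\\ \gcd(q\mathfrak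 p,w)=1}}\int_{\mathbb{Q}_S^d}f(qv)\,f\Big(\frac{w}{\mathfrak p}v\Big)\,dv .$$ -/

import Mathlib

open MeasureTheory
open scoped Matrix

noncomputable section

namespace SArith

instance factPrime (p : Nat.Primes) : Fact (p : ℕ).Prime := ⟨p.2⟩

/-- `ℚ_p` carries its Borel σ-algebra. -/
instance padicMeasurableSpace (p : ℕ) [Fact p.Prime] : MeasurableSpace ℚ_[p] := borel _

instance padicBorelSpace (p : ℕ) [Fact p.Prime] : BorelSpace ℚ_[p] := ⟨rfl⟩

/-- The unit ball `ℤ_p = {x : |x|_p ≤ 1}` of `ℚ_p`, a compact set with non-empty interior. -/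
def unitBall (p : ℕ) [Fact p.Prime] : TopologicalSpace.PositiveCompacts ℚ_[p] where
  carrier := Metric.closedBall 0 1
  isCompact' := isCompact_closedBall 0 1
  interior_nonempty' := by
    rw [(IsUltrametricDist.isOpen_closedBall (0 : ℚ_[p]) one_ne_zero).interior_eq]
    exact ⟨0, by simp⟩

/-- The Haar measure `μ_p` on `ℚ_p`, normalized by `μ_p(ℤ_p) = 1`. -/
def padicHaar (p : ℕ) [Fact p.Prime] : Measure ℚ_[p] := Measure.addHaarMeasure (unitBall p)

/-- `ℚ_S = ℝ × ∏_{p ∈ S_f} ℚ_p`, where the parameter `S` is the finite set `S_f` of primes, so that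
the set of places is `{∞} ∪ S`. -/
abbrev QS (S : Finset Nat.Primes) : Type := ℝ × ((p : S) → ℚ_[(p.1 : ℕ)])

/-- The measure `μ = ∏ μ_p` on `ℚ_S`, with `μ_∞` the Lebesgue measure. -/
def muS (S : Finset Nat.Primes) : Measure (QS S) :=
  (volume : Measure ℝ).prod (Measure.pi fun p : S => padicHaar (p.1 : ℕ))

/-- The measure `μ^d` on `ℚ_S^d`. -/
def muSd (S : Finset Nat.Primes) (d : ℕ) : Measure (Fin d → QS S) :=
  Measure.pi fun _ => muS S

/-- The diagonal embedding `z ↦ (z, …, z)` of `ℚ` in `ℚ_S`. -/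
def diag (S : Finset Nat.Primes) : ℚ →+* QS S :=
  (Rat.castHom ℝ).prod (RingHom.pi fun p : S => Rat.castHom ℚ_[(p.1 : ℕ)])

/-- The ring of `S`-integers
`ℤ_S = {(z, …, z) : z ∈ ℚ, |z|_p ≤ 1 for every prime p ∉ S}`, as a subring of `ℚ_S`. -/
def ZS (S : Finset Nat.Primes) : Subring (QS S) where
  carrier := {x | ∃ z : ℚ, (∀ p : Nat.Primes, p ∉ S → padicNorm p z ≤ 1) ∧ x = diag S z}
  mul_mem' := by
    rintro _ _ ⟨y, hy, rfl⟩ ⟨z, hz, rfl⟩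
    refine ⟨y * z, fun p hp => ?_, by simp⟩
    rw [padicNorm.mul]
    exact mul_le_one₀ (hy p hp) (padicNorm.nonneg z) (hz p hp)
  one_mem' := ⟨1, fun p _ => by simp, by simp⟩
  add_mem' := by
    rintro _ _ ⟨y, hy, rfl⟩ ⟨z, hz, rfl⟩
    exact ⟨y + z, fun p hp => padicNorm.nonarchimedean.trans (max_le (hy p hp) (hz p hp)), by simp⟩
  zero_mem' := ⟨0, fun p _ => by simp, by simp⟩
  neg_mem' := by
    rintro _ ⟨z, hz, rfl⟩
    exact ⟨-z, fun p hp => by simpa using hz p hp, by simp⟩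

/-- `GL_d(ℚ_S)`, with the topology of the group of units of the matrix ring. -/
abbrev GLS (S : Finset Nat.Primes) (d : ℕ) : Type := Matrix.GeneralLinearGroup (Fin d) (QS S)

/-- `UL_d(ℚ_S)`: `det g_∞ = 1` and `|det g_p|_p = 1` for `p ∈ S_f`. -/
def UL (S : Finset Nat.Primes) (d : ℕ) : Subgroup (GLS S d) where
  carrier := {g | g.val.det.1 = 1 ∧ ∀ p : S, ‖g.val.det.2 p‖ = 1}
  mul_mem' := by
    rintro a b ⟨ha, ha'⟩ ⟨hb, hb'⟩
    refine ⟨by simp [ha, hb], fun p => by simp [ha' p, hb' p]⟩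
  one_mem' := ⟨by simp, fun p => by simp⟩
  inv_mem' := by
    rintro g ⟨hg, hg'⟩
    have h : g.val.det * (g⁻¹).val.det = 1 := by
      rw [← Matrix.det_mul, ← Units.val_mul, mul_inv_cancel, Units.val_one, Matrix.det_one]
    refine ⟨?_, fun p => ?_⟩
    · have h1 := congrArg Prod.fst h
      rwa [Prod.fst_mul, hg, one_mul] at h1
    · have h1 := congrArg (fun x : QS S => ‖x.2 p‖) h
      simpa only [Prod.snd_mul, Pi.mul_apply, norm_mul, hg' p, one_mul, Prod.snd_one,
        Pi.one_apply, norm_one] using h1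

/-- `SL_d(ℚ_S) = ∏_{p ∈ S} SL_d(ℚ_p)`, as a subgroup of `GL_d(ℚ_S)`. -/
def SL (S : Finset Nat.Primes) (d : ℕ) : Subgroup (GLS S d) where
  carrier := {g | g.val.det = 1}
  mul_mem' := by
    intro a b ha hb
    simp only [Set.mem_ofPred_eq] at ha hb ⊢
    rw [Units.val_mul, Matrix.det_mul, ha, hb, one_mul]
  one_mem' := by simp
  inv_mem' := by
    intro g hg
    have h : g.val.det * (g⁻¹).val.det = 1 := by
      rw [← Matrix.det_mul, ← Units.val_mul, mul_inv_cancel, Units.val_one, Matrix.det_one]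
    rw [Set.mem_ofPred_eq] at hg
    rwa [hg, one_mul] at h

theorem SL_le_UL (S : Finset Nat.Primes) (d : ℕ) : SL S d ≤ UL S d := by
  intro g hg
  have hg : g.val.det = 1 := hg
  exact ⟨by simp [hg], fun p => by simp [hg]⟩

theorem det_mem_ZS {S : Finset Nat.Primes} {d : ℕ} {A : Matrix (Fin d) (Fin d) (QS S)}
    (hA : ∀ i j, A i j ∈ ZS S) : A.det ∈ ZS S := by
  rw [Matrix.det_apply]
  refine Subring.sum_mem _ fun σ _ => ?_
  rw [Units.smul_def]
  exact Subring.zsmul_mem _ (Subring.prod_mem _ fun i _ => hA _ _) _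

theorem inv_entries_mem_ZS {S : Finset Nat.Primes} {d : ℕ} {g : GLS S d} (hg : g ∈ UL S d)
    (hA : ∀ i j, g.val i j ∈ ZS S) (i j : Fin d) : (g⁻¹).val i j ∈ ZS S := by
  have hdet : g.val.det = 1 := by
    obtain ⟨z, -, hz⟩ := det_mem_ZS hA
    have h1 : (z : ℝ) = 1 := by
      have := hg.1
      rw [hz] at this
      simpa [diag] using this
    have h2 : z = 1 := by exact_mod_cast h1
    rw [hz, h2, map_one]
  have hinv : (g⁻¹).val = g.val.adjugate := by
    rw [Matrix.coe_units_inv, Matrix.inv_def, hdet, Ring.inverse_one, one_smul]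
  rw [hinv, Matrix.adjugate_apply]
  refine det_mem_ZS fun k l => ?_
  rw [Matrix.updateRow_apply]
  split_ifs
  · rw [Pi.single_apply]
    split_ifs
    · exact Subring.one_mem _
    · exact Subring.zero_mem _
  · exact hA k l

/-- For a subgroup `G` of `UL_d(ℚ_S)`, the group `G ∩ M_d(ℤ_S)` of elements of `G` all of whose
entries are in `ℤ_S`. -/
def integralPoints (S : Finset Nat.Primes) (d : ℕ) (G : Subgroup (GLS S d)) (hG : G ≤ UL S d) :
    Subgroup (GLS S d) where
  carrier := {g | g ∈ G ∧ ∀ i j, g.val i j ∈ ZS S}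
  mul_mem' := by
    rintro a b ⟨ha, ha'⟩ ⟨hb, hb'⟩
    refine ⟨G.mul_mem ha hb, fun i j => ?_⟩
    rw [Units.val_mul, Matrix.mul_apply]
    exact Subring.sum_mem _ fun k _ => Subring.mul_mem _ (ha' i k) (hb' k j)
  one_mem' := by
    refine ⟨G.one_mem, fun i j => ?_⟩
    rw [Units.val_one, Matrix.one_apply]
    split_ifs
    · exact Subring.one_mem _
    · exact Subring.zero_mem _
  inv_mem' := by
    rintro g ⟨hg, hg'⟩
    exact ⟨G.inv_mem hg, inv_entries_mem_ZS (hG hg) hg'⟩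

/-- `UL_d(ℤ_S) = UL_d(ℚ_S) ∩ M_d(ℤ_S)`. -/
def ULZ (S : Finset Nat.Primes) (d : ℕ) : Subgroup (GLS S d) :=
  integralPoints S d (UL S d) le_rfl

/-- `SL_d(ℤ_S)`, the matrices of determinant one with entries in `ℤ_S`. -/
def SLZ (S : Finset Nat.Primes) (d : ℕ) : Subgroup (GLS S d) :=
  integralPoints S d (SL S d) (SL_le_UL S d)

/-- The `S`-lattice `g ℤ_S^d` in `ℚ_S^d`. -/
def latticeOfMatrix {S : Finset Nat.Primes} {d : ℕ} (g : GLS S d) : Set (Fin d → QS S) :=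
  {v | ∃ z : Fin d → QS S, (∀ i, z i ∈ ZS S) ∧ v = g.val *ᵥ z}

/-- The `S`-lattice attached to the coset `x = gΓ`: it is `g ℤ_S^d` for any representative `g` of
`x`; see `lattice_mk`. -/
def lattice {S : Finset Nat.Primes} {d : ℕ} {G Γ : Subgroup (GLS S d)}
    (x : G ⧸ Γ.subgroupOf G) : Set (Fin d → QS S) :=
  {v | ∃ g : G, (QuotientGroup.mk g : G ⧸ Γ.subgroupOf G) = x ∧ v ∈ latticeOfMatrix (g : GLS S d)}

theorem lattice_mk {S : Finset Nat.Primes} {d : ℕ} {G Γ : Subgroup (GLS S d)}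
    (hΓ : ∀ γ ∈ Γ, ∀ i j, γ.val i j ∈ ZS S) (g : G) :
    lattice (QuotientGroup.mk g : G ⧸ Γ.subgroupOf G) = latticeOfMatrix (g : GLS S d) := by
  ext v
  constructor
  · rintro ⟨h, hh, z, hz, rfl⟩
    have hmem : ((g⁻¹ * h : G) : GLS S d) ∈ Γ :=
      Subgroup.mem_subgroupOf.1 (QuotientGroup.eq.1 hh.symm)
    refine ⟨((g⁻¹ * h : G) : GLS S d).val *ᵥ z, fun i => ?_, ?_⟩
    · simp only [Matrix.mulVec, dotProduct]
      exact Subring.sum_mem _ fun k _ => Subring.mul_mem _ (hΓ _ hmem i k) (hz k)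
    · rw [Matrix.mulVec_mulVec, ← Units.val_mul, ← Subgroup.coe_mul, mul_inv_cancel_left]
  · exact fun hv => ⟨g, rfl, hv⟩

theorem lattice_mk_UL {S : Finset Nat.Primes} {d : ℕ} (g : UL S d) :
    lattice (QuotientGroup.mk g : UL S d ⧸ (ULZ S d).subgroupOf (UL S d)) =
      latticeOfMatrix (g : GLS S d) :=
  lattice_mk (fun γ (hγ : γ ∈ integralPoints S d (UL S d) le_rfl) => hγ.2) g

theorem lattice_mk_SL {S : Finset Nat.Primes} {d : ℕ} (g : SL S d) :
    lattice (QuotientGroup.mk g : SL S d ⧸ (SLZ S d).subgroupOf (SL S d)) =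
      latticeOfMatrix (g : GLS S d) :=
  lattice_mk (fun γ (hγ : γ ∈ integralPoints S d (SL S d) (SL_le_UL S d)) => hγ.2) g

/-- The Siegel transform `f̃(Λ) = ∑_{v ∈ Λ - {0}} f(v)`. -/
def siegelTransform {S : Finset Nat.Primes} {d : ℕ} (f : (Fin d → QS S) → ℝ)
    (Λ : Set (Fin d → QS S)) : ℝ :=
  ∑' v : {v : Fin d → QS S // v ∈ Λ ∧ v ≠ 0}, f v

/-- `ℕ_S`: the positive integers prime to every prime of `S`. -/
def NS (S : Finset Nat.Primes) : Set ℕ :=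
  {q | 0 < q ∧ Nat.gcd q (∏ p ∈ S, (p : ℕ)) = 1}

/-- `ℙ_S`: the products of powers of the primes of `S`. -/
def PS (S : Finset Nat.Primes) : Set ℕ :=
  {n | ∃ m : Nat.Primes → ℕ, n = ∏ p ∈ S, (p : ℕ) ^ m p}

/-- The triples `(q, 𝔭, w)` with `q ∈ ℕ_S`, `𝔭 ∈ ℙ_S`, `w ∈ ℤ - {0}` and `gcd(q𝔭, w) = 1`. -/
def momentIndex (S : Finset Nat.Primes) : Set (ℕ × ℕ × ℤ) :=
  {t | t.1 ∈ NS S ∧ t.2.1 ∈ PS S ∧ t.2.2 ≠ 0 ∧ Int.gcd ((t.1 * t.2.1 : ℕ) : ℤ) t.2.2 = 1}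

/-- The integral `∫ f(q v) f((w/𝔭) v) dv` over `ℚ_S^d`, for `t = (q, 𝔭, w)`. -/
def momentTerm {S : Finset Nat.Primes} {d : ℕ} (f : (Fin d → QS S) → ℝ) (t : ℕ × ℕ × ℤ) : ℝ :=
  ∫ v, f (diag S (t.1 : ℚ) • v) * f (diag S ((t.2.2 : ℚ) / (t.2.1 : ℚ)) • v) ∂(muSd S d)

end SArith

end

/-!
The second moment of the Siegel transform over the space of `S`-lattices is computed by averaging
over Hecke operators, which makes reduction theory and the integrability of the Siegel transform
over a fundamental domain unnecessary.

Let `ℓ ∉ S` be a prime, and let `c` be a diagonal matrix of determinant `ℓ⁻¹` that multiplies the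
real components by `t = ℓ^(-1/d)` and the `p`-adic ones by units. For a non-zero vector `a` over
`𝔽_ℓ`, the vectors `c g z` with `z ∈ ℤ_S^d` and `a ⬝ z ≡ 0 mod ℓ` form again an `S`-lattice in the
`G`-orbit. Choosing `a` at random defines a probability kernel on `G/Γ`, which commutes with the
action of `G` up to conjugation by `c`. It therefore preserves `m`, because the invariant
probability measure on `G/Γ` is unique (`invariant_probability_unique`, `exists_hecke_kernel`).
Consequently, if the averages of a non-negative function tend to the same constant `L` at every
point as `ℓ → ∞`, its integral is `L`, by Fatou's lemma and Jensen's inequality for truncations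
(`lintegral_eq_of_tendsto_average`, `exists_heckeSequence`).

The averages of sums over lattice vectors are Riemann sums. A non-zero vector of `ℤ_S^d` that is
not divisible by `ℓ` is orthogonal to a proportion of about `1/ℓ = t^d` of the `a`'s, and the sum of
`t^d f(c g z)` over all `z` tends to `∫ f` (`tendsto_riemann_sum`). The vectors with `f(c g z) ≠ 0`
have coordinates of size `O(ℓ^(1/d))`, so that those divisible by `ℓ` do not intervene. This gives
the mean value formula for lattice vectors (`HeckeSequence.tendsto_average_latticeSum`). In the same
way, a pair of vectors independent modulo `ℓ` is orthogonal to a proportion of about `1/ℓ²` of the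
`a`'s. The minors of an independent pair that contributes are of size `O(ℓ^(2/d))`, and `2 < d`, so
that the pair remains independent modulo `ℓ`. Hence the sum of `f(u) f(v)` over the pairs of vectors
of the lattice that are linearly independent over `ℚ` has mean `(∫ f)²`
(`HeckeSequence.tendsto_average_latticePairSum`). Both statements use that `G` preserves the measure
of `ℚ_S^d`, which follows from the existence of `m` (`modulus_eq_one`).

The pairs of dependent non-zero vectors are parametrized uniquely by `(q u, (w/𝔭) u)`, where `u` is
a non-zero lattice vector and `w/(q𝔭)` is the ratio of the two vectors in lowest terms, the
denominator being split into its parts prime to `S` and composed of primes of `S`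
(`tsum_puncture_sq`). The mean value formula for `v ↦ f(q v) f((w/𝔭) v)` turns the sum over `u` into
the terms of the series.

Finally the series converges: after the measure-preserving substitution `v = 𝔭 u` the integrand is
supported in a box with real sides `O(1 / max(q𝔭, |w|))`, because at each prime of `S` one of
`q𝔭` and `w` is a unit; and `max(q𝔭, |w|)^(-3) ≤ (q𝔭)^(-3/2) |w|^(-3/2)`
(`tsum_lintegral_momentFun_ne_top`).
-/

noncomputable section

namespace SArith

open Filter Topology Set
open scoped ENNReal NNReal

/-! ### Averaging operators and invariant probability measures -/

/-- A probability measure `m` which is stationary under probability kernels `κ n` integrates `Φ` to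
the pointwise limit of the averages `∫ Φ dκ n x`. No integrability of `Φ` is assumed: the lower
bound is Fatou's lemma, the upper bound is Jensen's inequality for the truncations `min Φ N`. -/
theorem lintegral_eq_of_tendsto_average {X : Type*} [MeasurableSpace X] (m : Measure X)
    [IsProbabilityMeasure m] (κ : ℕ → X → Measure X) (hκ : ∀ n, Measurable (κ n))
    (hκ1 : ∀ n x, IsProbabilityMeasure (κ n x)) (hm : ∀ n, m.bind (κ n) = m)
    (Φ : X → ℝ≥0∞) (hΦ : Measurable Φ) (c : ℝ≥0∞)
    (hlim : ∀ x, Tendsto (fun n => ∫⁻ y, Φ y ∂κ n x) atTop (𝓝 c)) :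
    ∫⁻ x, Φ x ∂m = c := by
  have key : ∀ (Ψ : X → ℝ≥0∞), Measurable Ψ → ∀ n, ∫⁻ x, ∫⁻ y, Ψ y ∂κ n x ∂m = ∫⁻ x, Ψ x ∂m := by
    intro Ψ hΨ n
    rw [← Measure.lintegral_bind (hκ n).aemeasurable hΨ.aemeasurable, hm n]
  have hmeas : ∀ (Ψ : X → ℝ≥0∞), Measurable Ψ → ∀ n, Measurable fun x => ∫⁻ y, Ψ y ∂κ n x :=
    fun Ψ hΨ n => (Measure.measurable_lintegral hΨ).comp (hκ n)
  apply le_antisymm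
  · have hN : ∀ N : ℕ, ∫⁻ x, min (Φ x) N ∂m ≤ c := by
      intro N
      have h1 : Tendsto (fun n => ∫⁻ x, min (∫⁻ y, Φ y ∂κ n x) N ∂m) atTop
          (𝓝 (∫⁻ _, min c N ∂m)) := by
        refine tendsto_lintegral_of_dominated_convergence (fun _ => (N : ℝ≥0∞))
          (fun n => (hmeas Φ hΦ n).min measurable_const)
          (fun n => Eventually.of_forall fun x => min_le_right _ _) (by simp) ?_
        exact Eventually.of_forall fun x => (hlim x).min tendsto_const_nhds
      rw [lintegral_const, measure_univ, mul_one] at h1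
      refine (ge_of_tendsto' h1 fun n => ?_).trans (min_le_left c (N : ℝ≥0∞))
      rw [← key _ (hΦ.min measurable_const) n]
      refine lintegral_mono fun x => le_min (lintegral_mono fun y => min_le_left _ _) ?_
      calc ∫⁻ y, min (Φ y) (N : ℝ≥0∞) ∂κ n x ≤ ∫⁻ y, (N : ℝ≥0∞) ∂κ n x :=
            lintegral_mono fun y => min_le_right _ _
        _ = N := by have := hκ1 n x; simp
    have hsup : ∀ x, Φ x = ⨆ N : ℕ, min (Φ x) (N : ℝ≥0∞) := by
      intro x
      have h := (inf_iSup_eq (Φ x) fun N : ℕ => (N : ℝ≥0∞))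
      rw [ENNReal.iSup_natCast, inf_top_eq] at h
      exact h
    calc ∫⁻ x, Φ x ∂m = ∫⁻ x, ⨆ N : ℕ, min (Φ x) (N : ℝ≥0∞) ∂m := by simp_rw [← hsup]
      _ = ⨆ N : ℕ, ∫⁻ x, min (Φ x) (N : ℝ≥0∞) ∂m :=
          lintegral_iSup (fun N => hΦ.min measurable_const) fun a b hab x =>
            min_le_min_left _ (by exact_mod_cast hab)
      _ ≤ c := iSup_le hN
  · calc c = ∫⁻ x, liminf (fun n => ∫⁻ y, Φ y ∂κ n x) atTop ∂m := by
          simp_rw [fun x => (hlim x).liminf_eq]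
          simp
      _ ≤ liminf (fun n => ∫⁻ x, ∫⁻ y, Φ y ∂κ n x ∂m) atTop :=
          lintegral_liminf_le fun n => hmeas Φ hΦ n
      _ = ∫⁻ x, Φ x ∂m := by simp_rw [key Φ hΦ]; exact liminf_const _

section Unique

variable {G X : Type*} [Group G] [TopologicalSpace G] [IsTopologicalGroup G]
  [LocallyCompactSpace G] [SecondCountableTopology G] [MeasurableSpace G] [BorelSpace G]
  [MulAction G X] [MeasurableSpace X] [MeasurableSMul₂ G X] [MulAction.IsPretransitive G X]

/-- Invariant finite measures on a transitive space are ergodic, for Borel sets invariant up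
to null sets. -/
theorem measure_eq_zero_or_compl_of_invariant (m : Measure X) [IsFiniteMeasure m]
    [SMulInvariantMeasure G X m] (A : Set X) (hA : MeasurableSet A)
    (hinv : ∀ g : G, ∀ᵐ x ∂m, g • x ∈ A ↔ x ∈ A) : m A = 0 ∨ m Aᶜ = 0 := by
  let lam : Measure G := Measure.haar
  have hset : MeasurableSet {p : X × G | ¬ (p.2 • p.1 ∈ A ↔ p.1 ∈ A)} := by
    have h1 : MeasurableSet {p : X × G | p.2 • p.1 ∈ A} :=
      (measurable_snd.smul measurable_fst) hA
    have h2 : MeasurableSet {p : X × G | p.1 ∈ A} := measurable_fst hA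
    exact (h1.iff h2).compl
  have h0 : (m.prod lam) {p : X × G | ¬ (p.2 • p.1 ∈ A ↔ p.1 ∈ A)} = 0 := by
    rw [Measure.prod_apply_symm hset]
    refine (lintegral_congr fun g => ?_).trans lintegral_zero
    exact hinv g
  rw [Measure.measure_prod_null hset] at h0
  by_cases hmA : m A = 0
  · exact Or.inl hmA
  right
  obtain ⟨x, hxA, hx⟩ : ∃ x ∈ A, lam {g | ¬ (g • x ∈ A ↔ x ∈ A)} = 0 := by
    by_contra hcon
    exact hmA (measure_mono_null (fun x hx h => hcon ⟨x, hx, h⟩) h0)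
  have hx' : lam {g | g • x ∈ Aᶜ} = 0 := by
    refine measure_mono_null ?_ hx
    intro g hg h
    exact hg (h.2 hxA)
  -- the orbit map through any other point differs by a right translation of `G`
  have hall : ∀ y : X, lam {g | g • y ∈ Aᶜ} = 0 := by
    intro y
    obtain ⟨k, rfl⟩ := MulAction.exists_smul_eq G x y
    have := (measure_mul_right_null lam (s := {g | g • x ∈ Aᶜ}) k).2 hx'
    simpa [smul_smul, Set.preimage] using this
  have hset2 : MeasurableSet {p : X × G | p.2 • p.1 ∈ Aᶜ} :=
    (measurable_snd.smul measurable_fst) hA.compl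
  have h3 : (m.prod lam) {p : X × G | p.2 • p.1 ∈ Aᶜ} = 0 := by
    rw [Measure.prod_apply hset2]
    exact (lintegral_congr fun y => hall y).trans lintegral_zero
  rw [Measure.prod_apply_symm hset2] at h3
  have h4 : ∀ g : G, m ((fun x => (x, g)) ⁻¹' {p : X × G | p.2 • p.1 ∈ Aᶜ}) = m Aᶜ := by
    intro g
    exact SMulInvariantMeasure.measure_preimage_smul g hA.compl
  simp_rw [h4] at h3
  rw [lintegral_const, mul_eq_zero] at h3
  refine h3.resolve_right ?_
  exact (isOpen_univ.measure_pos lam univ_nonempty).ne'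

/-- The invariant probability measure on a transitive space is unique. -/
theorem invariant_probability_unique (m₁ m₂ : Measure X) [IsProbabilityMeasure m₁]
    [IsProbabilityMeasure m₂] [SMulInvariantMeasure G X m₁] [SMulInvariantMeasure G X m₂] :
    m₁ = m₂ := by
  set m : Measure X := m₁ + m₂ with hm
  have : SMulInvariantMeasure G X m := ⟨fun g B hB => by
    simp only [hm, Measure.add_apply]
    rw [SMulInvariantMeasure.measure_preimage_smul g hB,
      SMulInvariantMeasure.measure_preimage_smul g hB]⟩
  have hac : m₁ ≪ m := Measure.absolutelyContinuous_of_le (Measure.le_add_right le_rfl)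
  set h := m₁.rnDeriv m with hh
  have hmeas : Measurable h := Measure.measurable_rnDeriv _ _
  have hset : ∀ B, ∫⁻ x in B, h x ∂m = m₁ B := fun B => Measure.setLIntegral_rnDeriv hac B
  have hinv : ∀ g : G, (fun x => h (g • x)) =ᵐ[m] h := by
    intro g
    refine ae_eq_of_forall_setLIntegral_eq_of_sigmaFinite
      (hmeas.comp (measurable_const_smul g)) hmeas fun B hB _ => ?_
    have hB' : MeasurableSet ((fun x : X => g⁻¹ • x) ⁻¹' B) := measurable_const_smul g⁻¹ hB
    have hpre : (fun x : X => g • x) ⁻¹' ((fun x : X => g⁻¹ • x) ⁻¹' B) = B := by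
      ext x; simp
    calc ∫⁻ x in B, h (g • x) ∂m
        = ∫⁻ x in (fun x : X => g • x) ⁻¹' ((fun x : X => g⁻¹ • x) ⁻¹' B), h (g • x) ∂m := by
          rw [hpre]
      _ = ∫⁻ x in (fun x : X => g⁻¹ • x) ⁻¹' B, h x ∂m :=
          (measurePreserving_smul g m).setLIntegral_comp_preimage hB' hmeas
      _ = m₁ B := by
          rw [hset, SMulInvariantMeasure.measure_preimage_smul g⁻¹ hB]
      _ = ∫⁻ x in B, h x ∂m := (hset B).symm
  -- the density is almost everywhere at most `1/2`, or almost everywhere more than `1/2`, so that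
  -- one of the measures dominates the other
  have hA : MeasurableSet {x | h x ≤ 2⁻¹} := measurableSet_le hmeas measurable_const
  have herg := measure_eq_zero_or_compl_of_invariant (G := G) m {x | h x ≤ 2⁻¹} hA fun g => by
    filter_upwards [hinv g] with x hx
    simp only [hx]
  have htwo : ∀ B, (2 : ℝ≥0∞)⁻¹ * m B + 2⁻¹ * m B = m B := fun B => by
    rw [← add_mul, ENNReal.inv_two_add_inv_two, one_mul]
  have huniv : m₁ univ = m₂ univ := by simp
  have hhalf : ∀ B, ∫⁻ _ in B, (2 : ℝ≥0∞)⁻¹ ∂m = 2⁻¹ * m B := fun B => setLIntegral_const _ _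
  have hadd : ∀ B, m B = m₁ B + m₂ B := fun B => by simp [hm]
  rcases herg with h0 | h0
  · symm
    refine Measure.eq_of_le_of_measure_univ_eq (Measure.le_iff'.2 fun B => ?_) huniv.symm
    have h1 : 2⁻¹ * m B ≤ m₁ B := by
      rw [← hset, ← hhalf]
      refine lintegral_mono_ae (ae_restrict_of_ae ?_)
      filter_upwards [measure_eq_zero_iff_ae_notMem.1 h0] with x hx
      exact (not_le.1 hx).le
    have h2 : m₁ B + m₂ B ≤ m₁ B + m₁ B := by
      rw [← hadd, ← htwo]; exact add_le_add h1 h1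
    exact (ENNReal.add_le_add_iff_left (measure_ne_top _ _)).1 h2
  · refine Measure.eq_of_le_of_measure_univ_eq (Measure.le_iff'.2 fun B => ?_) huniv
    have h1 : m₁ B ≤ 2⁻¹ * m B := by
      rw [← hset, ← hhalf]
      refine lintegral_mono_ae (ae_restrict_of_ae ?_)
      filter_upwards [measure_eq_zero_iff_ae_notMem.1 h0] with x hx
      exact not_not.1 hx
    have h2 : m₁ B + m₁ B ≤ m₁ B + m₂ B := by
      rw [← hadd, ← htwo]; exact add_le_add h1 h1
    exact (ENNReal.add_le_add_iff_left (measure_ne_top _ _)).1 h2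

end Unique

/-! ### Haar measures and topology -/

instance isAddHaarMeasure_padicHaar (p : ℕ) [Fact p.Prime] :
    (padicHaar p).IsAddHaarMeasure := by
  unfold padicHaar; infer_instance

instance isAddHaarMeasure_muS (S : Finset Nat.Primes) : (muS S).IsAddHaarMeasure := by
  unfold muS; infer_instance

instance isAddHaarMeasure_muSd (S : Finset Nat.Primes) (d : ℕ) :
    (muSd S d).IsAddHaarMeasure :=
  Measure.pi.isAddHaarMeasure fun _ => muS S

instance regular_muSd (S : Finset Nat.Primes) (d : ℕ) : (muSd S d).Regular := inferInstance

variable {S : Finset Nat.Primes} {d : ℕ}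

theorem isClosedEmbedding_embedProduct_GLS :
    IsClosedEmbedding (Units.embedProduct (Matrix (Fin d) (Fin d) (QS S))) :=
  Units.isClosedEmbedding_embedProduct

instance polishSpace_GLS : PolishSpace (GLS S d) := by
  have h1 : PolishSpace (Matrix (Fin d) (Fin d) (QS S)) :=
    have : PolishSpace (Fin d → QS S) := inferInstance
    have h2 : SecondCountableTopology (Fin d → Fin d → QS S) := inferInstance
    have h3 : TopologicalSpace.IsCompletelyMetrizableSpace (Fin d → Fin d → QS S) := inferInstance
    (inferInstance : PolishSpace (Fin d → Fin d → QS S))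
  have : PolishSpace (Matrix (Fin d) (Fin d) (QS S))ᵐᵒᵖ :=
    MulOpposite.opHomeomorph.symm.isClosedEmbedding.polishSpace
  exact isClosedEmbedding_embedProduct_GLS.polishSpace

instance locallyCompactSpace_GLS : LocallyCompactSpace (GLS S d) := by
  have h1 : LocallyCompactSpace (Matrix (Fin d) (Fin d) (QS S)) :=
    inferInstanceAs (LocallyCompactSpace (Fin d → Fin d → QS S))
  have : LocallyCompactSpace (Matrix (Fin d) (Fin d) (QS S))ᵐᵒᵖ :=
    MulOpposite.opHomeomorph.symm.isClosedEmbedding.locallyCompactSpace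
  exact isClosedEmbedding_embedProduct_GLS.locallyCompactSpace

theorem continuous_entry (i j : Fin d) : Continuous fun g : GLS S d => g.val i j :=
  Units.continuous_val.matrix_elem i j

theorem continuous_det_GLS : Continuous fun g : GLS S d => g.val.det :=
  Continuous.matrix_det Units.continuous_val

theorem isClosed_SL : IsClosed (SL S d : Set (GLS S d)) :=
  isClosed_eq continuous_det_GLS continuous_const

theorem isClosed_UL : IsClosed (UL S d : Set (GLS S d)) := by
  have h : (UL S d : Set (GLS S d)) =
      {g | g.val.det.1 = 1} ∩ ⋂ p : S, {g | ‖g.val.det.2 p‖ = 1} := by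
    ext g
    simp only [mem_inter_iff, mem_iInter]
    rfl
  rw [h]
  exact (isClosed_eq (continuous_fst.comp continuous_det_GLS) continuous_const).inter
    (isClosed_iInter fun p => isClosed_eq
      (((continuous_apply p).comp (continuous_snd.comp continuous_det_GLS)).norm) continuous_const)

theorem inv_mulVec_mulVec (g : GLS S d) (v : Fin d → QS S) : (g⁻¹).val *ᵥ (g.val *ᵥ v) = v := by
  rw [Matrix.mulVec_mulVec, ← Units.val_mul, inv_mul_cancel, Units.val_one, Matrix.one_mulVec]

theorem mulVec_inv_mulVec (g : GLS S d) (v : Fin d → QS S) : g.val *ᵥ ((g⁻¹).val *ᵥ v) = v := by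
  rw [Matrix.mulVec_mulVec, ← Units.val_mul, mul_inv_cancel, Units.val_one, Matrix.one_mulVec]

theorem mulVec_injective (g : GLS S d) : Function.Injective fun v => g.val *ᵥ v :=
  fun u v h => by
    rw [← inv_mulVec_mulVec g u, ← inv_mulVec_mulVec g v]
    exact congrArg _ h

/-- The automorphism `v ↦ g v` of the additive group `ℚ_S^d`. -/
def actEquiv (g : GLS S d) : (Fin d → QS S) ≃ₜ+ (Fin d → QS S) where
  toFun v := g.val *ᵥ v
  invFun v := (g⁻¹).val *ᵥ v
  left_inv v := inv_mulVec_mulVec g v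
  right_inv v := mulVec_inv_mulVec g v
  map_add' := Matrix.mulVec_add _
  continuous_toFun := Continuous.matrix_mulVec continuous_const continuous_id
  continuous_invFun := Continuous.matrix_mulVec continuous_const continuous_id

/-- The factor by which `g` scales the Haar measure of `ℚ_S^d`. -/
def modulus (g : GLS S d) : ℝ≥0 := addEquivAddHaarChar (actEquiv g)

theorem modulus_pos (g : GLS S d) : 0 < modulus g := addEquivAddHaarChar_pos _

theorem modulus_mul (g h : GLS S d) : modulus (g * h) = modulus g * modulus h := by
  have : actEquiv (g * h) = (actEquiv h).trans (actEquiv g) := by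
    ext v : 1
    exact (Matrix.mulVec_mulVec v g.val h.val).symm
  rw [modulus, this, addEquivAddHaarChar_trans, mul_comm]; rfl

theorem modulus_one : modulus (1 : GLS S d) = 1 := by
  have h := modulus_mul (1 : GLS S d) 1
  rw [mul_one] at h
  exact (mul_eq_left₀ (modulus_pos _).ne').1 h.symm

theorem lintegral_mulVec (g : GLS S d) (F : (Fin d → QS S) → ℝ≥0∞) :
    modulus g * ∫⁻ v, F (g.val *ᵥ v) ∂muSd S d = ∫⁻ v, F v ∂muSd S d := by
  have h := addEquivAddHaarChar_smul_map (muSd S d) (actEquiv g)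
  have hme : MeasurableEmbedding (actEquiv g) := (actEquiv g).toHomeomorph.measurableEmbedding
  conv_rhs => rw [← h]
  have h2 := lintegral_smul_measure (addEquivAddHaarChar (actEquiv g) : ℝ≥0∞) F
    (μ := Measure.map (actEquiv g) (muSd S d))
  rw [hme.lintegral_map] at h2
  exact h2.symm

theorem muSd_preimage (g : GLS S d) (B : Set (Fin d → QS S)) :
    modulus g * muSd S d ((fun v => g.val *ᵥ v) ⁻¹' B) = muSd S d B := by
  have h := addEquivAddHaarChar_smul_map (muSd S d) (actEquiv g)
  have hme : MeasurableEmbedding (actEquiv g) := (actEquiv g).toHomeomorph.measurableEmbedding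
  conv_rhs => rw [← h]
  rw [Measure.smul_apply, hme.map_apply]
  rfl

/-! ### Arithmetic of `S`-integers -/

theorem padicNorm_le_one_iff (p : ℕ) [hp : Fact p.Prime] (z : ℚ) :
    padicNorm p z ≤ 1 ↔ ¬ p ∣ z.den := by
  have hmul : padicNorm p z * padicNorm p (z.den : ℚ) = padicNorm p (z.num : ℚ) := by
    rw [← padicNorm.mul, Rat.mul_den_eq_num]
  constructor
  · intro h hd
    have h1 : padicNorm p (z.den : ℚ) < 1 := (padicNorm.nat_lt_one_iff _).2 hd
    have h2 : padicNorm p (z.num : ℚ) < 1 := by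
      rw [← hmul]
      exact mul_lt_one_of_nonneg_of_lt_one_right h (padicNorm.nonneg _) h1
    rw [padicNorm.int_lt_one_iff] at h2
    have h3 : p ∣ z.num.natAbs := Int.natCast_dvd.1 h2
    exact hp.out.one_lt.ne' (Nat.dvd_one.1 (z.reduced ▸ Nat.dvd_gcd h3 hd))
  · intro h
    rw [(padicNorm.nat_eq_one_iff _).2 h, mul_one] at hmul
    rw [hmul]
    exact padicNorm.of_int _

theorem padicNorm_pos {p : ℕ} [Fact p.Prime] {z : ℚ} (hz : z ≠ 0) : 0 < padicNorm p z :=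
  lt_of_le_of_ne (padicNorm.nonneg z) (padicNorm.nonzero hz).symm

/-- A rational number which is integral at every prime is an integer. -/
theorem exists_int_of_padicNorm_le_one {z : ℚ} (h : ∀ p : Nat.Primes, padicNorm p z ≤ 1) :
    ∃ n : ℤ, z = n := by
  have : z.den = 1 := by
    by_contra hne
    obtain ⟨p, hp, hd⟩ := Nat.exists_prime_and_dvd hne
    have : Fact p.Prime := ⟨hp⟩
    exact (padicNorm_le_one_iff p z).1 (h ⟨p, hp⟩) hd
  exact ⟨z.num, (Rat.den_eq_one_iff z).1 this |>.symm⟩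

theorem primes_eq_of_dvd {p q : Nat.Primes} (h : (p : ℕ) ∣ (q : ℕ)) : p = q :=
  Subtype.ext ((Nat.prime_dvd_prime_iff_eq p.2 q.2).1 h)

/-- `ℤ_S` as a subring of `ℚ`. -/
def ratZS (S : Finset Nat.Primes) : Subring ℚ where
  carrier := {z | ∀ p : Nat.Primes, p ∉ S → padicNorm p z ≤ 1}
  mul_mem' := by
    intro y z hy hz p hp
    rw [padicNorm.mul]
    exact mul_le_one₀ (hy p hp) (padicNorm.nonneg z) (hz p hp)
  one_mem' := fun p _ => by simp
  add_mem' := by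
    intro y z hy hz p hp
    exact padicNorm.nonarchimedean.trans (max_le (hy p hp) (hz p hp))
  zero_mem' := fun p _ => by simp
  neg_mem' := by
    intro z hz p hp
    simpa using hz p hp

theorem intCast_mem_ratZS (n : ℤ) : (n : ℚ) ∈ ratZS S := fun p _ => padicNorm.of_int (p := p) n

theorem natCast_mem_ratZS (n : ℕ) : (n : ℚ) ∈ ratZS S := fun p _ => padicNorm.of_nat (p := p) n

@[simp] theorem diag_fst (z : ℚ) : (diag S z).1 = (z : ℝ) := rfl

theorem norm_diag_snd (z : ℚ) (p : S) : ‖(diag S z).2 p‖ = (padicNorm p z : ℝ) :=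
  Padic.eq_padicNorm z

theorem diag_injective : Function.Injective (diag S) := (diag S).injective

theorem mem_ZS_iff {x : QS S} : x ∈ ZS S ↔ ∃ z : ratZS S, x = diag S z :=
  ⟨fun ⟨z, hz, hx⟩ => ⟨⟨z, hz⟩, hx⟩, fun ⟨z, hx⟩ => ⟨z, z.2, hx⟩⟩

/-- `S`-integers with bounded `p`-adic absolute values, `p ∈ S`, have a common denominator. -/
theorem exists_common_denominator (S : Finset Nat.Primes) (C : ℝ) :
    ∃ M : ℕ, 0 < M ∧ (∀ p : Nat.Primes, p ∉ S → ¬ (p : ℕ) ∣ M) ∧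
      ∀ z : ratZS S, (∀ p : S, ‖(diag S z).2 p‖ ≤ C) → ∃ n : ℤ, (z : ℚ) * M = n := by
  obtain ⟨k, hk⟩ := pow_unbounded_of_one_lt C (one_lt_two)
  refine ⟨∏ p ∈ S, (p : ℕ) ^ k, Finset.prod_pos fun p _ => pow_pos p.2.pos _, ?_, ?_⟩
  · intro p hp hdvd
    obtain ⟨q, hq, h⟩ := (Prime.dvd_finsetProd_iff p.2.prime _).1 hdvd
    exact hp (primes_eq_of_dvd (p.2.dvd_of_dvd_pow h) ▸ hq)
  · intro z hz
    refine exists_int_of_padicNorm_le_one fun p => ?_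
    rw [padicNorm.mul]
    by_cases hp : p ∈ S
    · have hzp : (padicNorm p (z : ℚ) : ℝ) ≤ C := by
        have := hz ⟨p, hp⟩
        rwa [norm_diag_snd] at this
      have h2 : padicNorm p (z : ℚ) ≤ (p : ℚ) ^ k := by
        have hpk : (2 : ℝ) ^ k ≤ (p : ℝ) ^ k :=
          pow_le_pow_left₀ (by norm_num) (by exact_mod_cast p.2.two_le) k
        have : (padicNorm p (z : ℚ) : ℝ) ≤ (p : ℝ) ^ k := hzp.trans (hk.le.trans hpk)
        exact_mod_cast this
      have h3 : padicNorm p ((∏ q ∈ S, (q : ℕ) ^ k : ℕ) : ℚ) ≤ (p : ℚ) ^ (-k : ℤ) := by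
        rw [← Int.cast_natCast]
        exact (padicNorm.dvd_iff_norm_le).1 (by exact_mod_cast Finset.dvd_prod_of_mem _ hp)
      calc _ ≤ (p : ℚ) ^ k * (p : ℚ) ^ (-k : ℤ) :=
            mul_le_mul h2 h3 (padicNorm.nonneg _) (by positivity)
        _ = 1 := by
            have : (p : ℚ) ≠ 0 := by exact_mod_cast p.2.ne_zero
            rw [zpow_neg, zpow_natCast]; exact mul_inv_cancel₀ (pow_ne_zero _ this)
    · exact mul_le_one₀ (z.2 p hp) (padicNorm.nonneg _) (padicNorm.of_nat _)

/-- A `p`-adic number is congruent modulo `ℤ_p` to a rational number whose denominator is a power of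
`p`. -/
theorem exists_rat_approx (p : ℕ) [hp : Fact p.Prime] (x : ℚ_[p]) :
    ∃ z : ℚ, (∀ q : Nat.Primes, (q : ℕ) ≠ p → padicNorm q z ≤ 1) ∧ ‖(z : ℚ_[p]) + x‖ ≤ 1 := by
  have hp1 : (1 : ℝ) < p := by exact_mod_cast hp.out.one_lt
  obtain ⟨k, hk⟩ := pow_unbounded_of_one_lt ‖x‖ hp1
  have hpos : (0 : ℝ) < (p : ℝ) ^ k := by positivity
  have hnk : ‖((p : ℚ_[p]) ^ k)‖ = ((p : ℝ) ^ k)⁻¹ := by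
    rw [norm_pow, Padic.norm_p, inv_pow]
  have hy : ‖((p : ℚ_[p]) ^ k) * (-x)‖ ≤ 1 := by
    rw [norm_mul, norm_neg, hnk, inv_mul_le_iff₀ hpos, mul_one]
    exact hk.le
  obtain ⟨y, hyv⟩ : ∃ y : ℤ_[p], (y : ℚ_[p]) = ((p : ℚ_[p]) ^ k) * (-x) := ⟨⟨_, hy⟩, rfl⟩
  obtain ⟨a, ha⟩ := (PadicInt.denseRange_intCast (p := p)).exists_dist_lt y
    (ε := ((p : ℝ) ^ k)⁻¹) (by positivity)
  refine ⟨(a : ℚ) / (p : ℚ) ^ k, fun q hq => ?_, ?_⟩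
  · have : padicNorm q ((p : ℚ) ^ k) = 1 := by
      rw [← Nat.cast_pow]
      refine (padicNorm.nat_eq_one_iff _).2 fun h => hq ?_
      exact (Nat.prime_dvd_prime_iff_eq q.2 hp.out).1 (q.2.dvd_of_dvd_pow h)
    rw [padicNorm.div, this, div_one]
    exact padicNorm.of_int _
  · have hne : ((p : ℚ_[p]) ^ k) ≠ 0 := pow_ne_zero _ (by exact_mod_cast hp.out.ne_zero)
    rw [dist_eq_norm, PadicInt.norm_def] at ha
    have e : (((a : ℚ) / (p : ℚ) ^ k : ℚ) : ℚ_[p]) + x =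
        -(((p : ℚ_[p]) ^ k)⁻¹ * (((p : ℚ_[p]) ^ k) * (-x) - (a : ℚ_[p]))) := by
      push_cast
      field_simp
      ring
    rw [e, norm_neg, norm_mul, norm_inv, hnk, inv_inv]
    have ha' : ‖((p : ℚ_[p]) ^ k) * (-x) - (a : ℚ_[p])‖ < ((p : ℝ) ^ k)⁻¹ := by
      simpa [hyv] using ha
    calc _ ≤ (p : ℝ) ^ k * ((p : ℝ) ^ k)⁻¹ := by gcongr
      _ = 1 := mul_inv_cancel₀ hpos.ne'

/-- Approximation by `S`-integers at all the primes of `S` simultaneously. -/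
theorem exists_ratZS_approx (x : (p : S) → ℚ_[(p.1 : ℕ)]) :
    ∃ z : ratZS S, ∀ p : S, ‖(diag S z).2 p + x p‖ ≤ 1 := by
  have h1 : ∀ p : S, ∃ z : ℚ, (∀ q : Nat.Primes, q ≠ p.1 → padicNorm q z ≤ 1) ∧
      ‖((z : ℚ) : ℚ_[(p.1 : ℕ)]) + x p‖ ≤ 1 := by
    intro p
    obtain ⟨z, h, h'⟩ := exists_rat_approx p.1 (x p)
    exact ⟨z, fun q hq => h q fun e => hq (Subtype.ext e), h'⟩
  choose z hz1 hz2 using h1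
  have hmem : ∀ p : S, z p ∈ ratZS S := fun p q hq => hz1 p q fun h => hq (h ▸ p.2)
  refine ⟨⟨∑ p : S, z p, Subring.sum_mem _ fun p _ => hmem p⟩, fun p => ?_⟩
  have e : (diag S (∑ q : S, z q)).2 p + x p =
      (((z p : ℚ) : ℚ_[(p.1 : ℕ)]) + x p) + ((∑ q ∈ Finset.univ.erase p, z q : ℚ) :
        ℚ_[(p.1 : ℕ)]) := by
    have : (diag S (∑ q : S, z q)).2 p = ((∑ q : S, z q : ℚ) : ℚ_[(p.1 : ℕ)]) := rfl
    rw [this, ← Finset.add_sum_erase _ _ (Finset.mem_univ p)]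
    push_cast
    ring
  refine (congrArg norm e).le.trans ((Padic.nonarchimedean _ _).trans (max_le (hz2 p) ?_))
  rw [Padic.eq_padicNorm]
  have : padicNorm p (∑ q ∈ Finset.univ.erase p, z q) ≤ 1 :=
    padicNorm.sum_le' (fun q hq => hz1 q p.1 fun h => (Finset.ne_of_mem_erase hq)
      (Subtype.ext h.symm)) zero_le_one
  exact_mod_cast this

/-! ### Fundamental domains for the lattice of `S`-integral vectors -/

/-- The embedding of `ℤ_S^d` in `ℚ_S^d`. -/
def emb (S : Finset Nat.Primes) (d : ℕ) : (Fin d → ratZS S) →+ (Fin d → QS S) where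
  toFun z i := diag S (z i)
  map_zero' := by ext i : 1; simp
  map_add' y z := by ext i : 1; simp

@[simp] theorem emb_apply (z : Fin d → ratZS S) (i : Fin d) : emb S d z i = diag S (z i) := rfl

theorem emb_injective : Function.Injective (emb S d) := fun y z h => by
  ext i : 1
  exact Subtype.ext (diag_injective (congrFun h i))

/-- The lattice `ℤ_S^d` in `ℚ_S^d`. -/
def stdLattice (S : Finset Nat.Primes) (d : ℕ) : AddSubgroup (Fin d → QS S) := (emb S d).range

instance : Countable (stdLattice S d) :=
  (emb S d).rangeRestrict_surjective.countable

/-- The vectors with real components in `A` and `p`-adic components of absolute value at most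
`ρ p`. -/
def box (S : Finset Nat.Primes) (d : ℕ) (A : Set ℝ) (ρ : S → ℝ) : Set (Fin d → QS S) :=
  {v | ∀ i, (v i).1 ∈ A ∧ ∀ p, ‖(v i).2 p‖ ≤ ρ p}

theorem box_eq_pi (A : Set ℝ) (ρ : S → ℝ) :
    box S d A ρ = Set.pi univ fun _ => A ×ˢ Set.pi univ fun p : S => Metric.closedBall 0 (ρ p) := by
  ext v
  simp [box, Set.mem_pi]

theorem measurableSet_box {A : Set ℝ} (hA : MeasurableSet A) (ρ : S → ℝ) :
    MeasurableSet (box S d A ρ) := by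
  rw [box_eq_pi]
  exact MeasurableSet.univ_pi fun _ =>
    hA.prod (MeasurableSet.univ_pi fun p => Metric.isClosed_closedBall.measurableSet)

theorem muSd_box (A : Set ℝ) (ρ : S → ℝ) :
    muSd S d (box S d A ρ) =
      (volume A * ∏ p : S, padicHaar (p.1 : ℕ) (Metric.closedBall 0 (ρ p))) ^ d := by
  rw [box_eq_pi, muSd, Measure.pi_pi, muS, Measure.prod_prod, Measure.pi_pi]
  simp

theorem padicHaar_closedBall_one (p : ℕ) [Fact p.Prime] :
    padicHaar p (Metric.closedBall 0 1) = 1 :=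
  Measure.addHaarMeasure_self (K₀ := unitBall p)

theorem muSd_box_one (A : Set ℝ) : muSd S d (box S d A fun _ => 1) = volume A ^ d := by
  rw [muSd_box]
  simp [padicHaar_closedBall_one]

/-- The set `[0, 1) × ∏ ℤ_p` is a fundamental domain for `ℤ_S` in `ℚ_S`. -/
theorem existsUnique_ratZS (x : QS S) :
    ∃! z : ratZS S, (diag S z + x).1 ∈ Ico (0 : ℝ) 1 ∧ ∀ p, ‖(diag S z + x).2 p‖ ≤ 1 := by
  obtain ⟨z, hz⟩ := exists_ratZS_approx x.2
  have hint : ∀ (n : ℤ) (p : S), ‖(diag S n).2 p‖ ≤ 1 := fun n p => by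
    rw [norm_diag_snd]
    exact_mod_cast padicNorm.of_int n
  set n : ℤ := ⌊((z : ℚ) : ℝ) + x.1⌋ with hn
  have hsol : (diag S ((z - ⟨(n : ℚ), intCast_mem_ratZS n⟩ : ratZS S) : ℚ) + x).1 ∈ Ico (0 : ℝ) 1 ∧
      ∀ p, ‖(diag S ((z - ⟨(n : ℚ), intCast_mem_ratZS n⟩ : ratZS S) : ℚ) + x).2 p‖ ≤ 1 := by
    refine ⟨?_, fun p => ?_⟩
    · have e : (diag S ((z - ⟨(n : ℚ), intCast_mem_ratZS n⟩ : ratZS S) : ℚ) + x).1 =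
          Int.fract (((z : ℚ) : ℝ) + x.1) := by
        rw [Int.fract, ← hn]
        simp
        ring
      rw [e]
      exact ⟨Int.fract_nonneg _, Int.fract_lt_one _⟩
    · have e : (diag S ((z - ⟨(n : ℚ), intCast_mem_ratZS n⟩ : ratZS S) : ℚ) + x).2 p =
          ((diag S z).2 p + x.2 p) + -(diag S n).2 p := by
        simp
        ring
      rw [e]
      refine (Padic.nonarchimedean _ _).trans (max_le (hz p) ?_)
      rw [norm_neg]
      exact hint n p
  refine ⟨z - ⟨(n : ℚ), intCast_mem_ratZS n⟩, hsol, ?_⟩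
  · intro y hy
    -- the difference of two solutions is an integer of absolute value less than one
    have key : ∀ y y' : ratZS S,
        ((diag S y + x).1 ∈ Ico (0 : ℝ) 1 ∧ ∀ p, ‖(diag S y + x).2 p‖ ≤ 1) →
        ((diag S y' + x).1 ∈ Ico (0 : ℝ) 1 ∧ ∀ p, ‖(diag S y' + x).2 p‖ ≤ 1) → y = y' := by
      intro y y' hy hy'
      have hp : ∀ p : Nat.Primes, padicNorm p ((y : ℚ) - y') ≤ 1 := by
        intro p
        by_cases hpS : p ∈ S
        · have h1 : ‖(diag S ((y : ℚ) - y')).2 ⟨p, hpS⟩‖ ≤ 1 := by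
            have e : (diag S ((y : ℚ) - y')).2 ⟨p, hpS⟩ =
                (diag S y + x).2 ⟨p, hpS⟩ + -(diag S y' + x).2 ⟨p, hpS⟩ := by
              simp [sub_eq_add_neg]
            rw [e]
            refine (Padic.nonarchimedean _ _).trans (max_le (hy.2 _) ?_)
            rw [norm_neg]
            exact hy'.2 _
          rw [norm_diag_snd] at h1
          exact_mod_cast h1
        · exact (y - y').2 p hpS
      obtain ⟨k, hk⟩ := exists_int_of_padicNorm_le_one hp
      have h1 : (((y : ℚ) : ℝ) - ((y' : ℚ) : ℝ)) = k := by
        exact_mod_cast congrArg (Rat.cast (K := ℝ)) hk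
      obtain ⟨⟨h2, h3⟩, -⟩ := hy
      obtain ⟨⟨h4, h5⟩, -⟩ := hy'
      simp only [Prod.fst_add, diag_fst] at h2 h3 h4 h5
      have h6 : (k : ℝ) < 1 := by linarith
      have h7 : (-1 : ℝ) < k := by linarith
      have h8 : k < 1 := by exact_mod_cast h6
      have h9 : -1 < k := by exact_mod_cast h7
      have h0 : k = 0 := by omega
      rw [h0, Int.cast_zero, sub_eq_zero] at hk
      exact Subtype.ext hk
    exact key _ _ hy hsol

/-- Rescaling by a unit `u` of `ℤ_S` gives fundamental domains which are `p`-adically small. -/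
theorem existsUnique_ratZS_unit {u : ℚ} (hu0 : 0 < u) (hu : u ∈ ratZS S) (hu' : u⁻¹ ∈ ratZS S)
    (x : QS S) : ∃! z : ratZS S, (diag S z + x).1 ∈ Ico (0 : ℝ) u ∧
      ∀ p : S, ‖(diag S z + x).2 p‖ ≤ ‖(diag S u).2 p‖ := by
  have hu0' : (0 : ℝ) < u := by exact_mod_cast hu0
  have hup : ∀ p : S, 0 < ‖(diag S u).2 p‖ := fun p => by
    rw [norm_diag_snd]; exact_mod_cast padicNorm_pos hu0.ne'
  have huu : diag S u * diag S u⁻¹ = 1 := by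
    rw [← map_mul, mul_inv_cancel₀ hu0.ne', map_one]
  -- `z` solves the problem for `x` and `u` if and only if `u⁻¹ z` does for `u⁻¹ x` and `1`
  have key : ∀ z : ratZS S, ((diag S z + x).1 ∈ Ico (0 : ℝ) u ∧
      ∀ p : S, ‖(diag S z + x).2 p‖ ≤ ‖(diag S u).2 p‖) ↔
      ((diag S ((⟨u⁻¹, hu'⟩ * z : ratZS S) : ℚ) + diag S u⁻¹ * x).1 ∈ Ico (0 : ℝ) 1 ∧
      ∀ p : S, ‖(diag S ((⟨u⁻¹, hu'⟩ * z : ratZS S) : ℚ) + diag S u⁻¹ * x).2 p‖ ≤ 1) := by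
    intro z
    have e : diag S z + x =
        diag S u * (diag S ((⟨u⁻¹, hu'⟩ * z : ratZS S) : ℚ) + diag S u⁻¹ * x) := by
      rw [Subring.coe_mul, map_mul, ← mul_add, ← mul_assoc, huu, one_mul]
    rw [e]
    refine and_congr ?_ (forall_congr' fun p => ?_)
    · rw [Prod.fst_mul, diag_fst, mem_Ico, mem_Ico]
      refine and_congr (mul_nonneg_iff_of_pos_left hu0') ?_
      rw [mul_lt_iff_lt_one_right hu0']
    · rw [Prod.snd_mul, Pi.mul_apply, norm_mul, mul_le_iff_le_one_right (hup p)]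
  obtain ⟨w, hw, huniq⟩ := existsUnique_ratZS (diag S u⁻¹ * x)
  have hcancel : ∀ z : ratZS S, (⟨u⁻¹, hu'⟩ * (⟨u, hu⟩ * z) : ratZS S) = z := fun z =>
    Subtype.ext (inv_mul_cancel_left₀ hu0.ne' _)
  refine ⟨⟨u, hu⟩ * w, (key _).2 ?_, fun y hy => ?_⟩
  · rw [hcancel]; exact hw
  · rw [← huniq _ ((key y).1 hy)]
    exact (Subtype.ext (mul_inv_cancel_left₀ hu0.ne' _)).symm

theorem isAddFundamentalDomain_of_existsUnique {B : Set (Fin d → QS S)} (hB : MeasurableSet B)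
    (h : ∀ v, ∃! z : Fin d → ratZS S, emb S d z + v ∈ B) :
    IsAddFundamentalDomain (stdLattice S d) B (muSd S d) := by
  refine IsAddFundamentalDomain.mk' hB.nullMeasurableSet fun v => ?_
  obtain ⟨z, hz, huniq⟩ := h v
  refine ⟨⟨emb S d z, z, rfl⟩, hz, ?_⟩
  rintro ⟨_, y, rfl⟩ hy
  have := huniq y hy
  subst this
  rfl

theorem existsUnique_emb_unit {u : ℚ} (hu0 : 0 < u) (hu : u ∈ ratZS S) (hu' : u⁻¹ ∈ ratZS S)
    (v : Fin d → QS S) : ∃! z : Fin d → ratZS S,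
      emb S d z + v ∈ box S d (Ico 0 (u : ℝ)) fun p => ‖(diag S u).2 p‖ := by
  choose z hz huniq using fun i => existsUnique_ratZS_unit hu0 hu hu' (v i)
  refine ⟨z, fun i => hz i, fun y hy => funext fun i => huniq i (y i) (hy i)⟩

theorem box_unit_one : (box S d (Ico 0 ((1 : ℚ) : ℝ)) fun p => ‖(diag S 1).2 p‖) =
    box S d (Ico 0 1) fun _ => 1 := by
  simp

theorem isAddFundamentalDomain_box_one :
    IsAddFundamentalDomain (stdLattice S d) (box S d (Ico 0 1) fun _ => 1) (muSd S d) := by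
  rw [← box_unit_one]
  exact isAddFundamentalDomain_of_existsUnique (measurableSet_box measurableSet_Ico _)
    (existsUnique_emb_unit one_pos (Subring.one_mem _) (by simp))

theorem measure_fundamentalDomain {B : Set (Fin d → QS S)}
    (hB : IsAddFundamentalDomain (stdLattice S d) B (muSd S d)) : muSd S d B = 1 := by
  rw [hB.measure_eq isAddFundamentalDomain_box_one, muSd_box_one]
  simp

/-- Automorphisms of the lattice `ℤ_S^d` preserve the measure. -/
theorem modulus_eq_one_of_preserves {h : GLS S d}
    (h1 : ∀ z, ∃ y, h.val *ᵥ emb S d z = emb S d y)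
    (h2 : ∀ y, ∃ z, h.val *ᵥ emb S d z = emb S d y) :
    modulus h = 1 := by
  have hmeas : Measurable fun v : Fin d → QS S => h.val *ᵥ v :=
    (actEquiv h).toHomeomorph.measurable
  have hfd : IsAddFundamentalDomain (stdLattice S d)
      ((fun v => h.val *ᵥ v) ⁻¹' (box S d (Ico 0 1) fun _ => 1)) (muSd S d) := by
    refine isAddFundamentalDomain_of_existsUnique
      (hmeas (measurableSet_box measurableSet_Ico _)) fun v => ?_
    obtain ⟨y, hy, huniq⟩ := existsUnique_emb_unit one_pos (Subring.one_mem (ratZS S))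
      (by simp) (h.val *ᵥ v)
    rw [box_unit_one] at hy huniq
    obtain ⟨z, hz⟩ := h2 y
    refine ⟨z, ?_, fun z' hz' => ?_⟩
    · beta_reduce
      rw [mem_preimage, Matrix.mulVec_add, hz]
      exact hy
    · obtain ⟨y', hy'⟩ := h1 z'
      beta_reduce at hz'
      rw [mem_preimage, Matrix.mulVec_add, hy'] at hz'
      have := huniq y' hz'
      subst this
      exact emb_injective (mulVec_injective h (hy'.trans hz.symm))
  have h3 := muSd_preimage h (box S d (Ico 0 1) fun _ => 1)
  rw [measure_fundamentalDomain hfd, measure_fundamentalDomain isAddFundamentalDomain_box_one,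
    mul_one] at h3
  exact_mod_cast h3

/-! ### Riemann sums over lattices -/

/-- `c` is diagonal, multiplies the real components by `t`, and multiplies the `p`-adic components
by units of `ℤ_p`. -/
def IsContraction (t : ℝ) (c : GLS S d) : Prop :=
  ∃ D : Fin d → QS S, c.val = Matrix.diagonal D ∧ ∀ i, (D i).1 = t ∧ ∀ p, ‖(D i).2 p‖ = 1

theorem IsContraction.fst {t : ℝ} {c : GLS S d} (hc : IsContraction t c) (v : Fin d → QS S)
    (i : Fin d) : ((c.val *ᵥ v) i).1 = t * (v i).1 := by
  obtain ⟨D, hD, h⟩ := hc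
  rw [hD, Matrix.mulVec_diagonal, Prod.fst_mul, (h i).1]

theorem IsContraction.norm_snd {t : ℝ} {c : GLS S d} (hc : IsContraction t c) (v : Fin d → QS S)
    (i : Fin d) (p : S) : ‖((c.val *ᵥ v) i).2 p‖ = ‖(v i).2 p‖ := by
  obtain ⟨D, hD, h⟩ := hc
  rw [hD, Matrix.mulVec_diagonal, Prod.snd_mul, Pi.mul_apply, norm_mul, (h i).2 p, one_mul]

theorem IsContraction.modulus_eq {t : ℝ} (ht : 0 < t) {c : GLS S d} (hc : IsContraction t c) :
    (modulus c : ℝ≥0∞) = ENNReal.ofReal t ^ d := by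
  have h := muSd_preimage c (box S d (Ico 0 t) fun _ => 1)
  have e : (fun v => c.val *ᵥ v) ⁻¹' (box S d (Ico 0 t) fun _ => 1) =
      box S d (Ico 0 1) fun _ => 1 := by
    ext v
    refine forall_congr' fun i => and_congr ?_ (forall_congr' fun p => ?_)
    · rw [hc.fst, mem_Ico, mem_Ico, mul_nonneg_iff_of_pos_left ht, mul_lt_iff_lt_one_right ht]
    · rw [hc.norm_snd]
  rw [e, muSd_box_one, muSd_box_one, Real.volume_Ico, Real.volume_Ico] at h
  simpa using h

theorem mulVec_fst (A : Matrix (Fin d) (Fin d) (QS S)) (v : Fin d → QS S) (i : Fin d) :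
    ((A *ᵥ v) i).1 = ∑ j, (A i j).1 * (v j).1 := by
  simp [Matrix.mulVec, dotProduct, Prod.fst_sum]

theorem mulVec_snd (A : Matrix (Fin d) (Fin d) (QS S)) (v : Fin d → QS S) (i : Fin d) (p : S) :
    ((A *ᵥ v) i).2 p = ∑ j, (A i j).2 p * (v j).2 p := by
  simp [Matrix.mulVec, dotProduct, Prod.snd_sum]

/-- A matrix is bounded at every place. -/
theorem exists_place_bound (A : Matrix (Fin d) (Fin d) (QS S)) : ∃ C : ℝ, 0 < C ∧
    (∀ (r : ℝ) (v : Fin d → QS S), 0 ≤ r → (∀ j, |(v j).1| ≤ r) → ∀ i, |((A *ᵥ v) i).1| ≤ C * r) ∧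
    (∀ (r : ℝ) (v : Fin d → QS S) (p : S), 0 ≤ r → (∀ j, ‖(v j).2 p‖ ≤ r) →
      ∀ i, ‖((A *ᵥ v) i).2 p‖ ≤ C * r) := by
  have hC : ∀ i, ∑ j, ‖A i j‖ ≤ ∑ i, ∑ j, ‖A i j‖ + 1 := fun i =>
    (Finset.single_le_sum (f := fun i => ∑ j, ‖A i j‖)
      (fun i _ => Finset.sum_nonneg fun j _ => norm_nonneg _) (Finset.mem_univ i)).trans
      (le_add_of_nonneg_right zero_le_one)
  refine ⟨∑ i, ∑ j, ‖A i j‖ + 1, by positivity, fun r v hr hv i => ?_, fun r v p hr hv i => ?_⟩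
  · rw [mulVec_fst]
    refine (Finset.abs_sum_le_sum_abs _ _).trans ?_
    refine le_trans ?_ (mul_le_mul_of_nonneg_right (hC i) hr)
    rw [Finset.sum_mul]
    refine Finset.sum_le_sum fun j _ => ?_
    rw [abs_mul]
    exact mul_le_mul (norm_fst_le (A i j)) (hv j) (abs_nonneg _) (norm_nonneg _)
  · rw [mulVec_snd]
    refine (norm_sum_le _ _).trans ?_
    refine le_trans ?_ (mul_le_mul_of_nonneg_right (hC i) hr)
    rw [Finset.sum_mul]
    refine Finset.sum_le_sum fun j _ => ?_
    rw [norm_mul]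
    exact mul_le_mul ((norm_le_pi_norm _ p).trans (norm_snd_le (A i j))) (hv j) (norm_nonneg _)
      (norm_nonneg _)

theorem norm_le_of_places {v : Fin d → QS S} {r : ℝ} (hr : 0 ≤ r) (h1 : ∀ i, |(v i).1| ≤ r)
    (h2 : ∀ i p, ‖(v i).2 p‖ ≤ r) : ‖v‖ ≤ r := by
  refine (pi_norm_le_iff_of_nonneg hr).2 fun i => ?_
  rw [Prod.norm_def]
  exact max_le (h1 i) ((pi_norm_le_iff_of_nonneg hr).2 fun p => h2 i p)

theorem abs_fst_le_norm (v : Fin d → QS S) (i : Fin d) : |(v i).1| ≤ ‖v‖ :=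
  (norm_fst_le (v i)).trans (norm_le_pi_norm v i)

theorem norm_snd_le_norm (v : Fin d → QS S) (i : Fin d) (p : S) : ‖(v i).2 p‖ ≤ ‖v‖ :=
  ((norm_le_pi_norm _ p).trans (norm_snd_le (v i))).trans (norm_le_pi_norm v i)

/-- There are units of `ℤ_S` which are arbitrarily small at all the primes of `S`. -/
theorem exists_small_unit (S : Finset Nat.Primes) {δ : ℝ} (hδ : 0 < δ) :
    ∃ u : ℚ, 0 < u ∧ u ∈ ratZS S ∧ u⁻¹ ∈ ratZS S ∧ ∀ p : S, ‖(diag S u).2 p‖ ≤ δ := by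
  obtain ⟨k, hk⟩ := exists_pow_lt_of_lt_one hδ (by norm_num : (2⁻¹ : ℝ) < 1)
  refine ⟨((∏ p ∈ S, (p : ℕ) ^ k : ℕ) : ℚ), ?_, natCast_mem_ratZS _, fun p hp => ?_, fun p => ?_⟩
  · exact_mod_cast Finset.prod_pos fun (p : Nat.Primes) _ => pow_pos p.2.pos k
  · have h1 : padicNorm p ((∏ p ∈ S, (p : ℕ) ^ k : ℕ) : ℚ) = 1 := by
      refine (padicNorm.nat_eq_one_iff _).2 fun hdvd => ?_
      obtain ⟨q, hq, h⟩ := (Prime.dvd_finsetProd_iff p.2.prime _).1 hdvd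
      exact hp (primes_eq_of_dvd (p.2.dvd_of_dvd_pow h) ▸ hq)
    have h2 := padicNorm.div (p := p) 1 ((∏ p ∈ S, (p : ℕ) ^ k : ℕ) : ℚ)
    rw [one_div, h1, padicNorm.one, div_one] at h2
    exact h2.le
  · rw [norm_diag_snd]
    have h3 : padicNorm p.1 ((∏ q ∈ S, (q : ℕ) ^ k : ℕ) : ℚ) ≤ ((p.1 : ℕ) : ℚ) ^ (-k : ℤ) := by
      rw [← Int.cast_natCast]
      exact (padicNorm.dvd_iff_norm_le).1 (by exact_mod_cast Finset.dvd_prod_of_mem _ p.2)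
    have h4 : (padicNorm p.1 ((∏ q ∈ S, (q : ℕ) ^ k : ℕ) : ℚ) : ℝ) ≤
        (((p.1 : ℕ) : ℝ) ^ (-k : ℤ)) := by
      refine (Rat.cast_le.2 h3).trans_eq ?_
      push_cast
      rfl
    refine h4.trans (le_trans ?_ hk.le)
    rw [zpow_neg, zpow_natCast, inv_pow]
    have : (2 : ℝ) ≤ (p.1 : ℕ) := by exact_mod_cast p.1.2.two_le
    gcongr

/-- The lattice `ℤ_S^d` is parametrized by `S`-integral vectors. -/
def stdLatticeEquiv (S : Finset Nat.Primes) (d : ℕ) : (Fin d → ratZS S) ≃ stdLattice S d :=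
  Equiv.ofInjective _ emb_injective

/-- The integral over `ℚ_S^d`, cut into the translates of `g B` by the lattice `g ℤ_S^d`. -/
theorem lintegral_eq_tsum_cells {B : Set (Fin d → QS S)}
    (hB : IsAddFundamentalDomain (stdLattice S d) B (muSd S d)) (g : GLS S d)
    (H : (Fin d → QS S) → ℝ≥0∞) : ∫⁻ v, H v ∂muSd S d =
      modulus g * ∑' z, ∫⁻ y in B, H (g.val *ᵥ emb S d z + g.val *ᵥ y) ∂muSd S d := by
  rw [← lintegral_mulVec g H, hB.lintegral_eq_tsum'', ← (stdLatticeEquiv S d).tsum_eq]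
  congr 2 with z
  refine lintegral_congr fun y => ?_
  rw [← Matrix.mulVec_add]
  rfl

/-- A Riemann sum is at most the integral of a function which dominates `F` on the neighbouring
cells. -/
theorem tsum_le_lintegral {g : GLS S d} {B : Set (Fin d → QS S)}
    (hB : IsAddFundamentalDomain (stdLattice S d) B (muSd S d)) (hBm : MeasurableSet B)
    (F H : (Fin d → QS S) → ℝ≥0∞)
    (hFH : ∀ v, ∀ y ∈ B, F v ≤ H (v + g.val *ᵥ y)) :
    modulus g * ∑' z, F (g.val *ᵥ emb S d z) ≤ ∫⁻ v, H v ∂muSd S d := by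
  rw [lintegral_eq_tsum_cells hB g H]
  gcongr with z
  calc F (g.val *ᵥ emb S d z) = ∫⁻ _ in B, F (g.val *ᵥ emb S d z) ∂muSd S d := by
        rw [setLIntegral_const, measure_fundamentalDomain hB, mul_one]
    _ ≤ _ := setLIntegral_mono' hBm fun y hy => hFH _ y hy

/-- The integral of `H` is at most a Riemann sum of `F`, if `F` dominates `H` on the neighbouring
cells up to an error `K`. -/
theorem lintegral_le_tsum {g : GLS S d} {B : Set (Fin d → QS S)}
    (hB : IsAddFundamentalDomain (stdLattice S d) B (muSd S d)) (hBm : MeasurableSet B)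
    (F H K : (Fin d → QS S) → ℝ≥0∞)
    (hFH : ∀ v, ∀ y ∈ B, H (v + g.val *ᵥ y) ≤ F v + K (v + g.val *ᵥ y)) :
    ∫⁻ v, H v ∂muSd S d ≤ modulus g * ∑' z, F (g.val *ᵥ emb S d z) + ∫⁻ v, K v ∂muSd S d := by
  rw [lintegral_eq_tsum_cells hB g H, lintegral_eq_tsum_cells hB g K, ← mul_add,
    ← ENNReal.tsum_add]
  gcongr with z
  calc _ ≤ ∫⁻ y in B, (F (g.val *ᵥ emb S d z) +
          K (g.val *ᵥ emb S d z + g.val *ᵥ y)) ∂muSd S d :=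
        setLIntegral_mono' hBm fun y hy => hFH _ y hy
    _ = _ := by
        rw [lintegral_add_left measurable_const, setLIntegral_const,
          measure_fundamentalDomain hB, mul_one]

/-- Riemann sums of a continuous function of compact support over the lattices `c g ℤ_S^d` converge
to its integral as the contraction `c` becomes small at the real place. -/
theorem tendsto_riemann_sum {f : (Fin d → QS S) → ℝ} (hf0 : ∀ v, 0 ≤ f v) (hf : Continuous f)
    (hfc : HasCompactSupport f) {g : GLS S d} (hg : modulus g = 1) {t : ℕ → ℝ} (ht : ∀ n, 0 < t n)
    (ht0 : Tendsto t atTop (𝓝 0)) {c : ℕ → GLS S d} (hc : ∀ n, IsContraction (t n) (c n)) :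
    Tendsto (fun n => ENNReal.ofReal (t n) ^ d *
        ∑' z, ENNReal.ofReal (f ((c n).val *ᵥ (g.val *ᵥ emb S d z)))) atTop
      (𝓝 (∫⁻ v, ENNReal.ofReal (f v) ∂muSd S d)) := by
  obtain ⟨R, hR0, hR⟩ : ∃ R : ℝ, 0 ≤ R ∧ ∀ v, f v ≠ 0 → ‖v‖ ≤ R := by
    obtain ⟨R, hR⟩ := hfc.isCompact.isBounded.exists_norm_le
    exact ⟨max R 0, le_max_right _ _, fun v hv =>
      (hR v (subset_tsupport f hv)).trans (le_max_left _ _)⟩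
  set K : Set (Fin d → QS S) := Metric.closedBall 0 (R + 1) with hKdef
  have hKfin : muSd S d K ≠ ∞ := (isCompact_closedBall _ _).measure_lt_top.ne
  have hKm : MeasurableSet K := Metric.isClosed_closedBall.measurableSet
  have hcont : UniformContinuous f := hfc.uniformContinuous_of_continuous hf
  -- both approximation errors are at most `ε μ(K)`
  have main : ∀ ε : ℝ, 0 < ε → ∀ᶠ n in atTop,
      (ENNReal.ofReal (t n) ^ d * ∑' z, ENNReal.ofReal (f ((c n).val *ᵥ (g.val *ᵥ emb S d z))) ≤
        ∫⁻ v, ENNReal.ofReal (f v) ∂muSd S d + ENNReal.ofReal ε * muSd S d K) ∧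
      (∫⁻ v, ENNReal.ofReal (f v) ∂muSd S d ≤
        ENNReal.ofReal (t n) ^ d * ∑' z, ENNReal.ofReal (f ((c n).val *ᵥ (g.val *ᵥ emb S d z))) +
          ENNReal.ofReal ε * muSd S d K) := by
    intro ε hε
    obtain ⟨δ₀, hδ₀, hunif⟩ := Metric.uniformContinuous_iff.1 hcont ε hε
    set δ : ℝ := min (δ₀ / 2) 1 with hδ
    have hδpos : 0 < δ := lt_min (by positivity) one_pos
    obtain ⟨C, hC, hC1, hC2⟩ := exists_place_bound g.val
    obtain ⟨u, hu0, hu, hu', hup⟩ := exists_small_unit S (div_pos hδpos hC)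
    have hu0' : (0 : ℝ) < u := by exact_mod_cast hu0
    have hBm := measurableSet_box (S := S) (d := d) (measurableSet_Ico (a := (0 : ℝ)) (b := u))
      fun p => ‖(diag S u).2 p‖
    have hB := isAddFundamentalDomain_of_existsUnique hBm (existsUnique_emb_unit hu0 hu hu')
    have hsmall : ∀ᶠ n in atTop, t n * (C * u) < δ := by
      have : Tendsto (fun n => t n * (C * u)) atTop (𝓝 (0 * (C * u))) := ht0.mul_const _
      rw [zero_mul] at this
      exact this.eventually_lt_const hδpos
    filter_upwards [hsmall] with n hn
    have hmod : (modulus (c n * g) : ℝ≥0∞) = ENNReal.ofReal (t n) ^ d := by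
      rw [modulus_mul, hg, mul_one, (hc n).modulus_eq (ht n)]
    have hmulVec : ∀ v, (c n * g).val *ᵥ v = (c n).val *ᵥ (g.val *ᵥ v) := fun v => by
      rw [Units.val_mul, Matrix.mulVec_mulVec]
    have hy : ∀ y ∈ box S d (Ico 0 (u : ℝ)) (fun p => ‖(diag S u).2 p‖),
        ‖(c n * g).val *ᵥ y‖ ≤ δ := by
      intro y hy
      rw [hmulVec]
      refine norm_le_of_places hδpos.le (fun i => ?_) fun i p => ?_
      · rw [(hc n).fst, abs_mul, abs_of_pos (ht n)]
        refine le_trans (mul_le_mul_of_nonneg_left (hC1 u y hu0'.le (fun j => ?_) i) (ht n).le)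
          hn.le
        obtain ⟨⟨h1, h2⟩, -⟩ := hy j
        rw [abs_of_nonneg h1]
        exact h2.le
      · rw [(hc n).norm_snd]
        refine (hC2 (δ / C) y p (by positivity) (fun j => ((hy j).2 p).trans (hup p)) i).trans_eq ?_
        field_simp
    have hosc : ∀ v w : Fin d → QS S, ‖w‖ ≤ δ → |f (v + w) - f v| ≤ ε := by
      intro v w hw
      have : dist (f (v + w)) (f v) < ε := hunif (by
        rw [dist_eq_norm, add_sub_cancel_left]
        refine hw.trans_lt ((min_le_left _ _).trans_lt ?_)
        linarith)
      exact this.le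
    have hKmem : ∀ v w : Fin d → QS S, ‖w‖ ≤ δ → v + w ∉ K → f v = 0 ∧ f (v + w) = 0 := by
      intro v w hw hvw
      have h1 : R + 1 < ‖v + w‖ := by
        rw [hKdef, mem_closedBall_zero_iff, not_le] at hvw
        exact hvw
      have h2 : ‖v + w‖ ≤ ‖v‖ + ‖w‖ := norm_add_le _ _
      have h3 : δ ≤ 1 := min_le_right _ _
      constructor
      · by_contra h
        have := hR v h
        linarith
      · by_contra h
        have := hR _ h
        linarith
    set k : (Fin d → QS S) → ℝ≥0∞ := K.indicator fun _ => ENNReal.ofReal ε with hk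
    have hkint : ∫⁻ v, k v ∂muSd S d = ENNReal.ofReal ε * muSd S d K := by
      rw [hk, lintegral_indicator hKm, setLIntegral_const]
    have hfm : Measurable fun v => ENNReal.ofReal (f v) := hf.measurable.ennreal_ofReal
    constructor
    · rw [← hkint, ← lintegral_add_left hfm, ← hmod]
      simp_rw [← hmulVec]
      refine tsum_le_lintegral hB hBm (fun v => ENNReal.ofReal (f v))
        (fun v => ENNReal.ofReal (f v) + k v) fun v y hyB => ?_
      by_cases hmem : v + (c n * g).val *ᵥ y ∈ K
      · simp only [hk, indicator_of_mem hmem]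
        rw [← ENNReal.ofReal_add (hf0 _) hε.le]
        refine ENNReal.ofReal_le_ofReal ?_
        have := (abs_le.1 (hosc v _ (hy y hyB))).1
        linarith
      · simp only [(hKmem v _ (hy y hyB) hmem).1, ENNReal.ofReal_zero, zero_le]
    · rw [← hkint, ← hmod]
      simp_rw [← hmulVec]
      refine lintegral_le_tsum hB hBm (fun v => ENNReal.ofReal (f v))
        (fun v => ENNReal.ofReal (f v)) k fun v y hyB => ?_
      by_cases hmem : v + (c n * g).val *ᵥ y ∈ K
      · simp only [hk, indicator_of_mem hmem]
        rw [← ENNReal.ofReal_add (hf0 _) hε.le]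
        refine ENNReal.ofReal_le_ofReal ?_
        have := (abs_le.1 (hosc v _ (hy y hyB))).2
        linarith
      · simp only [(hKmem v _ (hy y hyB) hmem).2, ENNReal.ofReal_zero, zero_le]
  have hfin : ∫⁻ v, ENNReal.ofReal (f v) ∂muSd S d ≠ ∞ :=
    ((hf.integrable_of_hasCompactSupport hfc).lintegral_lt_top).ne
  rw [ENNReal.tendsto_nhds hfin]
  intro η hη
  obtain ⟨ε, hε, hεη⟩ : ∃ ε : ℝ, 0 < ε ∧ ENNReal.ofReal ε * muSd S d K ≤ η := by
    obtain ⟨ε, hε, h⟩ := ENNReal.exists_nnreal_pos_mul_lt hKfin hη.ne'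
    exact ⟨ε, hε, by rw [ENNReal.ofReal_coe_nnreal]; exact h.le⟩
  filter_upwards [main ε hε] with n hn
  exact ⟨tsub_le_iff_right.2 (hn.2.trans (by gcongr)), hn.1.trans (by gcongr)⟩

/-! ### Sublattices of prime index -/

/-- The inclusion of `ℤ_S` in `ℤ_ℓ`, for a prime `ℓ ∉ S`. -/
def toPadicInt (ℓ : Nat.Primes) (hℓ : ℓ ∉ S) : ratZS S →+* ℤ_[(ℓ : ℕ)] :=
  ((Rat.castHom ℚ_[(ℓ : ℕ)]).comp (ratZS S).subtype).codRestrict (PadicInt.subring (ℓ : ℕ))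
    fun z => by
      have h : ‖((z : ℚ) : ℚ_[(ℓ : ℕ)])‖ ≤ 1 := by
        rw [Padic.eq_padicNorm]
        exact_mod_cast z.2 ℓ hℓ
      exact h

theorem coe_toPadicInt (ℓ : Nat.Primes) (hℓ : ℓ ∉ S) (z : ratZS S) :
    (toPadicInt ℓ hℓ z : ℚ_[(ℓ : ℕ)]) = ((z : ℚ) : ℚ_[(ℓ : ℕ)]) := rfl

/-- Reduction of `S`-integers modulo a prime `ℓ ∉ S`. -/
def red (ℓ : Nat.Primes) (hℓ : ℓ ∉ S) : ratZS S →+* ZMod ℓ :=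
  PadicInt.toZMod.comp (toPadicInt ℓ hℓ)

theorem red_eq_zero_iff {ℓ : Nat.Primes} {hℓ : ℓ ∉ S} {z : ratZS S} :
    red ℓ hℓ z = 0 ↔ ∃ y : ratZS S, z = (ℓ : ℕ) * y := by
  constructor
  · intro h
    have h1 : toPadicInt ℓ hℓ z ∈ RingHom.ker (PadicInt.toZMod (p := (ℓ : ℕ))) := h
    rw [PadicInt.ker_toZMod, IsLocalRing.mem_maximalIdeal, PadicInt.mem_nonunits,
      PadicInt.norm_lt_one_iff_dvd] at h1
    obtain ⟨w, hw⟩ := h1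
    have hℓ0 : ((ℓ : ℕ) : ℚ) ≠ 0 := by exact_mod_cast ℓ.2.ne_zero
    have hw' : ((z : ℚ) : ℚ_[(ℓ : ℕ)]) = ((ℓ : ℕ) : ℚ_[(ℓ : ℕ)]) * w := by
      rw [← coe_toPadicInt ℓ hℓ z, hw]
      push_cast
      rfl
    refine ⟨⟨(z : ℚ) / (ℓ : ℕ), fun p hp => ?_⟩, ?_⟩
    · by_cases hpl : p = ℓ
      · subst hpl
        have h2 : ‖(((z : ℚ) / ((p : ℕ) : ℚ) : ℚ) : ℚ_[(p : ℕ)])‖ ≤ 1 := by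
          have hp0 : ((p : ℕ) : ℚ_[(p : ℕ)]) ≠ 0 := by exact_mod_cast p.2.ne_zero
          have e : (((z : ℚ) / ((p : ℕ) : ℚ) : ℚ) : ℚ_[(p : ℕ)]) = w := by
            push_cast
            rw [hw', mul_div_cancel_left₀ _ hp0]
          rw [e]
          exact w.2
        rw [Padic.eq_padicNorm] at h2
        exact_mod_cast h2
      · have h1 : padicNorm p ((ℓ : ℕ) : ℚ) = 1 :=
          (padicNorm.nat_eq_one_iff _).2 fun h => hpl (primes_eq_of_dvd h)
        rw [padicNorm.div, h1, div_one]
        exact z.2 p hp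
    · refine Subtype.ext ?_
      push_cast
      rw [mul_div_cancel₀ _ hℓ0]
  · rintro ⟨y, rfl⟩
    rw [map_mul, map_natCast, CharP.cast_eq_zero, zero_mul]

/-- The vectors of `ℤ_S^d` whose reduction is orthogonal to `a` form the lattice spanned by the
columns of an integral matrix of determinant `ℓ`. -/
theorem exists_sublattice_matrix (ℓ : Nat.Primes) (hℓ : ℓ ∉ S) (a : Fin d → ZMod ℓ) (ha : a ≠ 0) :
    ∃ α : GLS S d, α.val.det = diag S ((ℓ : ℕ) : ℚ) ∧
      (∀ y, ∃ z, a ⬝ᵥ (fun i => red ℓ hℓ (z i)) = 0 ∧ α.val *ᵥ emb S d y = emb S d z) ∧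
      ∀ z, a ⬝ᵥ (fun i => red ℓ hℓ (z i)) = 0 → ∃ y, α.val *ᵥ emb S d y = emb S d z := by
  obtain ⟨i, hi⟩ := Function.ne_iff.1 ha
  have hi : a i ≠ 0 := hi
  have hℓ0 : ((ℓ : ℕ) : ℚ) ≠ 0 := by exact_mod_cast ℓ.2.ne_zero
  -- the row vector `b` has `b i = ℓ`, and `b j` lifts `- a j / a i` for `j ≠ i`
  set b : Fin d → ratZS S := fun j => if j = i then ((ℓ : ℕ) : ratZS S) else
    ((-(a j / a i) : ZMod ℓ).val : ratZS S) with hb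
  have hbi : b i = ((ℓ : ℕ) : ratZS S) := by simp [hb]
  have hredb : ∀ j, j ≠ i → a i * red ℓ hℓ (b j) = - a j := by
    intro j hj
    simp only [hb, if_neg hj]
    rw [map_natCast, ZMod.natCast_zmod_val]
    field_simp
  set A : Matrix (Fin d) (Fin d) (QS S) := (1 : Matrix _ _ _).updateRow i (emb S d b) with hA
  have hdet : A.det = diag S ((ℓ : ℕ) : ℚ) := by
    rw [hA, ← Matrix.cramer_transpose_apply, Matrix.transpose_one, Matrix.cramer_one]
    simp [hbi]
  have hunit : IsUnit A.det := by
    rw [hdet]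
    exact (IsUnit.mk0 _ hℓ0).map (diag S)
  have hmul : ∀ y, A *ᵥ emb S d y = emb S d (Function.update y i (b ⬝ᵥ y)) := by
    intro y
    rw [hA, Matrix.updateRow_mulVec, Matrix.one_mulVec]
    ext j : 1
    by_cases hj : j = i
    · subst hj
      simp [dotProduct]
    · simp [Function.update_of_ne hj]
  -- the congruence `∑ a j z j = 0` is solved for the coordinate `z i`
  have hsplit : ∀ z : Fin d → ratZS S, a ⬝ᵥ (fun j => red ℓ hℓ (z j)) =
      a i * red ℓ hℓ (z i - ∑ j ∈ Finset.univ.erase i, b j * z j) := by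
    intro z
    rw [dotProduct, ← Finset.add_sum_erase _ _ (Finset.mem_univ i), map_sub, mul_sub,
      sub_eq_add_neg, map_sum, Finset.mul_sum, ← Finset.sum_neg_distrib]
    congr 1
    refine Finset.sum_congr rfl fun j hj => ?_
    rw [map_mul, ← mul_assoc, hredb j (Finset.ne_of_mem_erase hj)]
    ring
  have hupd : ∀ (y : Fin d → ratZS S) (w : ratZS S),
      ∑ j ∈ Finset.univ.erase i, b j * Function.update y i w j =
        ∑ j ∈ Finset.univ.erase i, b j * y j := fun y w =>
    Finset.sum_congr rfl fun j hj => by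
      rw [Function.update_of_ne (Finset.ne_of_mem_erase hj)]
  refine ⟨Matrix.GeneralLinearGroup.mk'' A hunit, hdet, fun y => ⟨_, ?_, hmul y⟩, fun z hz => ?_⟩
  · rw [hsplit]
    have e : (Function.update y i (b ⬝ᵥ y) i - ∑ j ∈ Finset.univ.erase i,
        b j * Function.update y i (b ⬝ᵥ y) j) = ((ℓ : ℕ) : ratZS S) * y i := by
      rw [hupd, Function.update_self, dotProduct, ← Finset.add_sum_erase _ _ (Finset.mem_univ i),
        hbi, add_sub_cancel_right]
    rw [e, map_mul, map_natCast, CharP.cast_eq_zero, zero_mul, mul_zero]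
  · rw [hsplit, mul_eq_zero, or_iff_right hi, red_eq_zero_iff] at hz
    obtain ⟨w, hw⟩ := hz
    refine ⟨Function.update z i w, ?_⟩
    refine (hmul _).trans ?_
    congr 1
    ext j : 1
    by_cases hj : j = i
    · subst hj
      rw [Function.update_self, dotProduct, ← Finset.add_sum_erase _ _ (Finset.mem_univ j), hbi,
        Function.update_self, ← hw, hupd, sub_add_cancel]
    · rw [Function.update_of_ne hj, Function.update_of_ne hj]

/-- A contraction by `t = ℓ^(-1/d)` at the real place with determinant `ℓ⁻¹`. -/
theorem exists_contraction (ℓ : Nat.Primes) (hℓ : ℓ ∉ S) (hd : 0 < d) {t : ℝ}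
    (ht : t ^ d = ((ℓ : ℕ) : ℝ)⁻¹) :
    ∃ c : GLS S d, IsContraction t c ∧ c.val.det = diag S ((ℓ : ℕ) : ℚ)⁻¹ := by
  have hℓ0 : ((ℓ : ℕ) : ℚ) ≠ 0 := by exact_mod_cast ℓ.2.ne_zero
  set D : Fin d → QS S := fun i =>
    (t, if i = ⟨0, hd⟩ then (diag S ((ℓ : ℕ) : ℚ)⁻¹).2 else 1) with hD
  have hdet : (Matrix.diagonal D).det = diag S ((ℓ : ℕ) : ℚ)⁻¹ := by
    rw [Matrix.det_diagonal]
    refine Prod.ext ?_ ?_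
    · rw [Prod.fst_prod]
      simp [hD, ht]
    · rw [Prod.snd_prod]
      simp [hD]
  have hunit : IsUnit (Matrix.diagonal D).det := by
    rw [hdet]
    exact (IsUnit.mk0 _ (inv_ne_zero hℓ0)).map (diag S)
  refine ⟨Matrix.GeneralLinearGroup.mk'' _ hunit, ⟨D, rfl, fun i => ⟨rfl, fun p => ?_⟩⟩, hdet⟩
  by_cases hi : i = ⟨0, hd⟩
  · have h1 : padicNorm p.1 ((ℓ : ℕ) : ℚ) = 1 :=
      (padicNorm.nat_eq_one_iff _).2 fun h => hℓ (primes_eq_of_dvd h ▸ p.2)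
    have h2 : padicNorm p.1 (((ℓ : ℕ) : ℚ)⁻¹) = 1 := by
      have := padicNorm.div (p := p.1) 1 ((ℓ : ℕ) : ℚ)
      rwa [one_div, h1, padicNorm.one, div_one] at this
    have h3 := norm_diag_snd (S := S) ((ℓ : ℕ) : ℚ)⁻¹ p
    rw [h2, Rat.cast_one] at h3
    simp only [hD, if_pos hi]
    exact h3
  · simp [hD, if_neg hi]

/-! ### The space of lattices -/

theorem mem_latticeOfMatrix {g : GLS S d} {v : Fin d → QS S} :
    v ∈ latticeOfMatrix g ↔ ∃ z, v = g.val *ᵥ emb S d z := by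
  constructor
  · rintro ⟨z, hz, rfl⟩
    choose y hy using fun i => mem_ZS_iff.1 (hz i)
    exact ⟨y, congrArg _ (funext hy)⟩
  · rintro ⟨z, rfl⟩
    exact ⟨emb S d z, fun i => mem_ZS_iff.2 ⟨z i, rfl⟩, rfl⟩

theorem isClosed_ZS : IsClosed (ZS S : Set (QS S)) := by
  refine Metric.isClosed_of_pairwise_le_dist one_pos ?_
  rintro _ ⟨y, hy, rfl⟩ _ ⟨z, hz, rfl⟩ hne
  by_contra hlt
  rw [not_le, dist_eq_norm, ← map_sub] at hlt
  have hp : ∀ p : Nat.Primes, padicNorm p (y - z) ≤ 1 := by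
    intro p
    by_cases hpS : p ∈ S
    · have h1 : ‖(diag S (y - z)).2 ⟨p, hpS⟩‖ ≤ 1 :=
        ((norm_le_pi_norm _ _).trans (norm_snd_le _)).trans hlt.le
      rw [norm_diag_snd] at h1
      exact_mod_cast h1
    · exact (ratZS S).sub_mem hy hz p hpS
  obtain ⟨k, hk⟩ := exists_int_of_padicNorm_le_one hp
  have h1 : |(k : ℝ)| < 1 := by
    have := (norm_fst_le (diag S (y - z))).trans_lt hlt
    rw [hk] at this
    simpa using this
  have h2 : k = 0 := by
    have : |k| < 1 := by exact_mod_cast h1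
    exact Int.abs_lt_one_iff.1 this
  rw [h2, Int.cast_zero, sub_eq_zero] at hk
  exact hne (congrArg _ hk)

/-- The homogeneous space `G/Γ`, with `Γ` the group of `ℤ_S`-points of `G`. -/
abbrev LatticeSpace (G : Subgroup (GLS S d)) (hUL : G ≤ UL S d) : Type :=
  G ⧸ (integralPoints S d G hUL).subgroupOf G

variable {G : Subgroup (GLS S d)} {hUL : G ≤ UL S d}

theorem lattice_mk_integralPoints (g : G) :
    lattice (QuotientGroup.mk g : LatticeSpace G hUL) = latticeOfMatrix (g : GLS S d) :=
  lattice_mk (fun _ (hγ : _ ∈ integralPoints S d G hUL) => hγ.2) g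

instance isClosed_subgroupOf_integralPoints :
    IsClosed ((integralPoints S d G hUL).subgroupOf G : Set G) := by
  have h : ((integralPoints S d G hUL).subgroupOf G : Set G) =
      ⋂ i, ⋂ j, {g : G | (g : GLS S d).val i j ∈ ZS S} := by
    ext g
    simp only [mem_iInter]
    exact ⟨fun h => h.2, fun h => ⟨g.2, h⟩⟩
  rw [h]
  exact isClosed_iInter fun i => isClosed_iInter fun j =>
    isClosed_ZS.preimage ((continuous_entry i j).comp continuous_subtype_val)

/-- A point of `G/Γ` is determined by its lattice. -/
theorem mk_eq_mk_of_lattice_eq {g h : G}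
    (e : latticeOfMatrix (g : GLS S d) = latticeOfMatrix (h : GLS S d)) :
    (QuotientGroup.mk g : LatticeSpace G hUL) = QuotientGroup.mk h := by
  rw [QuotientGroup.eq, Subgroup.mem_subgroupOf]
  refine ⟨(g⁻¹ * h).2, fun i j => ?_⟩
  have h1 : (h : GLS S d).val *ᵥ (emb S d (Pi.single j 1)) ∈ latticeOfMatrix (g : GLS S d) := by
    rw [e]
    exact mem_latticeOfMatrix.2 ⟨_, rfl⟩
  obtain ⟨z, hz⟩ := mem_latticeOfMatrix.1 h1
  have he : emb S d (Pi.single j 1) = Pi.single j 1 := by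
    ext k : 1
    rw [emb_apply, Pi.single_apply, Pi.single_apply]
    split_ifs <;> simp
  have h2 : ((g⁻¹ * h : G) : GLS S d).val *ᵥ Pi.single j 1 = emb S d z := by
    rw [Subgroup.coe_mul, Subgroup.coe_inv, Units.val_mul, ← Matrix.mulVec_mulVec, ← he, hz,
      inv_mulVec_mulVec]
  rw [Matrix.mulVec_single_one] at h2
  have h3 := congrFun h2 i
  rw [Matrix.col_apply] at h3
  rw [h3]
  exact mem_ZS_iff.2 ⟨z i, rfl⟩

/-- As `G` contains `SL_d(ℚ_S)`, membership in `G` depends on the determinant only. -/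
theorem mem_of_det_eq (hSL : SL S d ≤ G) {g h : GLS S d} (hg : g ∈ G)
    (e : h.val.det = g.val.det) : h ∈ G := by
  have h1 : h * g⁻¹ ∈ SL S d := by
    have h2 : (h * g⁻¹ * g).val.det = g.val.det := by rw [inv_mul_cancel_right, e]
    rw [Units.val_mul, Matrix.det_mul] at h2
    have h3 : IsUnit g.val.det := (Matrix.isUnit_iff_isUnit_det _).1 g.isUnit
    exact (h3.mul_eq_right).1 h2
  simpa using G.mul_mem (hSL h1) hg

/-! ### Averaging over the sublattices of index `ℓ` -/

/-- The lattice of the vectors `c g z`, where `z` is an `S`-integral vector with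
`a ⬝ z ≡ 0 mod ℓ`. -/
def subLattice (ℓ : Nat.Primes) (hℓ : ℓ ∉ S) (c g : GLS S d) (a : Fin d → ZMod ℓ) :
    Set (Fin d → QS S) :=
  {v | ∃ z, a ⬝ᵥ (fun i => red ℓ hℓ (z i)) = 0 ∧ v = c.val *ᵥ (g.val *ᵥ emb S d z)}

/-- The elements of `Γ` act on `ℤ_S^d`. -/
theorem exists_ratZS_matrix {γ : GLS S d} (hγ : γ ∈ integralPoints S d G hUL) :
    ∃ N : Matrix (Fin d) (Fin d) (ratZS S), (∀ z, γ.val *ᵥ emb S d z = emb S d (N *ᵥ z)) := by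
  choose N hN using fun i j => mem_ZS_iff.1 (hγ.2 i j)
  refine ⟨Matrix.of N, fun z => ?_⟩
  ext i : 1
  simp [Matrix.mulVec, dotProduct, hN]

/-- Changing the representative of a coset permutes the sublattices of index `ℓ`. -/
theorem exists_perm_subLattice (ℓ : Nat.Primes) (hℓ : ℓ ∉ S) (c : GLS S d) {g g' : G}
    (e : (QuotientGroup.mk g : LatticeSpace G hUL) = QuotientGroup.mk g') :
    ∃ σ : Equiv.Perm {a : Fin d → ZMod ℓ // a ≠ 0},
      ∀ a : {a : Fin d → ZMod ℓ // a ≠ 0},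
        subLattice ℓ hℓ c (g' : GLS S d) a.1 = subLattice ℓ hℓ c (g : GLS S d) (σ a).1 := by
  rw [QuotientGroup.eq, Subgroup.mem_subgroupOf] at e
  set γ : GLS S d := ((g⁻¹ * g' : G) : GLS S d) with hγ
  have hg' : (g' : GLS S d) = g * γ := by rw [hγ]; simp
  obtain ⟨N, hN⟩ := exists_ratZS_matrix e
  obtain ⟨N', hN'⟩ := exists_ratZS_matrix (inv_mem e)
  have hNN' : ∀ z, N *ᵥ (N' *ᵥ z) = z := fun z => emb_injective <| by
    rw [← hN, ← hN', mulVec_inv_mulVec]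
  have hN'N : ∀ z, N' *ᵥ (N *ᵥ z) = z := fun z => emb_injective <| by
    rw [← hN', ← hN, inv_mulVec_mulVec]
  have h1 : N * N' = 1 := Matrix.ext_of_mulVec_single fun i => by
    rw [← Matrix.mulVec_mulVec, hNN', Matrix.one_mulVec]
  have h2 : N' * N = 1 := Matrix.ext_of_mulVec_single fun i => by
    rw [← Matrix.mulVec_mulVec, hN'N, Matrix.one_mulVec]
  set n := N.map (red ℓ hℓ) with hn
  set n' := N'.map (red ℓ hℓ) with hn'
  have h3 : n * n' = 1 := by
    rw [hn, hn', ← Matrix.map_mul, h1, Matrix.map_one _ (map_zero _) (map_one _)]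
  have h4 : n' * n = 1 := by
    rw [hn, hn', ← Matrix.map_mul, h2, Matrix.map_one _ (map_zero _) (map_one _)]
  have hred : ∀ z : Fin d → ratZS S, (fun i => red ℓ hℓ ((N' *ᵥ z) i)) =
      n' *ᵥ fun i => red ℓ hℓ (z i) := by
    intro z
    ext i
    simp [Matrix.mulVec, dotProduct, hn']
  let τ : (Fin d → ZMod ℓ) ≃ (Fin d → ZMod ℓ) :=
    { toFun := fun a => a ᵥ* n'
      invFun := fun a => a ᵥ* n
      left_inv := fun a => by beta_reduce; rw [Matrix.vecMul_vecMul, h4, Matrix.vecMul_one]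
      right_inv := fun a => by beta_reduce; rw [Matrix.vecMul_vecMul, h3, Matrix.vecMul_one] }
  have hτ0 : ∀ a, a ≠ 0 ↔ τ a ≠ 0 := fun a => by
    have : τ 0 = 0 := Matrix.zero_vecMul n'
    exact (τ.injective.ne_iff' this).symm
  refine ⟨τ.subtypeEquiv hτ0, fun a => ?_⟩
  have key : ∀ w : Fin d → ratZS S, (a : Fin d → ZMod ℓ) ⬝ᵥ (fun i => red ℓ hℓ ((N' *ᵥ w) i)) =
      τ a ⬝ᵥ fun i => red ℓ hℓ (w i) := fun w => by
    rw [hred, Matrix.dotProduct_mulVec]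
    rfl
  ext v
  constructor
  · rintro ⟨z, hz, rfl⟩
    refine ⟨N *ᵥ z, ?_, ?_⟩
    · refine (key _).symm.trans ?_
      rw [hN'N]
      exact hz
    · rw [← hN, hg', Units.val_mul, ← Matrix.mulVec_mulVec]
  · rintro ⟨w, hw, rfl⟩
    refine ⟨N' *ᵥ w, (key w).trans hw, ?_⟩
    rw [hg', Units.val_mul, ← Matrix.mulVec_mulVec, hN, hNN']

/-- A multivalued map `g Γ ↦ {φ g a Γ}` on `G/Γ` defines a probability kernel. If it commutes with
the action of `G` up to some twist `h ↦ h'` of `G`, the kernel preserves the unique invariant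
probability measure. -/
theorem exists_averaging_kernel {G : Type*} [Group G] [TopologicalSpace G] [IsTopologicalGroup G]
    [LocallyCompactSpace G] [PolishSpace G] (Γ : Subgroup G) [IsClosed (Γ : Set G)]
    [MeasurableSpace (G ⧸ Γ)] [BorelSpace (G ⧸ Γ)] (m : Measure (G ⧸ Γ)) [IsProbabilityMeasure m]
    [SMulInvariantMeasure G (G ⧸ Γ) m] {A : Type*} [Fintype A] [Nonempty A] (φ : G → A → G)
    (hφ : ∀ a, Continuous fun g => φ g a)
    (hperm : ∀ g g' : G, (g : G ⧸ Γ) = g' →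
      ∃ σ : Equiv.Perm A, ∀ a, (φ g' a : G ⧸ Γ) = φ g (σ a))
    (htwist : ∀ h : G, ∃ h' : G, ∀ g a, φ (h' * g) a = h * φ g a) :
    ∃ κ : G ⧸ Γ → Measure (G ⧸ Γ), Measurable κ ∧ (∀ x, IsProbabilityMeasure (κ x)) ∧
      m.bind κ = m ∧ ∀ (g : G) (Φ : G ⧸ Γ → ℝ≥0∞), Measurable Φ →
        ∫⁻ y, Φ y ∂κ g = (Fintype.card A : ℝ≥0∞)⁻¹ * ∑ a, Φ (φ g a) := by
  let _ : MeasurableSpace G := borel G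
  have _ : BorelSpace G := ⟨rfl⟩
  have _ : MeasurableSMul₂ G (G ⧸ Γ) := ⟨(continuous_smul (M := G) (X := G ⧸ Γ)).measurable⟩
  set N : ℝ≥0∞ := (Fintype.card A : ℝ≥0∞) with hN
  have hN0 : N ≠ 0 := by rw [hN]; exact_mod_cast Fintype.card_ne_zero
  have hNtop : N ≠ ∞ := by rw [hN]; exact ENNReal.natCast_ne_top _
  let κ : G ⧸ Γ → Measure (G ⧸ Γ) := fun x => N⁻¹ • ∑ a, Measure.dirac (φ x.out a : G ⧸ Γ)
  have hκ : ∀ g : G, κ g = N⁻¹ • ∑ a, Measure.dirac (φ g a : G ⧸ Γ) := fun g => by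
    obtain ⟨σ, hσ⟩ := hperm g (g : G ⧸ Γ).out (QuotientGroup.out_eq' _).symm
    refine congrArg (N⁻¹ • ·) ?_
    rw [← Equiv.sum_comp σ fun a => Measure.dirac (φ g a : G ⧸ Γ)]
    exact Finset.sum_congr rfl fun a _ => congrArg Measure.dirac (hσ a)
  have hmk : Measurable (QuotientGroup.mk : G → G ⧸ Γ) := continuous_quotient_mk'.measurable
  have hκapply : ∀ (g : G) (s : Set (G ⧸ Γ)), MeasurableSet s →
      κ g s = N⁻¹ * ∑ a, s.indicator 1 (φ g a : G ⧸ Γ) := fun g s hs => by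
    rw [hκ, Measure.smul_apply, Measure.finsetSum_apply, smul_eq_mul]
    simp_rw [Measure.dirac_apply' _ hs]
  have hκmeas : Measurable κ := by
    rw [← hmk.measurable_comp_iff_of_surjective QuotientGroup.mk_surjective]
    refine Measure.measurable_of_measurable_coe _ fun s hs => ?_
    simp_rw [Function.comp_apply, fun g => hκapply g s hs]
    refine Measurable.const_mul (Finset.measurable_sum _ fun a _ => ?_) _
    exact (measurable_one.indicator hs).comp (hmk.comp (hφ a).measurable)
  have hprob : ∀ x, IsProbabilityMeasure (κ x) := by
    intro x
    obtain ⟨g, rfl⟩ := QuotientGroup.mk_surjective x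
    refine ⟨?_⟩
    rw [hκapply g univ MeasurableSet.univ]
    simp [← hN, ENNReal.inv_mul_cancel hN0 hNtop]
  have hbindprob : IsProbabilityMeasure (m.bind κ) := by
    refine ⟨?_⟩
    rw [Measure.bind_apply MeasurableSet.univ hκmeas.aemeasurable]
    simp
  have hbindinv : SMulInvariantMeasure G (G ⧸ Γ) (m.bind κ) := by
    refine ⟨fun h s hs => ?_⟩
    have hs' : MeasurableSet ((fun x : G ⧸ Γ => h • x) ⁻¹' s) := measurable_const_smul h hs
    obtain ⟨h', hh'⟩ := htwist h
    have hsm : ∀ x, κ x ((fun x : G ⧸ Γ => h • x) ⁻¹' s) = κ (h' • x) s := by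
      intro x
      obtain ⟨g, rfl⟩ := QuotientGroup.mk_surjective x
      have hsmul : h' • (g : G ⧸ Γ) = ((h' * g : G) : G ⧸ Γ) := rfl
      rw [hsmul, hκapply _ _ hs', hκapply _ _ hs]
      simp_rw [hh']
      rfl
    rw [Measure.bind_apply hs' hκmeas.aemeasurable, Measure.bind_apply hs hκmeas.aemeasurable]
    simp_rw [hsm]
    exact (measurePreserving_smul h' m).lintegral_comp ((Measure.measurable_coe hs).comp hκmeas)
  refine ⟨κ, hκmeas, hprob, invariant_probability_unique (G := G) _ _, fun g Φ hΦ => ?_⟩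
  rw [hκ, lintegral_smul_measure, lintegral_finsetSum_measure, smul_eq_mul]
  simp_rw [lintegral_dirac' _ hΦ]

/-- The Hecke operator at `ℓ`: a probability kernel on `G/Γ` which sends `g ℤ_S^d` to a random
sublattice of index `ℓ`, rescaled by the contraction `c`. It commutes with the action of `G` up to
conjugation by `c`, so that it preserves the unique invariant probability measure. -/
theorem exists_hecke_kernel (hSL : SL S d ≤ G) (hcl : IsClosed (G : Set (GLS S d)))
    (hd : 0 < d) (ℓ : Nat.Primes) (hℓ : ℓ ∉ S) {t : ℝ} (ht : t ^ d = ((ℓ : ℕ) : ℝ)⁻¹)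
    [MeasurableSpace (LatticeSpace G hUL)] [BorelSpace (LatticeSpace G hUL)]
    (m : Measure (LatticeSpace G hUL)) [IsProbabilityMeasure m]
    [SMulInvariantMeasure G (LatticeSpace G hUL) m] :
    ∃ c : GLS S d, IsContraction t c ∧ ∃ κ : LatticeSpace G hUL → Measure (LatticeSpace G hUL),
      Measurable κ ∧ (∀ x, IsProbabilityMeasure (κ x)) ∧ m.bind κ = m ∧
      ∀ (g : G) (Φ : LatticeSpace G hUL → ℝ≥0∞), Measurable Φ →
        ∃ x : {a : Fin d → ZMod ℓ // a ≠ 0} → LatticeSpace G hUL,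
          (∀ a, lattice (x a) = subLattice ℓ hℓ c g a) ∧
          ∫⁻ y, Φ y ∂κ (QuotientGroup.mk g) =
            (Fintype.card {a : Fin d → ZMod ℓ // a ≠ 0} : ℝ≥0∞)⁻¹ * ∑ a, Φ (x a) := by
  have _ : PolishSpace G := hcl.polishSpace
  have _ : LocallyCompactSpace G := hcl.isClosedEmbedding_subtypeVal.locallyCompactSpace
  obtain ⟨c, hc, hcdet⟩ := exists_contraction ℓ hℓ hd ht
  choose α hαdet hα1 hα2 using fun a : {a : Fin d → ZMod ℓ // a ≠ 0} =>
    exists_sublattice_matrix ℓ hℓ a.1 a.2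
  have hℓ0 : ((ℓ : ℕ) : ℚ) ≠ 0 := by exact_mod_cast ℓ.2.ne_zero
  have hmem : ∀ (g : G) a, c * g * α a ∈ G := fun g a => by
    refine mem_of_det_eq hSL g.2 ?_
    rw [Units.val_mul, Units.val_mul, Matrix.det_mul, Matrix.det_mul, hcdet, hαdet, mul_right_comm,
      ← map_mul, inv_mul_cancel₀ hℓ0, map_one, one_mul]
  have hlat : ∀ (g : G) a,
      latticeOfMatrix (c * (g : GLS S d) * α a) = subLattice ℓ hℓ c g a.1 := by
    intro g a
    ext v
    rw [mem_latticeOfMatrix]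
    constructor
    · rintro ⟨y, rfl⟩
      obtain ⟨z, hz, e⟩ := hα1 a y
      refine ⟨z, hz, ?_⟩
      rw [Units.val_mul, Units.val_mul, ← Matrix.mulVec_mulVec, ← Matrix.mulVec_mulVec, e]
    · rintro ⟨z, hz, rfl⟩
      obtain ⟨y, e⟩ := hα2 a z hz
      refine ⟨y, ?_⟩
      rw [Units.val_mul, Units.val_mul, ← Matrix.mulVec_mulVec, ← Matrix.mulVec_mulVec, e]
  have : Nonempty {a : Fin d → ZMod ℓ // a ≠ 0} :=
    ⟨⟨fun _ => 1, fun h => one_ne_zero (congrFun h ⟨0, hd⟩)⟩⟩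
  obtain ⟨κ, hκ1, hκ2, hκ3, hκ4⟩ := exists_averaging_kernel
    ((integralPoints S d G hUL).subgroupOf G) m
    (fun (g : G) a => (⟨c * g * α a, hmem g a⟩ : G)) (fun a => by
      refine Continuous.subtype_mk ?_ _
      exact (continuous_const.mul continuous_subtype_val).mul continuous_const)
    (fun g g' e => by
      obtain ⟨σ, hσ⟩ := exists_perm_subLattice ℓ hℓ c e
      refine ⟨σ, fun a => mk_eq_mk_of_lattice_eq ?_⟩
      exact (hlat g' a).trans ((hσ a).trans (hlat g (σ a)).symm))
    (fun h => by
      have hmem' : c⁻¹ * h * c ∈ G := by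
        refine mem_of_det_eq hSL h.2 ?_
        rw [Units.val_mul, Matrix.det_mul, mul_comm, ← Matrix.det_mul, ← Units.val_mul,
          mul_inv_cancel_left]
      exact ⟨⟨c⁻¹ * h * c, hmem'⟩, fun g a => Subtype.ext (by simp [mul_assoc])⟩)
  exact ⟨c, hc, κ, hκ1, hκ2, hκ3, fun g Φ hΦ => ⟨_, fun a =>
    (lattice_mk_integralPoints _).trans (hlat g a), hκ4 g Φ hΦ⟩⟩

/-! ### Invariance of the Haar measure under `G` -/

theorem modulus_of_mem_integralPoints {γ : GLS S d} (hγ : γ ∈ integralPoints S d G hUL) :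
    modulus γ = 1 := by
  obtain ⟨N, hN⟩ := exists_ratZS_matrix hγ
  obtain ⟨N', hN'⟩ := exists_ratZS_matrix (inv_mem hγ)
  exact modulus_eq_one_of_preserves (fun z => ⟨_, hN z⟩) fun y =>
    ⟨N' *ᵥ y, by rw [← hN', mulVec_inv_mulVec]⟩

theorem measurable_modulus [MeasurableSpace G] [BorelSpace G] :
    Measurable fun g : G => (modulus (g : GLS S d) : ℝ≥0∞) := by
  set B := box S d (Ico 0 1) fun _ => 1 with hB
  have hBm : MeasurableSet B := measurableSet_box measurableSet_Ico _
  have hB1 : muSd S d B = 1 := measure_fundamentalDomain isAddFundamentalDomain_box_one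
  -- the inverse image of a set of measure one has measure `(modulus g)⁻¹`
  have h : ∀ g : G, (modulus (g : GLS S d) : ℝ≥0∞) =
      (∫⁻ v, B.indicator 1 ((g : GLS S d).val *ᵥ v) ∂muSd S d)⁻¹ := fun g => by
    refine ENNReal.eq_inv_of_mul_eq_one_left ?_
    rw [lintegral_mulVec, lintegral_indicator_one hBm, hB1]
  simp_rw [h]
  refine Measurable.inv (Measurable.lintegral_prod_right' (f := fun p : G × (Fin d → QS S) =>
    B.indicator 1 ((p.1 : GLS S d).val *ᵥ p.2)) ?_)
  refine (measurable_one.indicator hBm).comp (Continuous.measurable ?_)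
  exact Continuous.matrix_mulVec
    (Units.continuous_val.comp (continuous_subtype_val.comp continuous_fst)) continuous_snd

/-- The elements of `G` preserve the Haar measure of `ℚ_S^d`: the modulus is a character of `G`
which is trivial on `Γ`, and a non-trivial one would be incompatible with the existence of a finite
invariant measure on `G/Γ`. -/
theorem modulus_eq_one (hcl : IsClosed (G : Set (GLS S d)))
    [MeasurableSpace (LatticeSpace G hUL)] [BorelSpace (LatticeSpace G hUL)]
    (m : Measure (LatticeSpace G hUL)) [IsProbabilityMeasure m]
    [SMulInvariantMeasure G (LatticeSpace G hUL) m] (g : G) : modulus (g : GLS S d) = 1 := by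
  let _ : MeasurableSpace G := borel G
  have _ : BorelSpace G := ⟨rfl⟩
  have _ : PolishSpace G := hcl.polishSpace
  have hout : ∀ g : G, modulus ((QuotientGroup.mk g : LatticeSpace G hUL).out : GLS S d) =
      modulus (g : GLS S d) := fun g => by
    have e : (QuotientGroup.mk g : LatticeSpace G hUL) =
        QuotientGroup.mk (QuotientGroup.mk g : LatticeSpace G hUL).out :=
      (QuotientGroup.out_eq' _).symm
    have h1 := Subgroup.mem_subgroupOf.1 (QuotientGroup.eq.1 e)
    have h2 := modulus_of_mem_integralPoints h1
    set k := (QuotientGroup.mk g : LatticeSpace G hUL).out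
    rw [show (k : GLS S d) = g * ((g⁻¹ * k : G) : GLS S d) by simp, modulus_mul, h2, mul_one]
  -- a bounded, strictly decreasing function of the modulus descends to `G/Γ`
  set ψ : LatticeSpace G hUL → ℝ≥0∞ := fun x => (1 + (modulus (x.out : GLS S d) : ℝ≥0∞))⁻¹ with hψ
  have hψmk : ∀ g : G, ψ (QuotientGroup.mk g) = (1 + (modulus (g : GLS S d) : ℝ≥0∞))⁻¹ :=
    fun g => by rw [hψ]; beta_reduce; rw [hout]
  have hmk : Measurable (QuotientGroup.mk : G → LatticeSpace G hUL) :=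
    continuous_quotient_mk'.measurable
  have hψm : Measurable ψ := by
    rw [← hmk.measurable_comp_iff_of_surjective QuotientGroup.mk_surjective]
    have : (ψ ∘ QuotientGroup.mk) = fun g : G => (1 + (modulus (g : GLS S d) : ℝ≥0∞))⁻¹ :=
      funext hψmk
    rw [this]
    exact (measurable_modulus.const_add 1).inv
  have hle : ∀ x, ψ x ≤ 1 := fun x => ENNReal.inv_le_one.2 le_self_add
  have hno : ∀ h : G, ¬ 1 < modulus (h : GLS S d) := by
    intro h hh
    have hlt : ∀ x, ψ (h • x) < ψ x := by
      intro x
      obtain ⟨k, rfl⟩ := QuotientGroup.mk_surjective x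
      have e : h • (QuotientGroup.mk k : LatticeSpace G hUL) = QuotientGroup.mk (h * k) := rfl
      rw [e, hψmk, hψmk, ENNReal.inv_lt_inv, Subgroup.coe_mul, modulus_mul]
      have h1 : modulus (k : GLS S d) < modulus (h : GLS S d) * modulus (k : GLS S d) :=
        lt_mul_of_one_lt_left (modulus_pos _) hh
      exact_mod_cast add_lt_add_right h1 1
    have hint : ∫⁻ x, ψ (h • x) ∂m = ∫⁻ x, ψ x ∂m :=
      (measurePreserving_smul h m).lintegral_comp hψm
    have hfin : ∫⁻ x, ψ (h • x) ∂m ≠ ∞ := by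
      refine ((lintegral_mono fun x => hle (h • x)).trans_lt ?_).ne
      simp
    exact (lintegral_strict_mono (IsProbabilityMeasure.ne_zero m) hψm.aemeasurable hfin
      (Eventually.of_forall hlt)).ne hint
  refine le_antisymm (not_lt.1 (hno g)) ?_
  have h1 := not_lt.1 (hno g⁻¹)
  have h2 := modulus_mul (g : GLS S d) (g⁻¹ : G)
  rw [Subgroup.coe_inv, mul_inv_cancel, modulus_one] at h2
  rw [h2]
  exact mul_le_of_le_one_right' h1

/-! ### Sequences of Hecke operators -/

/-- Primes `ℓ n ∉ S` tending to infinity, with contractions `c n` by `t n = (ℓ n)^(-1/d)`. -/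
structure HeckeSequence (S : Finset Nat.Primes) (d : ℕ) where
  /-- The primes. -/
  ℓ : ℕ → Nat.Primes
  notMem : ∀ n, ℓ n ∉ S
  /-- The contraction factors. -/
  t : ℕ → ℝ
  t_pos : ∀ n, 0 < t n
  t_pow : ∀ n, t n ^ d = ((ℓ n : ℕ) : ℝ)⁻¹
  tendsto_t : Tendsto t atTop (𝓝 0)
  /-- The contractions. -/
  c : ℕ → GLS S d
  isContraction : ∀ n, IsContraction (t n) (c n)

/-- The average of a function of lattices over the sublattices of index `ℓ n`, rescaled by `c n`. -/
def HeckeSequence.average (H : HeckeSequence S d) (Ψ : Set (Fin d → QS S) → ℝ≥0∞) (g : GLS S d)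
    (n : ℕ) : ℝ≥0∞ :=
  (Fintype.card {a : Fin d → ZMod (H.ℓ n) // a ≠ 0} : ℝ≥0∞)⁻¹ *
    ∑ a : {a : Fin d → ZMod (H.ℓ n) // a ≠ 0}, Ψ (subLattice (H.ℓ n) (H.notMem n) (H.c n) g a.1)

theorem exists_prime_notMem (S : Finset Nat.Primes) (n : ℕ) :
    ∃ ℓ : Nat.Primes, ℓ ∉ S ∧ n < (ℓ : ℕ) := by
  obtain ⟨p, hp, hp'⟩ := Nat.exists_infinite_primes (n + 1 + ∑ q ∈ S, (q : ℕ))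
  refine ⟨⟨p, hp'⟩, fun h => ?_, ?_⟩
  · have h1 : p ≤ ∑ q ∈ S, (q : ℕ) :=
      Finset.single_le_sum (f := fun q : Nat.Primes => (q : ℕ)) (fun _ _ => Nat.zero_le _) h
    omega
  · have : n < p := by omega
    exact this

/-- The integral over `G/Γ` of a function of lattices is the limit of its Hecke averages at any
point, if these converge to the same limit everywhere. -/
theorem exists_heckeSequence (hSL : SL S d ≤ G) (hcl : IsClosed (G : Set (GLS S d))) (hd : 0 < d)
    [MeasurableSpace (LatticeSpace G hUL)] [BorelSpace (LatticeSpace G hUL)]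
    (m : Measure (LatticeSpace G hUL)) [IsProbabilityMeasure m]
    [SMulInvariantMeasure G (LatticeSpace G hUL) m] :
    ∃ H : HeckeSequence S d, ∀ Ψ : Set (Fin d → QS S) → ℝ≥0∞,
      (Measurable fun x : LatticeSpace G hUL => Ψ (lattice x)) → ∀ L : ℝ≥0∞,
      (∀ g : G, Tendsto (H.average Ψ g) atTop (𝓝 L)) →
        ∫⁻ x : LatticeSpace G hUL, Ψ (lattice x) ∂m = L := by
  choose ℓ hℓ hℓn using exists_prime_notMem S
  have hd0 : (d : ℝ) ≠ 0 := by exact_mod_cast hd.ne'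
  have hpos : ∀ n, (0 : ℝ) < (ℓ n : ℕ) := fun n => by exact_mod_cast (ℓ n).2.pos
  set t : ℕ → ℝ := fun n => ((ℓ n : ℕ) : ℝ) ^ (-(d : ℝ)⁻¹) with ht
  have htpow : ∀ n, t n ^ d = ((ℓ n : ℕ) : ℝ)⁻¹ := fun n => by
    simp only [ht]
    rw [← Real.rpow_natCast, ← Real.rpow_mul (hpos n).le, neg_mul, inv_mul_cancel₀ hd0,
      Real.rpow_neg_one]
  have htend : Tendsto t atTop (𝓝 0) := by
    refine (tendsto_rpow_neg_atTop (inv_pos.2 (by positivity : (0 : ℝ) < d))).comp ?_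
    exact tendsto_atTop_mono (fun n => by exact_mod_cast (hℓn n).le) tendsto_natCast_atTop_atTop
  choose c hc κ hκ1 hκ2 hκ3 hκ4 using fun n =>
    exists_hecke_kernel hSL hcl hd (ℓ n) (hℓ n) (htpow n) m
  refine ⟨⟨ℓ, hℓ, t, fun n => Real.rpow_pos_of_pos (hpos n) _, htpow, htend, c, hc⟩,
    fun Ψ hΨ L hL => ?_⟩
  refine lintegral_eq_of_tendsto_average m κ hκ1 hκ2 hκ3 _ hΨ L fun x => ?_
  obtain ⟨g, rfl⟩ := QuotientGroup.mk_surjective x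
  refine (hL g).congr fun n => ?_
  obtain ⟨x, hx, e⟩ := hκ4 n g _ hΨ
  rw [e, HeckeSequence.average]
  simp_rw [hx]

/-! ### Sums over lattices and their Hecke averages -/

/-- The sum of `W` over the lattice `Λ`. -/
def latticeSum (W : (Fin d → QS S) → ℝ≥0∞) (Λ : Set (Fin d → QS S)) : ℝ≥0∞ := ∑' v : Λ, W v

/-- The sum of `W` over the pairs of vectors of the lattice `Λ`. -/
def latticePairSum (W : (Fin d → QS S) → (Fin d → QS S) → ℝ≥0∞) (Λ : Set (Fin d → QS S)) :
    ℝ≥0∞ :=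
  ∑' u : Λ, ∑' v : Λ, W u v

theorem latticeSum_latticeOfMatrix (W : (Fin d → QS S) → ℝ≥0∞) (g : GLS S d) :
    latticeSum W (latticeOfMatrix g) = ∑' z, W (g.val *ᵥ emb S d z) := by
  have e : latticeOfMatrix g = range fun z => g.val *ᵥ emb S d z := by
    ext v
    rw [mem_latticeOfMatrix]
    simp [eq_comm]
  rw [latticeSum, e]
  exact tsum_range W ((mulVec_injective g).comp emb_injective)

theorem tsum_image_setOf {α β : Type*} {e : α → β} (he : Function.Injective e) (P : α → Prop)
    [DecidablePred P] (W : β → ℝ≥0∞) :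
    ∑' v : e '' {x | P x}, W v = ∑' x, if P x then W (e x) else 0 := by
  rw [tsum_image W he.injOn, tsum_subtype {x | P x} fun x => W (e x)]
  refine tsum_congr fun x => ?_
  by_cases hx : P x <;> simp [indicator, hx]

theorem tsum_tsum_image_setOf {α β : Type*} {e : α → β} (he : Function.Injective e) (P : α → Prop)
    [DecidablePred P] (W : β → β → ℝ≥0∞) : ∑' u : e '' {x | P x}, ∑' v : e '' {x | P x}, W u v =
      ∑' p : α × α, if P p.1 ∧ P p.2 then W (e p.1) (e p.2) else 0 := by
  simp_rw [fun u => tsum_image_setOf he P (W u)]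
  rw [tsum_image_setOf he P fun u => ∑' x, if P x then W u (e x) else 0,
    ENNReal.tsum_prod (f := fun x y => if P x ∧ P y then W (e x) (e y) else 0)]
  refine tsum_congr fun x => ?_
  split_ifs with hx
  · simp [hx]
  · simp [hx]

theorem subLattice_eq_image (ℓ : Nat.Primes) (hℓ : ℓ ∉ S) (c g : GLS S d) (a : Fin d → ZMod ℓ) :
    subLattice ℓ hℓ c g a = (fun z => c.val *ᵥ (g.val *ᵥ emb S d z)) ''
      {z | a ⬝ᵥ (fun i => red ℓ hℓ (z i)) = 0} := by
  ext v
  simp only [subLattice, mem_ofPred_eq, mem_image]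
  exact exists_congr fun z => and_congr Iff.rfl eq_comm

theorem mulVec_mulVec_emb_injective (c g : GLS S d) :
    Function.Injective fun z => c.val *ᵥ (g.val *ᵥ emb S d z) :=
  (mulVec_injective c).comp ((mulVec_injective g).comp emb_injective)

theorem latticeSum_subLattice (W : (Fin d → QS S) → ℝ≥0∞) (ℓ : Nat.Primes) (hℓ : ℓ ∉ S)
    (c g : GLS S d) (a : Fin d → ZMod ℓ) :
    latticeSum W (subLattice ℓ hℓ c g a) =
      ∑' z, if a ⬝ᵥ (fun i => red ℓ hℓ (z i)) = 0 then
        W (c.val *ᵥ (g.val *ᵥ emb S d z)) else 0 := by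
  rw [latticeSum, subLattice_eq_image]
  exact tsum_image_setOf (mulVec_mulVec_emb_injective c g) _ W

theorem latticePairSum_latticeOfMatrix (W : (Fin d → QS S) → (Fin d → QS S) → ℝ≥0∞)
    (g : GLS S d) : latticePairSum W (latticeOfMatrix g) =
      ∑' y, ∑' z, W (g.val *ᵥ emb S d y) (g.val *ᵥ emb S d z) := by
  have h : ∀ u, ∑' v : latticeOfMatrix g, W u v = ∑' z, W u (g.val *ᵥ emb S d z) := fun u =>
    latticeSum_latticeOfMatrix (W u) g
  rw [latticePairSum]
  simp_rw [h]
  exact latticeSum_latticeOfMatrix (fun u => ∑' z, W u (g.val *ᵥ emb S d z)) g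

theorem latticePairSum_subLattice (W : (Fin d → QS S) → (Fin d → QS S) → ℝ≥0∞) (ℓ : Nat.Primes)
    (hℓ : ℓ ∉ S) (c g : GLS S d) (a : Fin d → ZMod ℓ) :
    latticePairSum W (subLattice ℓ hℓ c g a) =
      ∑' p : (Fin d → ratZS S) × (Fin d → ratZS S),
        if a ⬝ᵥ (fun i => red ℓ hℓ (p.1 i)) = 0 ∧ a ⬝ᵥ (fun i => red ℓ hℓ (p.2 i)) = 0 then
          W (c.val *ᵥ (g.val *ᵥ emb S d p.1)) (c.val *ᵥ (g.val *ᵥ emb S d p.2)) else 0 := by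
  rw [latticePairSum, subLattice_eq_image]
  exact tsum_tsum_image_setOf (mulVec_mulVec_emb_injective c g) _ W

/-- Exchange of the average over `a` and the sum over `τ`, when every `τ` which contributes is
compatible with the same number of `a`'s. -/
theorem sum_tsum_ite {A τ : Type*} [Fintype A] (P : A → τ → Prop)
    [∀ a x, Decidable (P a x)] (W : τ → ℝ≥0∞) (k : ℕ)
    (h : ∀ x, W x ≠ 0 → Nat.card {a // P a x} = k) :
    ∑ a, ∑' x, (if P a x then W x else 0) = k * ∑' x, W x := by
  rw [← Summable.tsum_finsetSum fun a _ => ENNReal.summable, ← ENNReal.tsum_mul_left]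
  refine tsum_congr fun x => ?_
  by_cases hx : W x = 0
  · simp [hx]
  · rw [← h x hx, Finset.sum_ite, Finset.sum_const_zero, add_zero, Finset.sum_const, nsmul_eq_mul,
      Nat.card_eq_fintype_card, Fintype.card_subtype]

/-- The number of vectors orthogonal to `k` independent vectors over a finite prime field. -/
theorem card_orthogonal {p : ℕ} [Fact p.Prime] {k : ℕ} (v : Fin k → Fin d → ZMod p)
    (hv : LinearIndependent (ZMod p) v) :
    Nat.card {a : Fin d → ZMod p // ∀ i, v i ⬝ᵥ a = 0} = p ^ (d - k) := by
  set M : Matrix (Fin k) (Fin d) (ZMod p) := Matrix.of v with hM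
  have hrank : M.rank = k := by
    have : LinearIndependent (ZMod p) M.row := hv
    simpa using this.rank_matrix
  have h1 := LinearMap.finrank_range_add_finrank_ker M.mulVecLin
  have h2 : Module.finrank (ZMod p) (LinearMap.range M.mulVecLin) = k := hrank
  rw [h2, Module.finrank_fin_fun] at h1
  have h3 : Nat.card (LinearMap.ker M.mulVecLin) =
      p ^ Module.finrank (ZMod p) (LinearMap.ker M.mulVecLin) := by
    rw [Module.natCard_eq_pow_finrank (K := ZMod p), Nat.card_zmod]
  rw [show d - k = Module.finrank (ZMod p) (LinearMap.ker M.mulVecLin) by omega, ← h3]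
  refine Nat.card_congr (Equiv.subtypeEquivRight fun a => ?_)
  rw [LinearMap.mem_ker, Matrix.mulVecLin_apply]
  exact ⟨fun h => funext h, fun h i => congrFun h i⟩

theorem card_orthogonal_ne_zero {p : ℕ} [Fact p.Prime] {k : ℕ} (v : Fin k → Fin d → ZMod p)
    (hv : LinearIndependent (ZMod p) v) :
    Nat.card {a : {a : Fin d → ZMod p // a ≠ 0} // ∀ i, a.1 ⬝ᵥ v i = 0} = p ^ (d - k) - 1 := by
  classical
  rw [← card_orthogonal v hv]
  have h0 : ∀ i, v i ⬝ᵥ (0 : Fin d → ZMod p) = 0 := fun i => dotProduct_zero _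
  rw [Nat.card_eq_fintype_card, Nat.card_eq_fintype_card,
    ← Set.card_ne_eq (⟨0, h0⟩ : {a : Fin d → ZMod p // ∀ i, v i ⬝ᵥ a = 0})]
  refine Fintype.card_congr ⟨fun a => ⟨⟨a.1.1, fun i => by rw [dotProduct_comm]; exact a.2 i⟩,
    fun h => a.1.2 (congrArg Subtype.val h)⟩, fun a => ⟨⟨a.1.1, fun h => a.2 (Subtype.ext h)⟩,
    fun i => by rw [dotProduct_comm]; exact a.1.2 i⟩, fun a => rfl, fun a => rfl⟩

theorem card_ne_zero_vectors (p : ℕ) [Fact p.Prime] :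
    Fintype.card {a : Fin d → ZMod p // a ≠ 0} = p ^ d - 1 := by
  classical
  have h := Set.card_ne_eq (0 : Fin d → ZMod p)
  rw [Fintype.card_fun, ZMod.card, Fintype.card_fin] at h
  rw [← h]
  exact Fintype.card_congr (Equiv.refl _)

theorem HeckeSequence.tendsto_inv (H : HeckeSequence S d) (hd : 0 < d) :
    Tendsto (fun n => ((H.ℓ n : ℕ) : ℝ)⁻¹) atTop (𝓝 0) := by
  simp_rw [← H.t_pow]
  simpa [hd.ne'] using H.tendsto_t.pow d

/-- A lattice vector lies in about `1/ℓ` of the sublattices, and an independent pair in about `1/ℓ²`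
of them. -/
theorem HeckeSequence.tendsto_proportion (H : HeckeSequence S d) {k : ℕ} (hk : k < d) :
    Tendsto (fun n => (Fintype.card {a : Fin d → ZMod (H.ℓ n) // a ≠ 0} : ℝ≥0∞)⁻¹ *
      (((H.ℓ n : ℕ) ^ (d - k) - 1 : ℕ) : ℝ≥0∞) * ((H.ℓ n : ℕ) : ℝ≥0∞) ^ k) atTop (𝓝 1) := by
  have hd : 0 < d := by omega
  have hx := H.tendsto_inv hd
  have h1 : Tendsto (fun n => (1 - ((H.ℓ n : ℕ) : ℝ)⁻¹ ^ (d - k)) /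
      (1 - ((H.ℓ n : ℕ) : ℝ)⁻¹ ^ d)) atTop (𝓝 1) := by
    have hdk : d - k ≠ 0 := by omega
    have h2 := (tendsto_const_nhds (x := (1 : ℝ))).sub (hx.pow (d - k))
    have h3 := (tendsto_const_nhds (x := (1 : ℝ))).sub (hx.pow d)
    rw [zero_pow hdk, sub_zero] at h2
    rw [zero_pow hd.ne', sub_zero] at h3
    have h5 := h2.div h3 one_ne_zero
    rw [div_one] at h5
    exact h5
  have h4 := ENNReal.tendsto_ofReal h1
  rw [ENNReal.ofReal_one] at h4
  refine h4.congr fun n => ?_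
  have hp1 : (1 : ℝ) < (H.ℓ n : ℕ) := by exact_mod_cast (H.ℓ n).2.one_lt
  have hp0 : (0 : ℝ) < (H.ℓ n : ℕ) := by positivity
  have hpd : (1 : ℝ) < ((H.ℓ n : ℕ) : ℝ) ^ d := one_lt_pow₀ hp1 hd.ne'
  have hle : ∀ j, 1 ≤ (H.ℓ n : ℕ) ^ j := fun j => Nat.one_le_pow _ _ (H.ℓ n).2.pos
  have e1 : (Fintype.card {a : Fin d → ZMod (H.ℓ n) // a ≠ 0} : ℝ≥0∞) =
      ENNReal.ofReal (((H.ℓ n : ℕ) : ℝ) ^ d - 1) := by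
    rw [card_ne_zero_vectors, ← ENNReal.ofReal_natCast, Nat.cast_sub (hle d)]
    push_cast
    rfl
  have e2 : (((H.ℓ n : ℕ) ^ (d - k) - 1 : ℕ) : ℝ≥0∞) =
      ENNReal.ofReal (((H.ℓ n : ℕ) : ℝ) ^ (d - k) - 1) := by
    rw [← ENNReal.ofReal_natCast, Nat.cast_sub (hle _)]
    push_cast
    rfl
  have e3 : ((H.ℓ n : ℕ) : ℝ≥0∞) ^ k = ENNReal.ofReal (((H.ℓ n : ℕ) : ℝ) ^ k) := by
    rw [ENNReal.ofReal_pow hp0.le, ENNReal.ofReal_natCast]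
  rw [e1, e2, e3, ← ENNReal.ofReal_inv_of_pos (by linarith), ← ENNReal.ofReal_mul (by
    rw [inv_nonneg]; linarith), ← ENNReal.ofReal_mul (by
      refine mul_nonneg (by rw [inv_nonneg]; linarith) ?_
      rw [sub_nonneg]
      exact one_le_pow₀ hp1.le)]
  congr 1
  have hne : ((H.ℓ n : ℕ) : ℝ) ^ d - 1 ≠ 0 := by linarith
  have hsplit : ((H.ℓ n : ℕ) : ℝ) ^ d = ((H.ℓ n : ℕ) : ℝ) ^ (d - k) * ((H.ℓ n : ℕ) : ℝ) ^ k := by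
    rw [← pow_add]; congr 1; omega
  have hne2 : 1 - (((H.ℓ n : ℕ) : ℝ) ^ d)⁻¹ ≠ 0 := by
    have := inv_lt_one_of_one_lt₀ hpd
    linarith
  rw [inv_pow, inv_pow, div_eq_iff hne2]
  set P := ((H.ℓ n : ℕ) : ℝ) ^ d with hP
  have hP0 : P ≠ 0 := by positivity
  have hA : ((H.ℓ n : ℕ) : ℝ) ^ (d - k) ≠ 0 := by positivity
  have hB : ((H.ℓ n : ℕ) : ℝ) ^ k ≠ 0 := by positivity
  have e4 : 1 - P⁻¹ = (P - 1) * P⁻¹ := by field_simp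
  rw [e4, ← mul_assoc, mul_right_comm _ _ (P - 1), mul_right_comm _ _ (P - 1), inv_mul_cancel₀ hne,
    one_mul, hsplit]
  field_simp

/-! ### Lattice vectors in a dilated box -/

/-- If `c g z` stays bounded, then the coordinates of `z` are `O(1/t)` at the real place and bounded
at the primes of `S`. -/
theorem exists_coord_bound (g : GLS S d) {R : ℝ} (hR : 0 < R) :
    ∃ C : ℝ, 0 < C ∧ ∀ (t : ℝ) (c : GLS S d), 0 < t → IsContraction t c →
      ∀ z : Fin d → ratZS S, ‖c.val *ᵥ (g.val *ᵥ emb S d z)‖ ≤ R →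
        ∀ i, |((z i : ℚ) : ℝ)| ≤ C / t ∧ ∀ p, ‖(diag S (z i)).2 p‖ ≤ C := by
  obtain ⟨C, hC, hC1, hC2⟩ := exists_place_bound (g⁻¹).val
  refine ⟨C * R, by positivity, fun t c ht hc z hz i => ?_⟩
  have e := inv_mulVec_mulVec g (emb S d z)
  constructor
  · have h1 := hC1 (R / t) (g.val *ᵥ emb S d z) (by positivity) (fun j => by
      rw [le_div_iff₀ ht, mul_comm, ← abs_of_pos ht, ← abs_mul, ← hc.fst]
      exact (abs_fst_le_norm _ j).trans hz) i
    rw [e] at h1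
    rw [mul_div_assoc]
    exact h1
  · intro p
    have h1 := hC2 R (g.val *ᵥ emb S d z) p hR.le (fun j => by
      rw [← hc.norm_snd]
      exact (norm_snd_le_norm _ j p).trans hz) i
    rw [e] at h1
    exact h1

/-- A non-zero `S`-integer divisible by a large prime cannot be small at all places. -/
theorem exists_eq_zero_of_dvd (S : Finset Nat.Primes) (C : ℝ) :
    ∃ M : ℝ, 0 < M ∧ ∀ (ℓ : Nat.Primes) (hℓ : ℓ ∉ S) (x : ratZS S), red ℓ hℓ x = 0 →
      (∀ p, ‖(diag S x).2 p‖ ≤ C) → |((x : ℚ) : ℝ)| * M < (ℓ : ℕ) → x = 0 := by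
  obtain ⟨M, hM, -, h⟩ := exists_common_denominator S C
  refine ⟨M, by exact_mod_cast hM, fun ℓ hℓ x hx hxC hlt => ?_⟩
  obtain ⟨y, rfl⟩ := red_eq_zero_iff.1 hx
  have hy : ∀ p, ‖(diag S y).2 p‖ ≤ C := by
    intro p
    have h1 : ‖(diag S ((ℓ : ℕ) : ℚ)).2 p‖ = 1 := by
      have h2 : padicNorm p.1 ((ℓ : ℕ) : ℚ) = 1 :=
        (padicNorm.nat_eq_one_iff _).2 fun h => hℓ (primes_eq_of_dvd h ▸ p.2)
      rw [norm_diag_snd, h2, Rat.cast_one]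
    have h2 := hxC p
    rw [Subring.coe_mul, Subring.coe_natCast, map_mul, Prod.snd_mul, Pi.mul_apply, norm_mul, h1,
      one_mul] at h2
    exact h2
  obtain ⟨k, hk⟩ := h y hy
  have hℓ0 : (0 : ℝ) < (ℓ : ℕ) := by exact_mod_cast ℓ.2.pos
  have hk' : ((y : ℚ) : ℝ) * M = k := by exact_mod_cast congrArg (Rat.cast (K := ℝ)) hk
  have h3 : |(k : ℝ)| < 1 := by
    rw [← hk', abs_mul, abs_of_pos (by exact_mod_cast hM : (0 : ℝ) < M)]
    have e : |(((((ℓ : ℕ) : ratZS S) * y : ratZS S) : ℚ) : ℝ)| * M =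
        (ℓ : ℕ) * (|((y : ℚ) : ℝ)| * M) := by
      push_cast
      rw [abs_mul, abs_of_pos hℓ0, mul_assoc]
    rw [e] at hlt
    exact (mul_lt_iff_lt_one_right hℓ0).1 hlt
  have h4 : k = 0 := by
    have : |k| < 1 := by exact_mod_cast h3
    exact Int.abs_lt_one_iff.1 this
  rw [h4, Int.cast_zero, mul_eq_zero] at hk
  have hy0 : y = 0 := Subtype.ext (hk.resolve_right (by exact_mod_cast hM.ne'))
  rw [hy0, mul_zero]

theorem HeckeSequence.ofReal_t_pow (H : HeckeSequence S d) (n : ℕ) :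
    ENNReal.ofReal (H.t n) ^ d = ((H.ℓ n : ℕ) : ℝ≥0∞)⁻¹ := by
  have hpos : (0 : ℝ) < (H.ℓ n : ℕ) := by exact_mod_cast (H.ℓ n).2.pos
  rw [← ENNReal.ofReal_pow (H.t_pos n).le, H.t_pow, ENNReal.ofReal_inv_of_pos hpos,
    ENNReal.ofReal_natCast]

/-- For `k < d`, the size `t^(-k)` of a product of `k` coordinates is negligible with respect to
`ℓ = t^(-d)`. -/
theorem HeckeSequence.eventually_lt (H : HeckeSequence S d) (A : ℝ) {k : ℕ} (hk : k < d) :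
    ∀ᶠ n in atTop, A / H.t n ^ k < (H.ℓ n : ℕ) := by
  have h1 : Tendsto (fun n => A * H.t n ^ (d - k)) atTop (𝓝 0) := by
    have := (H.tendsto_t.pow (d - k)).const_mul A
    rwa [zero_pow (by omega), mul_zero] at this
  filter_upwards [h1.eventually_lt_const one_pos] with n hn
  have ht := H.t_pos n
  have e : ((H.ℓ n : ℕ) : ℝ) = (H.t n ^ d)⁻¹ := by rw [H.t_pow, inv_inv]
  rw [e, div_lt_iff₀ (by positivity), ← div_eq_inv_mul, lt_div_iff₀ (by positivity)]
  calc A * H.t n ^ d = A * H.t n ^ (d - k) * H.t n ^ k := by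
        rw [mul_assoc, ← pow_add]; congr 2; omega
    _ < 1 * H.t n ^ k := by gcongr
    _ = H.t n ^ k := one_mul _

theorem tendsto_of_add_tendsto_zero {a b s : ℕ → ℝ≥0∞} {L : ℝ≥0∞} (h : ∀ n, a n + b n = s n)
    (hs : Tendsto s atTop (𝓝 L)) (hb : Tendsto b atTop (𝓝 0)) : Tendsto a atTop (𝓝 L) := by
  have h1 := ENNReal.Tendsto.sub hs hb (Or.inr ENNReal.zero_ne_top)
  rw [tsub_zero] at h1
  refine h1.congr' ?_
  filter_upwards [hb.eventually_lt_const ENNReal.zero_lt_top] with n hn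
  rw [← h n, ENNReal.add_sub_cancel_right hn.ne]

theorem exists_radius {f : (Fin d → QS S) → ℝ} (hfc : HasCompactSupport f) :
    ∃ R : ℝ, 0 < R ∧ ∀ v, f v ≠ 0 → ‖v‖ ≤ R := by
  obtain ⟨R, hR⟩ := hfc.isCompact.isBounded.exists_norm_le
  exact ⟨max R 1, lt_max_of_lt_right one_pos, fun v hv =>
    (hR v (subset_tsupport f hv)).trans (le_max_left _ _)⟩

theorem mulVec_mulVec_emb_eq_zero_iff {c g : GLS S d} {z : Fin d → ratZS S} :
    c.val *ᵥ (g.val *ᵥ emb S d z) = 0 ↔ z = 0 := by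
  have h : c.val *ᵥ (g.val *ᵥ emb S d 0) = 0 := by
    rw [map_zero, Matrix.mulVec_zero, Matrix.mulVec_zero]
  rw [← h]
  exact (mulVec_mulVec_emb_injective c g).eq_iff

/-! ### The mean value theorem for lattice vectors -/

open Classical in
/-- The function `f`, with its value at the origin replaced by zero. -/
def puncture (f : (Fin d → QS S) → ℝ) (v : Fin d → QS S) : ℝ≥0∞ :=
  if v = 0 then 0 else ENNReal.ofReal (f v)

/-- The Hecke averages of a sum over the non-zero lattice vectors converge to the integral: each
vector which contributes lies in a proportion about `1/ℓ` of the sublattices, and the sum over all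
vectors, multiplied by `1/ℓ`, is a Riemann sum. -/
theorem HeckeSequence.tendsto_average_latticeSum (H : HeckeSequence S d) (hd : 2 ≤ d)
    {f : (Fin d → QS S) → ℝ} (hf0 : ∀ v, 0 ≤ f v) (hf : Continuous f) (hfc : HasCompactSupport f)
    {g : GLS S d} (hg : modulus g = 1) :
    Tendsto (H.average (latticeSum (puncture f)) g) atTop
      (𝓝 (∫⁻ v, ENNReal.ofReal (f v) ∂muSd S d)) := by
  classical
  obtain ⟨R, hR, hfR⟩ := exists_radius hfc
  obtain ⟨C, hC, hCz⟩ := exists_coord_bound g hR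
  obtain ⟨M, hM, hMz⟩ := exists_eq_zero_of_dvd S C
  have hsum : Tendsto (fun n => ENNReal.ofReal (H.t n) ^ d *
      ∑' z, puncture f ((H.c n).val *ᵥ (g.val *ᵥ emb S d z))) atTop
      (𝓝 (∫⁻ v, ENNReal.ofReal (f v) ∂muSd S d)) := by
    refine tendsto_of_add_tendsto_zero
      (b := fun n => ENNReal.ofReal (H.t n) ^ d * ENNReal.ofReal (f 0))
      (fun n => ?_) (tendsto_riemann_sum hf0 hf hfc hg H.t_pos H.tendsto_t H.isContraction) ?_
    · rw [← mul_add, ← tsum_ite_eq (0 : Fin d → ratZS S) fun _ => ENNReal.ofReal (f 0),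
        ← ENNReal.tsum_add]
      congr 2 with z
      by_cases hz : z = 0
      · subst hz
        simp [puncture]
      · rw [puncture, if_neg (mt mulVec_mulVec_emb_eq_zero_iff.1 hz), if_neg hz, add_zero]
    · have h1 : Tendsto (fun n => ENNReal.ofReal (H.t n) ^ d) atTop (𝓝 0) := by
        have := ENNReal.tendsto_ofReal (H.tendsto_t.pow d)
        rw [zero_pow (by omega), ENNReal.ofReal_zero] at this
        exact this.congr fun n => ENNReal.ofReal_pow (H.t_pos n).le d
      have := ENNReal.Tendsto.mul_const h1 (Or.inr (ENNReal.ofReal_ne_top (r := f 0)))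
      rwa [zero_mul] at this
  have hlim := ENNReal.Tendsto.mul (H.tendsto_proportion (k := 1) (by omega)) (Or.inl one_ne_zero)
    hsum (Or.inr ENNReal.one_ne_top)
  rw [one_mul] at hlim
  refine hlim.congr' ?_
  filter_upwards [H.eventually_lt (C * M) (k := 1) (by omega)] with n hn
  -- for `ℓ` large, no non-zero vector which contributes vanishes modulo `ℓ`
  have hcount : ∀ z, puncture f ((H.c n).val *ᵥ (g.val *ᵥ emb S d z)) ≠ 0 →
      Nat.card {a : {a : Fin d → ZMod (H.ℓ n) // a ≠ 0} //
        a.1 ⬝ᵥ (fun i => red (H.ℓ n) (H.notMem n) (z i)) = 0} = (H.ℓ n : ℕ) ^ (d - 1) - 1 := by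
    intro z hz
    have hz0 : z ≠ 0 := fun h => hz (by
      rw [puncture, if_pos (mulVec_mulVec_emb_eq_zero_iff.2 h)])
    have hfz : f ((H.c n).val *ᵥ (g.val *ᵥ emb S d z)) ≠ 0 := fun h => hz (by
      rw [puncture, h, ENNReal.ofReal_zero, ite_self])
    have hb := hCz _ _ (H.t_pos n) (H.isContraction n) z (hfR _ hfz)
    have hred : (fun i => red (H.ℓ n) (H.notMem n) (z i)) ≠ 0 := by
      intro h
      refine hz0 (funext fun i => hMz (H.ℓ n) (H.notMem n) (z i) (congrFun h i) (hb i).2 ?_)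
      calc |((z i : ℚ) : ℝ)| * M ≤ C / H.t n * M := by gcongr; exact (hb i).1
        _ = C * M / H.t n ^ 1 := by rw [pow_one]; ring
        _ < _ := hn
    rw [← card_orthogonal_ne_zero (k := 1) (fun _ => fun i => red (H.ℓ n) (H.notMem n) (z i))
      (linearIndependent_unique_iff.2 hred)]
    exact Nat.card_congr (Equiv.subtypeEquivRight fun a => ⟨fun h _ => h, fun h => h 0⟩)
  rw [HeckeSequence.average]
  simp_rw [latticeSum_subLattice]
  rw [sum_tsum_ite _ _ _ hcount, H.ofReal_t_pow, pow_one, ← mul_assoc, ← mul_assoc]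
  congr 1
  rw [mul_assoc, ENNReal.mul_inv_cancel (by exact_mod_cast (H.ℓ n).2.ne_zero)
    (ENNReal.natCast_ne_top _), mul_one]

/-- The projection of `G` on `G/Γ` is an open quotient map, so that lower semicontinuity can be
checked on `G`. -/
theorem measurable_of_lowerSemicontinuous_mk [MeasurableSpace (LatticeSpace G hUL)]
    [BorelSpace (LatticeSpace G hUL)] {φ : LatticeSpace G hUL → ℝ≥0∞}
    (h : LowerSemicontinuous fun g : G => φ (QuotientGroup.mk g)) : Measurable φ := by
  refine LowerSemicontinuous.measurable ?_
  rw [lowerSemicontinuous_iff_isOpen_preimage] at h ⊢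
  intro y
  rw [← (isQuotientMap_quotient_mk' (X := G)).isOpen_preimage]
  exact h y

theorem continuous_mulVec_emb (z : Fin d → ratZS S) :
    Continuous fun g : G => (g : GLS S d).val *ᵥ emb S d z :=
  Continuous.matrix_mulVec (Units.continuous_val.comp continuous_subtype_val) continuous_const

theorem mulVec_emb_eq_zero_iff {g : GLS S d} {z : Fin d → ratZS S} :
    g.val *ᵥ emb S d z = 0 ↔ z = 0 := by
  have h : g.val *ᵥ emb S d 0 = 0 := by rw [map_zero, Matrix.mulVec_zero]
  rw [← h]
  exact ((mulVec_injective g).comp emb_injective).eq_iff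

theorem measurable_latticeSum_puncture [MeasurableSpace (LatticeSpace G hUL)]
    [BorelSpace (LatticeSpace G hUL)] {f : (Fin d → QS S) → ℝ} (hf : Continuous f) :
    Measurable fun x : LatticeSpace G hUL => latticeSum (puncture f) (lattice x) := by
  refine measurable_of_lowerSemicontinuous_mk ?_
  simp_rw [lattice_mk_integralPoints, latticeSum_latticeOfMatrix]
  refine lowerSemicontinuous_tsum fun z => Continuous.lowerSemicontinuous ?_
  simp_rw [puncture, mulVec_emb_eq_zero_iff]
  split_ifs
  · exact continuous_const
  · exact ENNReal.continuous_ofReal.comp (hf.comp (continuous_mulVec_emb z))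

/-! ### The mean value theorem for independent pairs of lattice vectors -/

/-- Linear independence over `ℚ` of two vectors of `ℚ_S^d`. -/
def QIndep (u v : Fin d → QS S) : Prop :=
  ∀ a b : ℚ, diag S a • u + diag S b • v = 0 → a = 0 ∧ b = 0

theorem qIndep_mulVec_iff {g : GLS S d} {u v : Fin d → QS S} :
    QIndep (g.val *ᵥ u) (g.val *ᵥ v) ↔ QIndep u v := by
  refine forall_congr' fun a => forall_congr' fun b => ?_
  rw [← Matrix.mulVec_smul, ← Matrix.mulVec_smul, ← Matrix.mulVec_add]
  have h : g.val *ᵥ (0 : Fin d → QS S) = 0 := Matrix.mulVec_zero _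
  rw [← (mulVec_injective g).eq_iff (a := diag S a • u + diag S b • v) (b := 0)]
  rw [h]

theorem smul_emb_add_eq_zero_iff {y z : Fin d → ratZS S} {a b : ℚ} :
    diag S a • emb S d y + diag S b • emb S d z = 0 ↔ ∀ i, a * (y i : ℚ) + b * (z i : ℚ) = 0 := by
  rw [funext_iff]
  refine forall_congr' fun i => ?_
  rw [Pi.add_apply, Pi.smul_apply, Pi.smul_apply, smul_eq_mul, smul_eq_mul, emb_apply, emb_apply,
    ← map_mul, ← map_mul, ← map_add, Pi.zero_apply, map_eq_zero_iff _ diag_injective]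

/-- Two dependent vectors are proportional. -/
theorem exists_ratio_of_not_qIndep {y z : Fin d → ratZS S} (h : ¬ QIndep (emb S d y) (emb S d z))
    (hy : y ≠ 0) : ∃ r : ℚ, ∀ i, (z i : ℚ) = r * (y i : ℚ) := by
  simp only [QIndep, smul_emb_add_eq_zero_iff, not_forall] at h
  obtain ⟨a, b, hab, hne⟩ := h
  have hb : b ≠ 0 := by
    rintro rfl
    refine hne ⟨?_, rfl⟩
    obtain ⟨i, hi⟩ := Function.ne_iff.1 hy
    have hi' : (y i : ℚ) ≠ 0 := fun h => hi (Subtype.ext h)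
    have := hab i
    rw [zero_mul, add_zero, mul_eq_zero] at this
    exact this.resolve_right hi'
  refine ⟨-a / b, fun i => ?_⟩
  have := hab i
  field_simp
  linarith

theorem not_qIndep_of_ratio {y z : Fin d → ratZS S} {r : ℚ} (h : ∀ i, (z i : ℚ) = r * (y i : ℚ)) :
    ¬ QIndep (emb S d y) (emb S d z) := fun hi =>
  one_ne_zero (hi (-r) 1 (smul_emb_add_eq_zero_iff.2 fun i => by rw [h i]; ring)).2

/-- If all the minors vanish, the vectors are dependent. -/
theorem not_qIndep_of_minors {y z : Fin d → ratZS S}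
    (h : ∀ i j, y i * z j - y j * z i = 0) : ¬ QIndep (emb S d y) (emb S d z) := by
  intro hi
  have h0 : ∀ j, z j = 0 := fun j => by
    refine Subtype.ext (hi (z j : ℚ) (-(y j : ℚ)) (smul_emb_add_eq_zero_iff.2 fun i => ?_)).1
    have := congrArg Subtype.val (h i j)
    push_cast at this
    linarith
  exact one_ne_zero (hi 0 1 (smul_emb_add_eq_zero_iff.2 fun i => by simp [h0 i])).2

open Classical in
/-- `f ⊗ f`, restricted to the pairs of independent vectors. -/
def indepPair (f : (Fin d → QS S) → ℝ) (u v : Fin d → QS S) : ℝ≥0∞ :=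
  if QIndep u v then ENNReal.ofReal (f u) * ENNReal.ofReal (f v) else 0

open Classical in
/-- `f ⊗ f`, restricted to the pairs of dependent vectors. -/
def depPair (f : (Fin d → QS S) → ℝ) (u v : Fin d → QS S) : ℝ≥0∞ :=
  if QIndep u v then 0 else ENNReal.ofReal (f u) * ENNReal.ofReal (f v)

theorem indepPair_add_depPair (f : (Fin d → QS S) → ℝ) (u v : Fin d → QS S) :
    indepPair f u v + depPair f u v = ENNReal.ofReal (f u) * ENNReal.ofReal (f v) := by
  rw [indepPair, depPair]
  split_ifs <;> simp

/-- For `d ≥ 3` and `ℓ` large, two independent vectors in a box of size `ℓ^(1/d)` are independent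
modulo `ℓ`: their minors are of size `ℓ^(2/d)` and cannot be divisible by `ℓ`. -/
theorem HeckeSequence.eventually_linearIndependent (H : HeckeSequence S d) (hd : 3 ≤ d)
    {f : (Fin d → QS S) → ℝ} (hfc : HasCompactSupport f) (g : GLS S d) :
    ∀ᶠ n in atTop, ∀ y z : Fin d → ratZS S,
      indepPair f ((H.c n).val *ᵥ (g.val *ᵥ emb S d y)) ((H.c n).val *ᵥ (g.val *ᵥ emb S d z)) ≠ 0 →
      LinearIndependent (ZMod (H.ℓ n)) ![fun i => red (H.ℓ n) (H.notMem n) (y i),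
        fun i => red (H.ℓ n) (H.notMem n) (z i)] := by
  obtain ⟨R, hR, hfR⟩ := exists_radius hfc
  obtain ⟨C, hC, hCz⟩ := exists_coord_bound g hR
  obtain ⟨M, hM, hMz⟩ := exists_eq_zero_of_dvd S (C * C + C * C)
  filter_upwards [H.eventually_lt ((C * C + C * C) * M) (k := 2) (by omega)] with n hn
  intro y z hyz
  have hind : QIndep (emb S d y) (emb S d z) := by
    by_contra h
    refine hyz ?_
    rw [indepPair, if_neg]
    rwa [qIndep_mulVec_iff, qIndep_mulVec_iff]
  have hfyz : f ((H.c n).val *ᵥ (g.val *ᵥ emb S d y)) ≠ 0 ∧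
      f ((H.c n).val *ᵥ (g.val *ᵥ emb S d z)) ≠ 0 := by
    constructor <;> intro h <;> refine hyz ?_ <;> rw [indepPair, h, ENNReal.ofReal_zero]
    · rw [zero_mul, ite_self]
    · rw [mul_zero, ite_self]
  have hby := hCz _ _ (H.t_pos n) (H.isContraction n) y (hfR _ hfyz.1)
  have hbz := hCz _ _ (H.t_pos n) (H.isContraction n) z (hfR _ hfyz.2)
  have ht := H.t_pos n
  rw [LinearIndependent.pair_iff]
  intro a b hab
  by_contra hne
  have hab' : ∀ i, a * red (H.ℓ n) (H.notMem n) (y i) + b * red (H.ℓ n) (H.notMem n) (z i) = 0 :=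
    fun i => congrFun hab i
  refine not_qIndep_of_minors (fun i j => ?_) hind
  refine hMz (H.ℓ n) (H.notMem n) _ ?_ (fun p => ?_) ?_
  · have hi := hab' i
    have hj := hab' j
    rw [map_sub, map_mul, map_mul]
    by_cases ha : a = 0
    · have hb : b ≠ 0 := fun h => hne ⟨ha, h⟩
      refine (mul_eq_zero.1 ?_).resolve_left hb
      linear_combination red (H.ℓ n) (H.notMem n) (y i) * hj - red (H.ℓ n) (H.notMem n) (y j) * hi
    · refine (mul_eq_zero.1 ?_).resolve_left ha
      linear_combination red (H.ℓ n) (H.notMem n) (z j) * hi - red (H.ℓ n) (H.notMem n) (z i) * hj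
  · have e : (diag S ((y i * z j - y j * z i : ratZS S) : ℚ)).2 p =
        (diag S (y i)).2 p * (diag S (z j)).2 p - (diag S (y j)).2 p * (diag S (z i)).2 p := by
      simp
    rw [e]
    refine (norm_sub_le _ _).trans (add_le_add ?_ ?_)
    · rw [norm_mul]
      exact mul_le_mul ((hby i).2 p) ((hbz j).2 p) (norm_nonneg _) hC.le
    · rw [norm_mul]
      exact mul_le_mul ((hby j).2 p) ((hbz i).2 p) (norm_nonneg _) hC.le
  · have e : |(((y i * z j - y j * z i : ratZS S) : ℚ) : ℝ)| ≤ C / H.t n * (C / H.t n) +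
        C / H.t n * (C / H.t n) := by
      push_cast
      refine (abs_sub _ _).trans (add_le_add ?_ ?_)
      · rw [abs_mul]
        exact mul_le_mul (hby i).1 (hbz j).1 (abs_nonneg _) (by positivity)
      · rw [abs_mul]
        exact mul_le_mul (hby j).1 (hbz i).1 (abs_nonneg _) (by positivity)
    calc _ ≤ (C / H.t n * (C / H.t n) + C / H.t n * (C / H.t n)) * M := by gcongr
      _ = (C * C + C * C) * M / H.t n ^ 2 := by field_simp
      _ < _ := hn

/-- A fixed non-zero vector has `O(1/t)` multiples in a box of size `1/t`. -/
theorem tsum_depPair_le {f : (Fin d → QS S) → ℝ} (hfc : HasCompactSupport f) (g : GLS S d)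
    {B : ℝ} (hB : ∀ v, f v ≤ B) : ∃ K : ℝ, 0 < K ∧ ∀ (t : ℝ) (c : GLS S d), 0 < t →
      IsContraction t c → ∀ y : Fin d → ratZS S, y ≠ 0 →
        ∑' z, depPair f (c.val *ᵥ (g.val *ᵥ emb S d y)) (c.val *ᵥ (g.val *ᵥ emb S d z)) ≤
          ENNReal.ofReal (f (c.val *ᵥ (g.val *ᵥ emb S d y))) *
            (ENNReal.ofReal (K / t + 1) * ENNReal.ofReal B) := by
  obtain ⟨R, hR, hfR⟩ := exists_radius hfc
  obtain ⟨C, hC, hCz⟩ := exists_coord_bound g hR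
  obtain ⟨M, hM, -, hMz⟩ := exists_common_denominator S C
  have hM' : (0 : ℝ) < M := by exact_mod_cast hM
  refine ⟨2 * (C * M), by positivity, fun t c ht hc y hy => ?_⟩
  obtain ⟨i, hi⟩ := Function.ne_iff.1 hy
  have hi' : (y i : ℚ) ≠ 0 := fun h => hi (Subtype.ext h)
  set T : Set (Fin d → ratZS S) := {z | ¬ QIndep (emb S d y) (emb S d z) ∧
    f (c.val *ᵥ (g.val *ᵥ emb S d z)) ≠ 0} with hT
  set k : ℕ := ⌊C * M / t⌋₊ with hk
  have hex : ∀ z : T, ∃ n : ℤ, (z.1 i : ℚ) * M = n := fun z =>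
    hMz (z.1 i) fun p => (hCz t c ht hc z.1 (hfR _ z.2.2) i).2 p
  choose ν hν using hex
  have hνmem : ∀ z : T, ν z ∈ Finset.Icc (-(k : ℤ)) k := by
    intro z
    have h1 := (hCz t c ht hc z.1 (hfR _ z.2.2) i).1
    have h2 : (((z.1 i : ℚ) : ℝ) * M) = ν z := by exact_mod_cast congrArg (Rat.cast (K := ℝ)) (hν z)
    have h3 : |(ν z : ℝ)| ≤ C * M / t := by
      rw [← h2, abs_mul, abs_of_pos hM']
      calc _ ≤ C / t * M := by gcongr
        _ = C * M / t := by ring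
    have h4 : ((ν z).natAbs : ℝ) ≤ C * M / t := by
      rw [Nat.cast_natAbs, Int.cast_abs]
      exact h3
    have h5 : (ν z).natAbs ≤ k := Nat.le_floor h4
    rw [Finset.mem_Icc]
    omega
  have hνinj : Function.Injective ν := by
    intro z z' h
    obtain ⟨r, hr⟩ := exists_ratio_of_not_qIndep z.2.1 hy
    obtain ⟨r', hr'⟩ := exists_ratio_of_not_qIndep z'.2.1 hy
    have h1 : (z.1 i : ℚ) * M = (z'.1 i : ℚ) * M := by rw [hν, hν, h]
    have h2 := mul_right_cancel₀ (by exact_mod_cast hM.ne' : (M : ℚ) ≠ 0) h1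
    rw [hr, hr'] at h2
    have h3 := mul_right_cancel₀ hi' h2
    refine Subtype.ext (funext fun j => Subtype.ext ?_)
    rw [hr, hr', h3]
  have hTfin : Finite T := Finite.of_injective
    (fun z : T => (⟨ν z, hνmem z⟩ : Finset.Icc (-(k : ℤ)) k))
    fun z z' h => hνinj (congrArg Subtype.val h)
  have hcard : Nat.card T ≤ 2 * k + 1 := by
    have h := Nat.card_le_card_of_injective
      (fun z : T => (⟨ν z, hνmem z⟩ : Finset.Icc (-(k : ℤ)) k))
      fun z z' h => hνinj (congrArg Subtype.val h)
    refine h.trans (le_of_eq ?_)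
    rw [Nat.card_eq_fintype_card, Fintype.card_coe, Int.card_Icc]
    omega
  have hfint := Fintype.ofFinite T
  have hcardR : (Nat.card T : ℝ≥0∞) ≤ ENNReal.ofReal (2 * (C * M) / t + 1) := by
    rw [← ENNReal.ofReal_natCast]
    refine ENNReal.ofReal_le_ofReal ?_
    have h1 : (Nat.card T : ℝ) ≤ 2 * k + 1 := by exact_mod_cast hcard
    have h2 : (k : ℝ) ≤ C * M / t := Nat.floor_le (by positivity)
    calc (Nat.card T : ℝ) ≤ 2 * k + 1 := h1
      _ ≤ 2 * (C * M / t) + 1 := by gcongr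
      _ = _ := by ring
  set F := fun z => ENNReal.ofReal (f (c.val *ᵥ (g.val *ᵥ emb S d z))) with hF
  calc ∑' z, depPair f (c.val *ᵥ (g.val *ᵥ emb S d y)) (c.val *ᵥ (g.val *ᵥ emb S d z))
      ≤ ∑' z, T.indicator (fun _ => F y * ENNReal.ofReal B) z := by
        refine ENNReal.tsum_le_tsum fun z => ?_
        by_cases hz : z ∈ T
        · rw [indicator_of_mem hz, depPair]
          split_ifs
          · exact zero_le
          · gcongr
            exact hB _
        · rw [indicator_of_notMem hz, depPair, qIndep_mulVec_iff, qIndep_mulVec_iff]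
          split_ifs with h
          · exact le_rfl
          · have : f (c.val *ᵥ (g.val *ᵥ emb S d z)) = 0 := by
              by_contra hne
              exact hz ⟨h, hne⟩
            rw [this, ENNReal.ofReal_zero, mul_zero]
    _ = Nat.card T * (F y * ENNReal.ofReal B) := by
        rw [← tsum_subtype T fun _ => F y * ENNReal.ofReal B, tsum_fintype, Finset.sum_const,
          nsmul_eq_mul, Finset.card_univ, Nat.card_eq_fintype_card]
    _ ≤ ENNReal.ofReal (2 * (C * M) / t + 1) * (F y * ENNReal.ofReal B) := by gcongr
    _ = _ := by rw [mul_left_comm]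

/-- Dependent pairs do not contribute to the limit: for each vector there are only `O(1/t)`
multiples, against a normalization by `t^(2d)`. -/
theorem HeckeSequence.tendsto_depPair (H : HeckeSequence S d) (hd : 2 ≤ d)
    {f : (Fin d → QS S) → ℝ} (hf0 : ∀ v, 0 ≤ f v) (hf : Continuous f) (hfc : HasCompactSupport f)
    {g : GLS S d} (hg : modulus g = 1) :
    Tendsto (fun n => ENNReal.ofReal (H.t n) ^ d * (ENNReal.ofReal (H.t n) ^ d *
      ∑' y, ∑' z, depPair f ((H.c n).val *ᵥ (g.val *ᵥ emb S d y))
        ((H.c n).val *ᵥ (g.val *ᵥ emb S d z)))) atTop (𝓝 0) := by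
  classical
  obtain ⟨B, hB⟩ : ∃ B, ∀ v, f v ≤ B := by
    obtain ⟨B, hB⟩ := hf.bounded_above_of_compact_support hfc
    exact ⟨B, fun v => (Real.le_norm_self _).trans (hB v)⟩
  obtain ⟨K, hK, hKle⟩ := tsum_depPair_le hfc g hB
  have hslim := tendsto_riemann_sum hf0 hf hfc hg H.t_pos H.tendsto_t H.isContraction
  have hIfin : ∫⁻ v, ENNReal.ofReal (f v) ∂muSd S d ≠ ∞ :=
    ((hf.integrable_of_hasCompactSupport hfc).lintegral_lt_top).ne
  have hsmall : Tendsto (fun n => ENNReal.ofReal (H.t n ^ d * (K / H.t n + 2)) *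
      ENNReal.ofReal B) atTop (𝓝 0) := by
    have h1 : Tendsto (fun n => K * H.t n ^ (d - 1) + 2 * H.t n ^ d) atTop (𝓝 0) := by
      have h2 := ((H.tendsto_t.pow (d - 1)).const_mul K).add ((H.tendsto_t.pow d).const_mul 2)
      rwa [zero_pow (by omega), zero_pow (by omega), mul_zero, mul_zero, add_zero] at h2
    have h3 : Tendsto (fun n => H.t n ^ d * (K / H.t n + 2)) atTop (𝓝 0) := by
      refine h1.congr fun n => ?_
      have ht := (H.t_pos n).ne'
      have e : H.t n ^ d = H.t n ^ (d - 1) * H.t n := by rw [← pow_succ]; congr 1; omega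
      rw [e]
      field_simp
    have h4 := ENNReal.Tendsto.mul_const (ENNReal.tendsto_ofReal h3)
      (Or.inr (ENNReal.ofReal_ne_top (r := B)))
    rwa [ENNReal.ofReal_zero, zero_mul] at h4
  have hlim := ENNReal.Tendsto.mul hslim (Or.inr ENNReal.zero_ne_top) hsmall (Or.inr hIfin)
  rw [mul_zero] at hlim
  refine tendsto_of_tendsto_of_tendsto_of_le_of_le tendsto_const_nhds hlim (fun _ => zero_le) ?_
  intro n
  set F := fun z => ENNReal.ofReal (f ((H.c n).val *ᵥ (g.val *ᵥ emb S d z))) with hF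
  have ht := H.t_pos n
  have hinner : ∀ y, ∑' z, depPair f ((H.c n).val *ᵥ (g.val *ᵥ emb S d y))
      ((H.c n).val *ᵥ (g.val *ᵥ emb S d z)) ≤
      F y * (ENNReal.ofReal (K / H.t n + 1) * ENNReal.ofReal B) +
        if y = 0 then ENNReal.ofReal B * ∑' z, F z else 0 := by
    intro y
    by_cases hy : y = 0
    · rw [if_pos hy]
      refine le_add_left ?_
      rw [← ENNReal.tsum_mul_left]
      refine ENNReal.tsum_le_tsum fun z => ?_
      rw [depPair]
      split_ifs
      · exact zero_le
      · gcongr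
        exact hB _
    · rw [if_neg hy, add_zero]
      exact hKle _ _ ht (H.isContraction n) y hy
  have hsum : ∑' y, ∑' z, depPair f ((H.c n).val *ᵥ (g.val *ᵥ emb S d y))
      ((H.c n).val *ᵥ (g.val *ᵥ emb S d z)) ≤
      (∑' z, F z) * (ENNReal.ofReal (K / H.t n + 2) * ENNReal.ofReal B) := by
    refine (ENNReal.tsum_le_tsum hinner).trans_eq ?_
    rw [ENNReal.tsum_add, tsum_ite_eq, ENNReal.tsum_mul_right, mul_comm (ENNReal.ofReal B) (tsum F),
      ← mul_add]
    congr 1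
    nth_rewrite 2 [← one_mul (ENNReal.ofReal B)]
    rw [← add_mul, ← ENNReal.ofReal_one, ← ENNReal.ofReal_add (by positivity) zero_le_one]
    congr 2
    ring
  refine (mul_le_mul' le_rfl (mul_le_mul' le_rfl hsum)).trans_eq ?_
  beta_reduce
  rw [ENNReal.ofReal_mul (by positivity), ENNReal.ofReal_pow ht.le]
  ring

/-- The Hecke averages of the sum over independent pairs converge to the square of the integral:
each pair which contributes lies in a proportion about `1/ℓ²` of the sublattices, and the sum over
all pairs, multiplied by `1/ℓ²`, is the square of a Riemann sum up to the dependent pairs. -/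
theorem HeckeSequence.tendsto_average_latticePairSum (H : HeckeSequence S d) (hd : 3 ≤ d)
    {f : (Fin d → QS S) → ℝ} (hf0 : ∀ v, 0 ≤ f v) (hf : Continuous f) (hfc : HasCompactSupport f)
    {g : GLS S d} (hg : modulus g = 1) :
    Tendsto (H.average (latticePairSum (indepPair f)) g) atTop
      (𝓝 ((∫⁻ v, ENNReal.ofReal (f v) ∂muSd S d) ^ 2)) := by
  have hslim := tendsto_riemann_sum hf0 hf hfc hg H.t_pos H.tendsto_t H.isContraction
  have hIfin : ∫⁻ v, ENNReal.ofReal (f v) ∂muSd S d ≠ ∞ :=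
    ((hf.integrable_of_hasCompactSupport hfc).lintegral_lt_top).ne
  have hsq := ENNReal.Tendsto.mul hslim (Or.inr hIfin) hslim (Or.inr hIfin)
  rw [← sq] at hsq
  have hsum : Tendsto (fun n => ENNReal.ofReal (H.t n) ^ d * (ENNReal.ofReal (H.t n) ^ d *
      ∑' y, ∑' z, indepPair f ((H.c n).val *ᵥ (g.val *ᵥ emb S d y))
        ((H.c n).val *ᵥ (g.val *ᵥ emb S d z)))) atTop
      (𝓝 ((∫⁻ v, ENNReal.ofReal (f v) ∂muSd S d) ^ 2)) := by
    refine tendsto_of_add_tendsto_zero (fun n => ?_) hsq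
      (H.tendsto_depPair (by omega) hf0 hf hfc hg)
    rw [← mul_add, ← mul_add, ← ENNReal.tsum_add]
    simp_rw [← ENNReal.tsum_add, indepPair_add_depPair, ENNReal.tsum_mul_left,
      ENNReal.tsum_mul_right]
    ring
  have hlim := ENNReal.Tendsto.mul (H.tendsto_proportion (k := 2) (by omega)) (Or.inl one_ne_zero)
    hsum (Or.inr ENNReal.one_ne_top)
  rw [one_mul] at hlim
  refine hlim.congr' ?_
  filter_upwards [H.eventually_linearIndependent hd hfc g] with n hn
  -- for `ℓ` large, every pair which contributes is independent modulo `ℓ`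
  have hcount : ∀ p : (Fin d → ratZS S) × (Fin d → ratZS S),
      indepPair f ((H.c n).val *ᵥ (g.val *ᵥ emb S d p.1))
        ((H.c n).val *ᵥ (g.val *ᵥ emb S d p.2)) ≠ 0 →
      Nat.card {a : {a : Fin d → ZMod (H.ℓ n) // a ≠ 0} //
        a.1 ⬝ᵥ (fun i => red (H.ℓ n) (H.notMem n) (p.1 i)) = 0 ∧
        a.1 ⬝ᵥ (fun i => red (H.ℓ n) (H.notMem n) (p.2 i)) = 0} = (H.ℓ n : ℕ) ^ (d - 2) - 1 := by
    intro p hp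
    rw [← card_orthogonal_ne_zero (k := 2) _ (hn p.1 p.2 hp)]
    exact Nat.card_congr (Equiv.subtypeEquivRight fun a => by simp [Fin.forall_fin_two])
  rw [HeckeSequence.average]
  simp_rw [latticePairSum_subLattice]
  rw [sum_tsum_ite _ _ _ hcount, H.ofReal_t_pow, ← mul_assoc, ← mul_assoc, ← mul_assoc,
    ENNReal.tsum_prod (f := fun y z => indepPair f ((H.c n).val *ᵥ (g.val *ᵥ emb S d y))
        ((H.c n).val *ᵥ (g.val *ᵥ emb S d z)))]
  congr 1
  have h0 : ((H.ℓ n : ℕ) : ℝ≥0∞) ≠ 0 := by exact_mod_cast (H.ℓ n).2.ne_zero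
  rw [sq, ← mul_assoc, ENNReal.mul_inv_cancel_right h0 (ENNReal.natCast_ne_top _),
    ENNReal.mul_inv_cancel_right h0 (ENNReal.natCast_ne_top _)]

theorem measurable_latticePairSum_indepPair [MeasurableSpace (LatticeSpace G hUL)]
    [BorelSpace (LatticeSpace G hUL)] {f : (Fin d → QS S) → ℝ} (hf0 : ∀ v, 0 ≤ f v)
    (hf : Continuous f) :
    Measurable fun x : LatticeSpace G hUL => latticePairSum (indepPair f) (lattice x) := by
  refine measurable_of_lowerSemicontinuous_mk ?_
  simp_rw [lattice_mk_integralPoints, latticePairSum_latticeOfMatrix]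
  refine lowerSemicontinuous_tsum fun y => lowerSemicontinuous_tsum fun z =>
    Continuous.lowerSemicontinuous ?_
  by_cases h : QIndep (emb S d y) (emb S d z)
  · have hc : Continuous fun g : G => ENNReal.ofReal (f ((g : GLS S d).val *ᵥ emb S d y) *
        f ((g : GLS S d).val *ᵥ emb S d z)) :=
      ENNReal.continuous_ofReal.comp ((hf.comp (continuous_mulVec_emb y)).mul
        (hf.comp (continuous_mulVec_emb z)))
    exact hc.congr fun g => by
      rw [indepPair, if_pos (qIndep_mulVec_iff.2 h), ENNReal.ofReal_mul (hf0 _)]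
  · exact continuous_const.congr fun g => by
      rw [indepPair, if_neg (mt qIndep_mulVec_iff.1 h)]

/-! ### Dependent pairs of lattice vectors -/

theorem coprime_of_mem_NS {q : ℕ} (hq : q ∈ NS S) {p : Nat.Primes} (hp : p ∈ S) :
    Nat.Coprime q p :=
  Nat.Coprime.coprime_dvd_right (Finset.dvd_prod_of_mem (fun p : Nat.Primes => (p : ℕ)) hp) hq.2

theorem coprime_of_mem_NS_of_mem_PS {q n : ℕ} (hq : q ∈ NS S) (hn : n ∈ PS S) :
    Nat.Coprime q n := by
  obtain ⟨m, rfl⟩ := hn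
  exact Nat.Coprime.prod_right fun p hp => (coprime_of_mem_NS hq hp).pow_right _

theorem pos_of_mem_PS {n : ℕ} (hn : n ∈ PS S) : 0 < n := by
  obtain ⟨m, rfl⟩ := hn
  exact Finset.prod_pos fun p _ => pow_pos p.2.pos _

theorem mul_mem_PS {n k : ℕ} (hn : n ∈ PS S) (hk : k ∈ PS S) : n * k ∈ PS S := by
  obtain ⟨m, rfl⟩ := hn
  obtain ⟨m', rfl⟩ := hk
  refine ⟨m + m', ?_⟩
  simp_rw [Pi.add_apply, pow_add]
  exact Finset.prod_mul_distrib.symm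

theorem mem_PS_of_mem {p : Nat.Primes} (hp : p ∈ S) : (p : ℕ) ∈ PS S := by
  classical
  refine ⟨fun r => if r = p then 1 else 0, Eq.symm ?_⟩
  refine (Finset.prod_eq_single_of_mem p hp fun r _ hr => ?_).trans ?_
  · exact (congrArg ((r : ℕ) ^ ·) (if_neg hr)).trans (pow_zero _)
  · exact (congrArg ((p : ℕ) ^ ·) (if_pos rfl)).trans (pow_one _)

/-- The decomposition of an integer into a part outside `S` and a part in `S` is unique. -/
theorem eq_and_eq_of_mul_eq {q q' n n' : ℕ} (hq : q ∈ NS S) (hq' : q' ∈ NS S) (hn : n ∈ PS S)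
    (hn' : n' ∈ PS S) (h : q * n = q' * n') : q = q' ∧ n = n' := by
  have hqq : q = q' := Nat.dvd_antisymm
    ((coprime_of_mem_NS_of_mem_PS hq hn').dvd_of_dvd_mul_right (h ▸ dvd_mul_right _ _))
    ((coprime_of_mem_NS_of_mem_PS hq' hn).dvd_of_dvd_mul_right (h ▸ dvd_mul_right _ _))
  subst hqq
  exact ⟨rfl, Nat.eq_of_mul_eq_mul_left hq.1 h⟩

/-- A positive integer is the product of its parts outside `S` and in `S`. -/
theorem exists_eq_mul_of_ne_zero (S : Finset Nat.Primes) (n : ℕ) (hn : n ≠ 0) :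
    ∃ q ∈ NS S, ∃ p ∈ PS S, n = q * p := by
  induction n using induction_on_primes with
  | zero => exact absurd rfl hn
  | one => exact ⟨1, ⟨one_pos, Nat.gcd_one_left _⟩, 1, ⟨0, by simp⟩, rfl⟩
  | prime_mul l a hl ih =>
    obtain ⟨q, hq, p, ⟨m, hm⟩, rfl⟩ := ih fun h => hn (by rw [h, mul_zero])
    by_cases h : (⟨l, hl⟩ : Nat.Primes) ∈ S
    · exact ⟨q, hq, l * p, mul_mem_PS (mem_PS_of_mem h) ⟨m, hm⟩, by ring⟩
    · refine ⟨l * q, ⟨Nat.mul_pos hl.pos hq.1, Nat.Coprime.mul_left ?_ hq.2⟩, p, ⟨m, hm⟩, by ring⟩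
      refine Nat.Coprime.prod_right fun r hr => (Nat.coprime_primes hl r.2).2 fun e => h ?_
      rwa [show (⟨l, hl⟩ : Nat.Primes) = r from Subtype.ext e]

theorem inv_mem_ratZS_of_mem_PS {n : ℕ} (hn : n ∈ PS S) : (n : ℚ)⁻¹ ∈ ratZS S := by
  obtain ⟨m, rfl⟩ := hn
  intro p hp
  have h : padicNorm p ((∏ r ∈ S, (r : ℕ) ^ m r : ℕ) : ℚ) = 1 := by
    refine (padicNorm.nat_eq_one_iff _).2 fun hdvd => ?_
    obtain ⟨r, hr, h⟩ := (Prime.dvd_finsetProd_iff p.2.prime _).1 hdvd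
    exact hp (primes_eq_of_dvd (p.2.dvd_of_dvd_pow h) ▸ hr)
  rw [← one_div, padicNorm.div, h, padicNorm.one, div_one]

/-- The multiple of `u` by the `S`-integer `q`, for `t = (q, 𝔭, w)`. -/
def firstMultiple (t : momentIndex S) (u : Fin d → ratZS S) : Fin d → ratZS S := fun i =>
  ⟨(t.1.1 : ℚ), natCast_mem_ratZS _⟩ * u i

/-- The multiple of `u` by the `S`-integer `w/𝔭`, for `t = (q, 𝔭, w)`. -/
def secondMultiple (t : momentIndex S) (u : Fin d → ratZS S) : Fin d → ratZS S := fun i =>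
  ⟨(t.1.2.2 : ℚ) / (t.1.2.1 : ℚ), by
    rw [div_eq_mul_inv]
    exact mul_mem (intCast_mem_ratZS _) (inv_mem_ratZS_of_mem_PS t.2.2.1)⟩ * u i

theorem emb_firstMultiple (t : momentIndex S) (u : Fin d → ratZS S) :
    emb S d (firstMultiple t u) = diag S (t.1.1 : ℚ) • emb S d u :=
  funext fun _ => map_mul (diag S) _ _

theorem emb_secondMultiple (t : momentIndex S) (u : Fin d → ratZS S) :
    emb S d (secondMultiple t u) = diag S ((t.1.2.2 : ℚ) / (t.1.2.1 : ℚ)) • emb S d u :=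
  funext fun _ => map_mul (diag S) _ _

theorem firstMultiple_ne_zero (t : momentIndex S) {u : Fin d → ratZS S} (hu : u ≠ 0) :
    firstMultiple t u ≠ 0 := by
  obtain ⟨i, hi⟩ := Function.ne_iff.1 hu
  refine fun h => hi ((mul_eq_zero.1 (congrFun h i)).resolve_left fun h0 => ?_)
  have h1 : (t.1.1 : ℚ) = 0 := congrArg Subtype.val h0
  exact t.2.1.1.ne' (by exact_mod_cast h1)

theorem secondMultiple_ne_zero (t : momentIndex S) {u : Fin d → ratZS S} (hu : u ≠ 0) :
    secondMultiple t u ≠ 0 := by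
  obtain ⟨i, hi⟩ := Function.ne_iff.1 hu
  refine fun h => hi ((mul_eq_zero.1 (congrFun h i)).resolve_left fun h0 => ?_)
  have h1 : (t.1.2.2 : ℚ) / (t.1.2.1 : ℚ) = 0 := congrArg Subtype.val h0
  have h2 : (t.1.2.1 : ℚ) ≠ 0 := by exact_mod_cast (pos_of_mem_PS t.2.2.1).ne'
  have h3 : (t.1.2.2 : ℚ) ≠ 0 := by exact_mod_cast t.2.2.2.1
  exact div_ne_zero h3 h2 h1

theorem not_qIndep_multiples (t : momentIndex S) (u : Fin d → ratZS S) :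
    ¬ QIndep (emb S d (firstMultiple t u)) (emb S d (secondMultiple t u)) := by
  refine not_qIndep_of_ratio (r := (t.1.2.2 : ℚ) / (t.1.2.1 : ℚ) / (t.1.1 : ℚ)) fun i => ?_
  have h2 : (t.1.1 : ℚ) ≠ 0 := by exact_mod_cast t.2.1.1.ne'
  have e1 : ((firstMultiple t u i : ratZS S) : ℚ) = t.1.1 * (u i : ℚ) := rfl
  have e2 : ((secondMultiple t u i : ratZS S) : ℚ) = t.1.2.2 / t.1.2.1 * (u i : ℚ) := rfl
  rw [e1, e2]
  field_simp

/-- Every pair of dependent non-zero vectors of `ℤ_S^d` is of the form `(q u, (w/𝔭) u)`: if `r` is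
the ratio of the two vectors, `r = w/(q𝔭)` in lowest terms. -/
theorem exists_multiples {y z : Fin d → ratZS S} (hy : y ≠ 0) (hz : z ≠ 0)
    (h : ¬ QIndep (emb S d y) (emb S d z)) :
    ∃ (t : momentIndex S) (u : Fin d → ratZS S), u ≠ 0 ∧ firstMultiple t u = y ∧
      secondMultiple t u = z := by
  obtain ⟨r, hr⟩ := exists_ratio_of_not_qIndep h hy
  obtain ⟨q, hq, p, hp, hqp⟩ := exists_eq_mul_of_ne_zero S r.den r.den_nz
  have hr0 : r ≠ 0 := by
    rintro rfl
    exact hz (funext fun i => Subtype.ext (by rw [hr, zero_mul]; rfl))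
  have hcop : Int.gcd ((q * p : ℕ) : ℤ) r.num = 1 := by
    rw [← hqp, Int.gcd_comm]
    exact r.reduced
  have hq0 : (q : ℚ) ≠ 0 := by exact_mod_cast hq.1.ne'
  have hp0 : (p : ℚ) ≠ 0 := by exact_mod_cast (pos_of_mem_PS hp).ne'
  have hrq : r = r.num / (q * p) := by
    conv_lhs => rw [← Rat.num_div_den r, hqp]
    push_cast
    rfl
  obtain ⟨a, b, hab⟩ : ∃ a b : ℤ, a * r.num + b * q = 1 := by
    have hc : IsCoprime r.num (q : ℤ) := by
      have := (Int.isCoprime_iff_gcd_eq_one.2 hcop).symm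
      rw [Nat.cast_mul] at this
      exact this.of_mul_right_left
    exact hc
  have habQ : (a : ℚ) * r.num + b * q = 1 := by exact_mod_cast hab
  have hmem : ∀ i, (y i : ℚ) / q ∈ ratZS S := fun i => by
    have e : (y i : ℚ) / q = a * p * z i + b * y i := by
      rw [hr i, hrq]
      field_simp
      linear_combination -(y i : ℚ) * habQ
    rw [e]
    exact add_mem (mul_mem (mul_mem (intCast_mem_ratZS a) (natCast_mem_ratZS p)) (z i).2)
      (mul_mem (intCast_mem_ratZS b) (y i).2)
  have e1 : firstMultiple ⟨(q, p, r.num), hq, hp, Rat.num_ne_zero.2 hr0, hcop⟩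
      (fun i => ⟨(y i : ℚ) / q, hmem i⟩) = y := by
    refine funext fun i => Subtype.ext ?_
    show (q : ℚ) * (y i / q) = y i
    field_simp
  refine ⟨_, _, ?_, e1, ?_⟩
  · intro h0
    refine hy ?_
    rw [← e1, h0]
    exact funext fun i => mul_zero _
  · refine funext fun i => Subtype.ext ?_
    show (r.num / p : ℚ) * (y i / q) = z i
    rw [hr i]
    conv_rhs => rw [hrq]
    field_simp

/-- The triple `(q, 𝔭, w)` and the vector `u` are determined by the pair `(q u, (w/𝔭) u)`. -/
theorem multiples_injective : Function.Injective
    fun x : momentIndex S × {u : Fin d → ratZS S // u ≠ 0} =>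
      (firstMultiple x.1 x.2.1, secondMultiple x.1 x.2.1) := by
  rintro ⟨⟨⟨q, p, w⟩, hq, hp, hw, hc⟩, u, hu⟩ ⟨⟨⟨q', p', w'⟩, hq', hp', hw', hc'⟩, u', hu'⟩ h
  rw [Prod.mk.injEq] at h
  have h1 : ∀ i, (q : ℚ) * (u i : ℚ) = q' * (u' i : ℚ) := fun i =>
    congrArg Subtype.val (congrFun h.1 i)
  have h2 : ∀ i, (w / p : ℚ) * (u i : ℚ) = w' / p' * (u' i : ℚ) := fun i =>
    congrArg Subtype.val (congrFun h.2 i)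
  have hq0 : (q : ℚ) ≠ 0 := by exact_mod_cast hq.1.ne'
  have hp0 : (p : ℚ) ≠ 0 := by exact_mod_cast (pos_of_mem_PS hp).ne'
  have hq0' : (q' : ℚ) ≠ 0 := by exact_mod_cast hq'.1.ne'
  have hp0' : (p' : ℚ) ≠ 0 := by exact_mod_cast (pos_of_mem_PS hp').ne'
  obtain ⟨i, hi⟩ := Function.ne_iff.1 hu
  have hi' : (u i : ℚ) ≠ 0 := fun h => hi (Subtype.ext h)
  have hratio : (w : ℚ) * (q' * p') = w' * (q * p) := by
    refine mul_right_cancel₀ hi' ?_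
    have h2i := h2 i
    field_simp at h2i
    linear_combination q' * h2i - w' * p * h1 i
  have hratio' : w * ((q' * p' : ℕ) : ℤ) = w' * ((q * p : ℕ) : ℤ) := by exact_mod_cast hratio
  have hcop : IsCoprime ((q * p : ℕ) : ℤ) w := Int.isCoprime_iff_gcd_eq_one.2 hc
  have hcop' : IsCoprime ((q' * p' : ℕ) : ℤ) w' := Int.isCoprime_iff_gcd_eq_one.2 hc'
  have hd1 : q * p ∣ q' * p' := Int.natCast_dvd_natCast.1
    (hcop.dvd_of_dvd_mul_left (hratio' ▸ dvd_mul_left _ _))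
  have hd2 : q' * p' ∣ q * p := Int.natCast_dvd_natCast.1
    (hcop'.dvd_of_dvd_mul_left (hratio' ▸ dvd_mul_left _ _))
  have hqp := Nat.dvd_antisymm hd1 hd2
  have hww : w = w' := by
    rw [hqp] at hratio'
    refine mul_right_cancel₀ ?_ hratio'
    exact_mod_cast (Nat.mul_pos hq'.1 (pos_of_mem_PS hp')).ne'
  obtain ⟨hqq, hpp⟩ := eq_and_eq_of_mul_eq hq hq' hp hp' hqp
  subst hqq hpp hww
  have huu : u = u' := funext fun j => Subtype.ext (mul_left_cancel₀ hq0 (h1 j))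
  subst huu
  rfl

/-- The function `v ↦ f(q v) f((w/𝔭) v)`, for `t = (q, 𝔭, w)`. -/
def momentFun (f : (Fin d → QS S) → ℝ) (t : ℕ × ℕ × ℤ) (v : Fin d → QS S) : ℝ :=
  f (diag S (t.1 : ℚ) • v) * f (diag S ((t.2.2 : ℚ) / (t.2.1 : ℚ)) • v)

/-- The square of the sum over the non-zero lattice vectors, split into the contributions of the
independent pairs and of the dependent pairs. -/
theorem tsum_puncture_sq {f : (Fin d → QS S) → ℝ} (hf0 : ∀ v, 0 ≤ f v) (g : GLS S d) :
    (∑' z, puncture f (g.val *ᵥ emb S d z)) ^ 2 =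
      (∑' y, ∑' z, indepPair f (g.val *ᵥ emb S d y) (g.val *ᵥ emb S d z)) +
        ∑' t : momentIndex S, ∑' u, puncture (momentFun f t) (g.val *ᵥ emb S d u) := by
  classical
  set A : (Fin d → ratZS S) × (Fin d → ratZS S) → ℝ≥0∞ := fun x =>
    puncture f (g.val *ᵥ emb S d x.1) * puncture f (g.val *ᵥ emb S d x.2) with hA
  set B : (Fin d → ratZS S) × (Fin d → ratZS S) → ℝ≥0∞ := fun x =>
    if QIndep (emb S d x.1) (emb S d x.2) then 0 else A x with hB
  set I : (Fin d → ratZS S) × (Fin d → ratZS S) → ℝ≥0∞ := fun x =>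
    indepPair f (g.val *ᵥ emb S d x.1) (g.val *ᵥ emb S d x.2) with hI
  have hsplit : ∀ x, A x = I x + B x := by
    rintro ⟨y, z⟩
    by_cases h : QIndep (emb S d y) (emb S d z)
    · have hy : y ≠ 0 := by
        rintro rfl
        exact one_ne_zero (h 1 0 (smul_emb_add_eq_zero_iff.2 fun i => by simp)).1
      have hz : z ≠ 0 := by
        rintro rfl
        exact one_ne_zero (h 0 1 (smul_emb_add_eq_zero_iff.2 fun i => by simp)).2
      simp only [hA, hB, hI]
      rw [if_pos h, add_zero, puncture, puncture, if_neg (mt mulVec_emb_eq_zero_iff.1 hy),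
        if_neg (mt mulVec_emb_eq_zero_iff.1 hz), indepPair, if_pos (qIndep_mulVec_iff.2 h)]
    · simp only [hB, hI]
      rw [if_neg h, indepPair, if_neg (mt qIndep_mulVec_iff.1 h), zero_add]
  have hsupp : Function.support B ⊆ range fun x : momentIndex S × {u : Fin d → ratZS S // u ≠ 0} =>
      (firstMultiple x.1 x.2.1, secondMultiple x.1 x.2.1) := by
    rintro ⟨y, z⟩ hyz
    rw [Function.mem_support] at hyz
    have hdep : ¬ QIndep (emb S d y) (emb S d z) := fun h => hyz (if_pos h)
    simp only [hB, if_neg hdep, hA] at hyz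
    have hy : y ≠ 0 := by
      rintro rfl
      refine hyz ?_
      rw [puncture, if_pos (mulVec_emb_eq_zero_iff.2 rfl), zero_mul]
    have hz : z ≠ 0 := by
      rintro rfl
      refine hyz ?_
      rw [mul_comm, puncture, if_pos (mulVec_emb_eq_zero_iff.2 rfl), zero_mul]
    obtain ⟨t, u, hu, h1, h2⟩ := exists_multiples hy hz hdep
    exact ⟨(t, ⟨u, hu⟩), Prod.ext h1 h2⟩
  have hBmul : ∀ (t : momentIndex S) (u : {u : Fin d → ratZS S // u ≠ 0}),
      B (firstMultiple t u.1, secondMultiple t u.1) =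
        puncture (momentFun f t) (g.val *ᵥ emb S d u.1) := fun t u => by
    simp only [hB, hA]
    rw [if_neg (not_qIndep_multiples t u.1), puncture, puncture, puncture,
      if_neg (mt mulVec_emb_eq_zero_iff.1 (firstMultiple_ne_zero t u.2)),
      if_neg (mt mulVec_emb_eq_zero_iff.1 (secondMultiple_ne_zero t u.2)),
      if_neg (mt mulVec_emb_eq_zero_iff.1 u.2), ← ENNReal.ofReal_mul (hf0 _), emb_firstMultiple,
      emb_secondMultiple, Matrix.mulVec_smul, Matrix.mulVec_smul]
    rfl
  have hpunct : ∀ t : momentIndex S, ∑' u : {u : Fin d → ratZS S // u ≠ 0},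
      puncture (momentFun f t) (g.val *ᵥ emb S d u.1) =
        ∑' u, puncture (momentFun f t) (g.val *ᵥ emb S d u) := fun t => by
    refine Subtype.val_injective.tsum_eq (f := fun u => puncture (momentFun f t)
      (g.val *ᵥ emb S d u)) fun u hu => ⟨⟨u, fun h => hu ?_⟩, rfl⟩
    exact if_pos (mulVec_emb_eq_zero_iff.2 h)
  calc (∑' z, puncture f (g.val *ᵥ emb S d z)) ^ 2 = ∑' x, A x := by
        rw [ENNReal.tsum_prod', sq]
        simp only [hA]
        simp_rw [ENNReal.tsum_mul_left, ENNReal.tsum_mul_right]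
    _ = ∑' x, I x + ∑' x, B x := by
        rw [← ENNReal.tsum_add]
        exact tsum_congr hsplit
    _ = _ := by
        congr 1
        · rw [ENNReal.tsum_prod']
        · rw [← multiples_injective.tsum_eq hsupp, ENNReal.tsum_prod']
          refine tsum_congr fun t => ?_
          rw [← hpunct t]
          exact tsum_congr fun u => hBmul t u

/-! ### Convergence of the series -/

/-- The homothety of ratio `r` of `ℚ_S^d`. -/
def homothety (S : Finset Nat.Primes) (d : ℕ) (r : ℚ) (hr : r ≠ 0) : GLS S d :=
  Matrix.GeneralLinearGroup.scalar (Fin d) (Units.map (diag S).toMonoidHom (Units.mk0 r hr))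

theorem homothety_mulVec {r : ℚ} (hr : r ≠ 0) (v : Fin d → QS S) :
    (homothety S d r hr).val *ᵥ v = diag S r • v := by
  have h : (homothety S d r hr).val = Matrix.diagonal fun _ => diag S r := rfl
  ext1 i
  rw [h, Matrix.mulVec_diagonal]
  rfl

/-- A homothety by a unit of `ℤ_S` preserves the measure. -/
theorem modulus_homothety {n : ℕ} (hn : n ∈ PS S) (h0 : (n : ℚ) ≠ 0) :
    modulus (homothety S d n h0) = 1 := by
  refine modulus_eq_one_of_preserves
    (fun z => ⟨fun i => ⟨n, natCast_mem_ratZS n⟩ * z i, ?_⟩)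
    fun y => ⟨fun i => ⟨(n : ℚ)⁻¹, inv_mem_ratZS_of_mem_PS hn⟩ * y i, ?_⟩
  · rw [homothety_mulVec]
    exact funext fun i => (map_mul (diag S) (n : ℚ) (z i)).symm
  · rw [homothety_mulVec]
    refine funext fun i => ?_
    have e : diag S (n : ℚ) * diag S ((n : ℚ)⁻¹ * (y i : ℚ)) = diag S (y i) := by
      rw [← map_mul, mul_inv_cancel_left₀ h0]
    exact e

theorem continuous_momentFun {f : (Fin d → QS S) → ℝ} (hf : Continuous f) (t : ℕ × ℕ × ℤ) :
    Continuous (momentFun f t) :=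
  (hf.comp (continuous_const_smul _)).mul (hf.comp (continuous_const_smul _))

theorem hasCompactSupport_momentFun {f : (Fin d → QS S) → ℝ} (hfc : HasCompactSupport f)
    (t : momentIndex S) : HasCompactSupport (momentFun f t) := by
  have hq : (t.1.1 : ℚ) ≠ 0 := by exact_mod_cast t.2.1.1.ne'
  have h := hfc.comp_homeomorph (actEquiv (homothety S d _ hq)).toHomeomorph
  have e : f ∘ (actEquiv (homothety S d _ hq)).toHomeomorph = fun v => f (diag S (t.1.1 : ℚ) • v) :=
    funext fun v => congrArg f (homothety_mulVec hq v)
  rw [e] at h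
  exact h.mul_right

theorem momentFun_nonneg {f : (Fin d → QS S) → ℝ} (hf0 : ∀ v, 0 ≤ f v) (t : ℕ × ℕ × ℤ)
    (v : Fin d → QS S) : 0 ≤ momentFun f t v := mul_nonneg (hf0 _) (hf0 _)

theorem integral_momentFun {f : (Fin d → QS S) → ℝ} (hf0 : ∀ v, 0 ≤ f v) (hf : Continuous f)
    (t : ℕ × ℕ × ℤ) :
    momentTerm f t = (∫⁻ v, ENNReal.ofReal (momentFun f t v) ∂muSd S d).toReal :=
  integral_eq_lintegral_of_nonneg_ae (Eventually.of_forall (momentFun_nonneg hf0 t))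
    (continuous_momentFun hf t).aestronglyMeasurable

/-- A prime does not divide both `q𝔭` and `w`. -/
theorem padicNorm_eq_one_or (t : momentIndex S) (p : Nat.Primes) :
    padicNorm p ((t.1.1 * t.1.2.1 : ℕ) : ℚ) = 1 ∨ padicNorm p (t.1.2.2 : ℚ) = 1 := by
  by_contra! h
  rw [Ne, Ne, padicNorm.nat_eq_one_iff, padicNorm.int_eq_one_iff, not_not, not_not] at h
  have h1 := Int.dvd_coe_gcd (Int.natCast_dvd_natCast.2 h.1) h.2
  rw [t.2.2.2.2] at h1
  exact p.2.one_lt.ne' (by exact_mod_cast Int.eq_one_of_dvd_one (by positivity) h1)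

/-- After the measure-preserving substitution `v = 𝔭u`, the integrand is supported in a box whose
real sides are of length `2R / max(q𝔭, |w|)`. -/
theorem lintegral_momentFun_le {f : (Fin d → QS S) → ℝ} (hf0 : ∀ v, 0 ≤ f v) (hf : Continuous f)
    (hfc : HasCompactSupport f) : ∃ K : ℝ≥0∞, K ≠ ∞ ∧ ∀ t : momentIndex S,
      ∫⁻ v, ENNReal.ofReal (momentFun f t v) ∂muSd S d ≤
        K * ENNReal.ofReal ((max ((t.1.1 * t.1.2.1 : ℕ) : ℝ) |(t.1.2.2 : ℝ)|)⁻¹) ^ d := by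
  obtain ⟨R, hR, hfR⟩ := exists_radius hfc
  obtain ⟨B, hB⟩ : ∃ B, ∀ v, f v ≤ B := by
    obtain ⟨B, hB⟩ := hf.bounded_above_of_compact_support hfc
    exact ⟨B, fun v => (Real.le_norm_self _).trans (hB v)⟩
  have hprod : ∏ p : S, padicHaar (p.1 : ℕ) (Metric.closedBall 0 R) ≠ ∞ :=
    ENNReal.prod_ne_top fun p _ => (measure_closedBall_lt_top (x := (0 : ℚ_[(p.1 : ℕ)]))).ne
  set V := ∏ p : S, padicHaar (p.1 : ℕ) (Metric.closedBall 0 R) with hV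
  refine ⟨ENNReal.ofReal (B * B) * (ENNReal.ofReal (2 * R) * V) ^ d, ENNReal.mul_ne_top
    ENNReal.ofReal_ne_top (ENNReal.pow_ne_top (ENNReal.mul_ne_top ENNReal.ofReal_ne_top hprod)),
    fun t => ?_⟩
  have hp0 : (t.1.2.1 : ℚ) ≠ 0 := by exact_mod_cast (pos_of_mem_PS t.2.2.1).ne'
  have hnat : 0 < t.1.1 * t.1.2.1 := Nat.mul_pos t.2.1.1 (pos_of_mem_PS t.2.2.1)
  have hnpos : (0 : ℝ) < ((t.1.1 * t.1.2.1 : ℕ) : ℝ) := by exact_mod_cast hnat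
  set x : ℝ := max ((t.1.1 * t.1.2.1 : ℕ) : ℝ) |(t.1.2.2 : ℝ)| with hx
  have hxpos : 0 < x := lt_max_of_lt_left hnpos
  set D := box S d (Metric.closedBall 0 (R / x)) fun _ => R with hD
  have hDm : MeasurableSet D := measurableSet_box Metric.isClosed_closedBall.measurableSet _
  have e : ∀ v : Fin d → QS S, momentFun f t ((homothety S d _ hp0).val *ᵥ v) =
      f (diag S ((t.1.1 * t.1.2.1 : ℕ) : ℚ) • v) * f (diag S (t.1.2.2 : ℚ) • v) := fun v => by
    rw [homothety_mulVec, momentFun, smul_smul, smul_smul, ← map_mul, ← map_mul,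
      div_mul_cancel₀ _ hp0, Nat.cast_mul]
  have hsub := lintegral_mulVec (homothety S d _ hp0)
    fun v => ENNReal.ofReal (momentFun f t v)
  rw [modulus_homothety t.2.2.1, ENNReal.coe_one, one_mul] at hsub
  have hmem : ∀ v : Fin d → QS S, f (diag S ((t.1.1 * t.1.2.1 : ℕ) : ℚ) • v) ≠ 0 →
      f (diag S (t.1.2.2 : ℚ) • v) ≠ 0 → v ∈ D := by
    intro v h1 h2 i
    constructor
    · rw [mem_closedBall_zero_iff, Real.norm_eq_abs, le_div_iff₀ hxpos, mul_max_of_nonneg _ _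
        (abs_nonneg _)]
      refine max_le ?_ ?_
      · have := (abs_fst_le_norm _ i).trans (hfR _ h1)
        rw [Pi.smul_apply, smul_eq_mul, Prod.fst_mul, abs_mul, diag_fst, Rat.cast_natCast,
          abs_of_pos hnpos, mul_comm] at this
        exact this
      · have := (abs_fst_le_norm _ i).trans (hfR _ h2)
        rw [Pi.smul_apply, smul_eq_mul, Prod.fst_mul, abs_mul, diag_fst, Rat.cast_intCast,
          mul_comm] at this
        exact this
    · intro p
      rcases padicNorm_eq_one_or t p.1 with h | h
      · have := (norm_snd_le_norm _ i p).trans (hfR _ h1)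
        rw [Pi.smul_apply, smul_eq_mul, Prod.snd_mul, Pi.mul_apply, norm_mul, norm_diag_snd, h,
          Rat.cast_one, one_mul] at this
        exact this
      · have := (norm_snd_le_norm _ i p).trans (hfR _ h2)
        rw [Pi.smul_apply, smul_eq_mul, Prod.snd_mul, Pi.mul_apply, norm_mul, norm_diag_snd, h,
          Rat.cast_one, one_mul] at this
        exact this
  calc ∫⁻ v, ENNReal.ofReal (momentFun f t v) ∂muSd S d
      = ∫⁻ v, ENNReal.ofReal (f (diag S ((t.1.1 * t.1.2.1 : ℕ) : ℚ) • v) *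
          f (diag S (t.1.2.2 : ℚ) • v)) ∂muSd S d := by
        rw [← hsub]
        simp_rw [e]
    _ ≤ ∫⁻ v, D.indicator (fun _ => ENNReal.ofReal (B * B)) v ∂muSd S d := by
        refine lintegral_mono fun v => ?_
        by_cases hv : v ∈ D
        · rw [indicator_of_mem hv]
          exact ENNReal.ofReal_le_ofReal (mul_le_mul (hB _) (hB _) (hf0 _) ((hf0 0).trans (hB 0)))
        · have : f (diag S ((t.1.1 * t.1.2.1 : ℕ) : ℚ) • v) * f (diag S (t.1.2.2 : ℚ) • v) = 0 := by
            by_contra hne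
            exact hv (hmem v (left_ne_zero_of_mul hne) (right_ne_zero_of_mul hne))
          rw [this, ENNReal.ofReal_zero]
          exact zero_le
    _ = ENNReal.ofReal (B * B) * (ENNReal.ofReal (2 * (R / x)) * V) ^ d := by
        rw [lintegral_indicator_const hDm, muSd_box, Real.volume_closedBall]
    _ = _ := by
        rw [div_eq_mul_inv, ← mul_assoc 2 R, ENNReal.ofReal_mul (p := 2 * R) (by positivity),
          mul_right_comm,
          mul_pow _ (ENNReal.ofReal x⁻¹), ← mul_assoc]

/-- As `d ≥ 3`, the volumes are dominated by a product of two convergent series, of exponent `3/2`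
because `max(n, |w|)³ ≥ (n |w|)^(3/2)`. -/
theorem max_inv_pow_le {n : ℕ} (hn : 0 < n) {w : ℤ} (hw : w ≠ 0) {d : ℕ} (hd : 3 ≤ d) :
    (max (n : ℝ) |(w : ℝ)|)⁻¹ ^ d ≤ (n : ℝ) ^ (-(3 / 2) : ℝ) * |(w : ℝ)| ^ (-(3 / 2) : ℝ) := by
  have hn1 : (1 : ℝ) ≤ n := by exact_mod_cast hn
  have hw1 : (1 : ℝ) ≤ |(w : ℝ)| := by exact_mod_cast Int.one_le_abs hw
  set x := max (n : ℝ) |(w : ℝ)| with hx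
  have hx1 : 1 ≤ x := hn1.trans (le_max_left _ _)
  have hx0 : 0 < x := by linarith
  have e : x⁻¹ ^ 3 = x ^ (-(3 / 2) : ℝ) * x ^ (-(3 / 2) : ℝ) := by
    rw [← Real.rpow_add hx0, inv_pow, ← Real.rpow_natCast, ← Real.rpow_neg hx0.le]
    norm_num
  calc x⁻¹ ^ d ≤ x⁻¹ ^ 3 := pow_le_pow_of_le_one (by positivity) (inv_le_one_of_one_le₀ hx1) hd
    _ = x ^ (-(3 / 2) : ℝ) * x ^ (-(3 / 2) : ℝ) := e
    _ ≤ _ := mul_le_mul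
        (Real.rpow_le_rpow_of_nonpos (by linarith) (le_max_left _ _) (by norm_num))
        (Real.rpow_le_rpow_of_nonpos (by linarith) (le_max_right _ _) (by norm_num))
        (by positivity) (by positivity)

theorem denominator_numerator_injective : Function.Injective
    fun t : momentIndex S => (t.1.1 * t.1.2.1, t.1.2.2) := by
  rintro ⟨⟨q, p, w⟩, hq, hp, _⟩ ⟨⟨q', p', w'⟩, hq', hp', _⟩ h
  obtain ⟨hqp, hw⟩ := Prod.mk.inj h
  obtain ⟨hqq, hpp⟩ := eq_and_eq_of_mul_eq hq hq' hp hp' hqp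
  exact Subtype.ext (Prod.ext hqq (Prod.ext hpp hw))

theorem tsum_lintegral_momentFun_ne_top (hd : 3 ≤ d) {f : (Fin d → QS S) → ℝ}
    (hf0 : ∀ v, 0 ≤ f v) (hf : Continuous f) (hfc : HasCompactSupport f) :
    ∑' t : momentIndex S, ∫⁻ v, ENNReal.ofReal (momentFun f t v) ∂muSd S d ≠ ∞ := by
  obtain ⟨K, hK, hKle⟩ := lintegral_momentFun_le hf0 hf hfc
  set a : ℕ × ℤ → ℝ := fun x => (x.1 : ℝ) ^ (-(3 / 2) : ℝ) * |(x.2 : ℝ)| ^ (-(3 / 2) : ℝ) with ha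
  have hsum : Summable a := by
    refine Summable.mul_of_nonneg (f := fun n : ℕ => (n : ℝ) ^ (-(3 / 2) : ℝ))
      (g := fun n : ℤ => |(n : ℝ)| ^ (-(3 / 2) : ℝ)) (Real.summable_nat_rpow.2 (by norm_num))
      (Real.summable_abs_int_rpow (by norm_num)) (fun n => ?_) fun n => ?_
    · exact Real.rpow_nonneg (Nat.cast_nonneg _) _
    · exact Real.rpow_nonneg (abs_nonneg _) _
  refine ne_top_of_le_ne_top (ENNReal.mul_ne_top hK hsum.tsum_ofReal_ne_top) ?_
  rw [← ENNReal.tsum_mul_left]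
  refine le_trans (ENNReal.tsum_le_tsum fun t => ?_)
    (ENNReal.tsum_comp_le_tsum_of_injective (denominator_numerator_injective (S := S))
      fun x => K * ENNReal.ofReal (a x))
  refine (hKle t).trans (mul_le_mul' le_rfl ?_)
  have hn : 0 < t.1.1 * t.1.2.1 := Nat.mul_pos t.2.1.1 (pos_of_mem_PS t.2.2.1)
  rw [← ENNReal.ofReal_pow (by positivity)]
  exact ENNReal.ofReal_le_ofReal (max_inv_pow_le hn t.2.2.2.1 hd)

/-! ### The second moment of the Siegel transform -/

/-- A bounded set contains finitely many vectors of a lattice. -/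
theorem finite_latticeOfMatrix_inter {f : (Fin d → QS S) → ℝ} (hfc : HasCompactSupport f)
    (g : GLS S d) : {v | v ∈ latticeOfMatrix g ∧ v ≠ 0 ∧ f v ≠ 0}.Finite := by
  obtain ⟨R, hR, hfR⟩ := exists_radius hfc
  obtain ⟨C, hC, hCz⟩ := exists_coord_bound g hR
  obtain ⟨M, hM, -, hMz⟩ := exists_common_denominator S C
  have hM' : (0 : ℝ) < M := by exact_mod_cast hM
  -- the bound for contracted lattices is applied to the trivial contraction
  have hone : IsContraction 1 (1 : GLS S d) :=
    ⟨fun _ => 1, by rw [Units.val_one, Matrix.diagonal_one], fun i => ⟨rfl, fun p => norm_one⟩⟩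
  set T : Set (Fin d → ratZS S) := {z | f (g.val *ᵥ emb S d z) ≠ 0} with hT
  have hex : ∀ z : T, ∀ i, ∃ n : ℤ, n ∈ Finset.Icc (-(⌊C * M⌋₊ : ℤ)) ⌊C * M⌋₊ ∧
      (z.1 i : ℚ) * M = n := by
    intro z i
    have hb := hCz 1 1 one_pos hone z.1 (by
      rw [Units.val_one, Matrix.one_mulVec]
      exact hfR _ z.2) i
    rw [div_one] at hb
    obtain ⟨n, hn⟩ := hMz (z.1 i) hb.2
    refine ⟨n, ?_, hn⟩
    have h2 : (((z.1 i : ℚ) : ℝ) * M) = n := by exact_mod_cast congrArg (Rat.cast (K := ℝ)) hn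
    have h3 : |(n : ℝ)| ≤ C * M := by
      rw [← h2, abs_mul, abs_of_pos hM']
      exact mul_le_mul_of_nonneg_right hb.1 hM'.le
    have h4 : (n.natAbs : ℝ) ≤ C * M := by
      rw [Nat.cast_natAbs, Int.cast_abs]
      exact h3
    have h5 : n.natAbs ≤ ⌊C * M⌋₊ := Nat.le_floor h4
    rw [Finset.mem_Icc]
    omega
  choose ν hνmem hν using hex
  have hTfin : Finite T := Finite.of_injective
    (fun z : T => fun i => (⟨ν z i, hνmem z i⟩ : Finset.Icc (-(⌊C * M⌋₊ : ℤ)) ⌊C * M⌋₊))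
    fun z z' h => by
      refine Subtype.ext (funext fun i => Subtype.ext ?_)
      have h1 : ν z i = ν z' i := congrArg Subtype.val (congrFun h i)
      refine mul_right_cancel₀ (by exact_mod_cast hM.ne' : (M : ℚ) ≠ 0) ?_
      rw [hν, hν, h1]
  refine (T.toFinite.image fun z => g.val *ᵥ emb S d z).subset ?_
  rintro v ⟨hv, -, hfv⟩
  obtain ⟨z, rfl⟩ := mem_latticeOfMatrix.1 hv
  exact ⟨z, hfv, rfl⟩

theorem latticeSum_puncture {f : (Fin d → QS S) → ℝ} (hf0 : ∀ v, 0 ≤ f v)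
    {Λ : Set (Fin d → QS S)} (hΛ : {v | v ∈ Λ ∧ v ≠ 0 ∧ f v ≠ 0}.Finite) :
    latticeSum (puncture f) Λ = ENNReal.ofReal (siegelTransform f Λ) := by
  have hsum : Summable fun v : {v : Fin d → QS S // v ∈ Λ ∧ v ≠ 0} => f v := by
    refine summable_of_hasFiniteSupport ?_
    refine (hΛ.preimage Subtype.val_injective.injOn).subset fun v hv => ?_
    exact ⟨v.2.1, v.2.2, hv⟩
  rw [siegelTransform, ENNReal.ofReal_tsum_of_nonneg
    (f := fun v : {v : Fin d → QS S // v ∈ Λ ∧ v ≠ 0} => f v) (fun v => hf0 v) hsum, latticeSum]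
  have hinj : Function.Injective fun v : {v : Fin d → QS S // v ∈ Λ ∧ v ≠ 0} =>
      (⟨v.1, v.2.1⟩ : Λ) := fun v v' h => Subtype.ext (congrArg (fun x : Λ => x.1) h)
  rw [← hinj.tsum_eq (f := fun v : Λ => puncture f v)]
  · exact tsum_congr fun v => if_neg v.2.2
  · intro v hv
    exact ⟨⟨v.1, v.2, fun h => hv (if_pos h)⟩, rfl⟩

theorem latticeSum_puncture_sq {f : (Fin d → QS S) → ℝ} (hf0 : ∀ v, 0 ≤ f v)
    (x : LatticeSpace G hUL) : latticeSum (puncture f) (lattice x) ^ 2 =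
      latticePairSum (indepPair f) (lattice x) +
        ∑' t : momentIndex S, latticeSum (puncture (momentFun f t)) (lattice x) := by
  obtain ⟨g, rfl⟩ := QuotientGroup.mk_surjective x
  rw [lattice_mk_integralPoints, latticeSum_latticeOfMatrix, latticePairSum_latticeOfMatrix,
    tsum_puncture_sq hf0]
  congr 1
  exact tsum_congr fun t => (latticeSum_latticeOfMatrix _ _).symm

/-- The second moment formula in `[0, ∞]`, where no convergence has to be known in advance. -/
theorem lintegral_latticeSum_sq (hSL : SL S d ≤ G) (hcl : IsClosed (G : Set (GLS S d)))
    (hd : 3 ≤ d) [MeasurableSpace (LatticeSpace G hUL)] [BorelSpace (LatticeSpace G hUL)]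
    (m : Measure (LatticeSpace G hUL)) [IsProbabilityMeasure m]
    [SMulInvariantMeasure G (LatticeSpace G hUL) m] {f : (Fin d → QS S) → ℝ}
    (hf0 : ∀ v, 0 ≤ f v) (hf : Continuous f) (hfc : HasCompactSupport f) :
    ∫⁻ x : LatticeSpace G hUL, latticeSum (puncture f) (lattice x) ^ 2 ∂m =
      (∫⁻ v, ENNReal.ofReal (f v) ∂muSd S d) ^ 2 +
        ∑' t : momentIndex S, ∫⁻ v, ENNReal.ofReal (momentFun f t v) ∂muSd S d := by
  obtain ⟨H, hH⟩ := exists_heckeSequence hSL hcl (by omega) m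
  have hmod := fun g : G => modulus_eq_one hcl m g
  have hmeas : ∀ t : momentIndex S, Measurable fun x : LatticeSpace G hUL =>
      latticeSum (puncture (momentFun f t)) (lattice x) := fun t =>
    measurable_latticeSum_puncture (continuous_momentFun hf t)
  simp_rw [latticeSum_puncture_sq hf0]
  rw [lintegral_add_left (measurable_latticePairSum_indepPair hf0 hf),
    lintegral_tsum fun t => (hmeas t).aemeasurable]
  congr 1
  · exact hH _ (measurable_latticePairSum_indepPair hf0 hf) _ fun g =>
      H.tendsto_average_latticePairSum hd hf0 hf hfc (hmod g)
  · exact tsum_congr fun t => hH _ (hmeas t) _ fun g =>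
      H.tendsto_average_latticeSum (by omega) (momentFun_nonneg hf0 t) (continuous_momentFun hf t)
        (hasCompactSupport_momentFun hfc t) (hmod g)

/-- The second moment formula for a closed group `G` between `SL_d(ℚ_S)` and `UL_d(ℚ_S)`. -/
theorem second_moment (hSL : SL S d ≤ G) (hcl : IsClosed (G : Set (GLS S d)))
    (hd : 3 ≤ d) [MeasurableSpace (LatticeSpace G hUL)] [BorelSpace (LatticeSpace G hUL)]
    (m : Measure (LatticeSpace G hUL)) [IsProbabilityMeasure m]
    [SMulInvariantMeasure G (LatticeSpace G hUL) m] {f : (Fin d → QS S) → ℝ}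
    (hf0 : ∀ v, 0 ≤ f v) (hf : Continuous f) (hfc : HasCompactSupport f) :
    (∀ x : LatticeSpace G hUL, {v | v ∈ lattice x ∧ v ≠ 0 ∧ f v ≠ 0}.Finite) ∧
    Integrable (fun x : LatticeSpace G hUL => siegelTransform f (lattice x) ^ 2) m ∧
    Summable (fun t : momentIndex S => momentTerm f (t : ℕ × ℕ × ℤ)) ∧
    ∫ x : LatticeSpace G hUL, siegelTransform f (lattice x) ^ 2 ∂m =
      (∫ v, f v ∂(muSd S d)) ^ 2 +
        ∑' t : momentIndex S, momentTerm f (t : ℕ × ℕ × ℤ) := by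
  have hfin : ∀ x : LatticeSpace G hUL, {v | v ∈ lattice x ∧ v ≠ 0 ∧ f v ≠ 0}.Finite := fun x => by
    obtain ⟨g, rfl⟩ := QuotientGroup.mk_surjective x
    rw [lattice_mk_integralPoints]
    exact finite_latticeOfMatrix_inter hfc g
  have hST0 : ∀ Λ : Set (Fin d → QS S), 0 ≤ siegelTransform f Λ := fun Λ =>
    tsum_nonneg fun v => hf0 v
  have hsq : ∀ x : LatticeSpace G hUL, ENNReal.ofReal (siegelTransform f (lattice x) ^ 2) =
      latticeSum (puncture f) (lattice x) ^ 2 := fun x => by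
    rw [latticeSum_puncture hf0 (hfin x), ENNReal.ofReal_pow (hST0 _)]
  have hmeas : Measurable fun x : LatticeSpace G hUL => siegelTransform f (lattice x) ^ 2 := by
    have e : (fun x : LatticeSpace G hUL => siegelTransform f (lattice x) ^ 2) =
        fun x => (latticeSum (puncture f) (lattice x)).toReal ^ 2 := funext fun x => by
      rw [latticeSum_puncture hf0 (hfin x), ENNReal.toReal_ofReal (hST0 _)]
    rw [e]
    exact (measurable_latticeSum_puncture hf).ennreal_toReal.pow_const 2
  have hmain := lintegral_latticeSum_sq hSL hcl hd m hf0 hf hfc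
  simp_rw [← hsq] at hmain
  have hIfin : ∫⁻ v, ENNReal.ofReal (f v) ∂muSd S d ≠ ∞ :=
    ((hf.integrable_of_hasCompactSupport hfc).lintegral_lt_top).ne
  have hDfin := tsum_lintegral_momentFun_ne_top hd hf0 hf hfc
  have hterm : ∀ t : momentIndex S, momentTerm f t =
      (∫⁻ v, ENNReal.ofReal (momentFun f t v) ∂muSd S d).toReal := fun t =>
    integral_momentFun hf0 hf t
  refine ⟨hfin, ⟨hmeas.aestronglyMeasurable, ?_⟩, ?_, ?_⟩
  · rw [hasFiniteIntegral_iff_ofReal (Eventually.of_forall fun x => sq_nonneg _), hmain]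
    exact ENNReal.add_lt_top.2 ⟨ENNReal.pow_lt_top hIfin.lt_top, hDfin.lt_top⟩
  · simp_rw [hterm]
    exact ENNReal.summable_toReal hDfin
  · rw [integral_eq_lintegral_of_nonneg_ae (Eventually.of_forall fun x => sq_nonneg _)
      hmeas.aestronglyMeasurable, hmain, ENNReal.toReal_add (ENNReal.pow_ne_top hIfin) hDfin,
      ENNReal.toReal_pow, integral_eq_lintegral_of_nonneg_ae (Eventually.of_forall hf0)
      hf.aestronglyMeasurable, ENNReal.tsum_toReal_eq (ENNReal.ne_top_of_tsum_ne_top hDfin)]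
    simp_rw [hterm]

end SArith

end

theorem mainTheorem2 (S : Finset Nat.Primes) (d : ℕ) (hd : 3 ≤ d)
    (G Γ : Subgroup (SArith.GLS S d))
    (hGΓ : (G = SArith.UL S d ∧ Γ = SArith.ULZ S d) ∨ (G = SArith.SL S d ∧ Γ = SArith.SLZ S d))
    [MeasurableSpace (G ⧸ Γ.subgroupOf G)] [BorelSpace (G ⧸ Γ.subgroupOf G)]
    (m : Measure (G ⧸ Γ.subgroupOf G)) [IsProbabilityMeasure m]
    [SMulInvariantMeasure G (G ⧸ Γ.subgroupOf G) m]
    (f : (Fin d → SArith.QS S) → ℝ) (hf_nonneg : ∀ v, 0 ≤ f v) (hf_cont : Continuous f)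
    (hf_supp : HasCompactSupport f) :
    (∀ x : G ⧸ Γ.subgroupOf G, {v | v ∈ SArith.lattice x ∧ v ≠ 0 ∧ f v ≠ 0}.Finite) ∧
    Integrable (fun x : G ⧸ Γ.subgroupOf G =>
      SArith.siegelTransform f (SArith.lattice x) ^ 2) m ∧
    Summable (fun t : SArith.momentIndex S => SArith.momentTerm f (t : ℕ × ℕ × ℤ)) ∧
    ∫ x, SArith.siegelTransform f (SArith.lattice x) ^ 2 ∂m =
      (∫ v, f v ∂(SArith.muSd S d)) ^ 2 +
        ∑' t : SArith.momentIndex S, SArith.momentTerm f (t : ℕ × ℕ × ℤ) := by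
  obtain ⟨hUL, hSL, hcl, rfl⟩ : ∃ hUL : G ≤ SArith.UL S d, SArith.SL S d ≤ G ∧
      IsClosed (G : Set (SArith.GLS S d)) ∧ Γ = SArith.integralPoints S d G hUL := by
    rcases hGΓ with ⟨rfl, rfl⟩ | ⟨rfl, rfl⟩
    · exact ⟨le_rfl, SArith.SL_le_UL S d, SArith.isClosed_UL, rfl⟩
    · exact ⟨SArith.SL_le_UL S d, le_rfl, SArith.isClosed_SL, rfl⟩
  exact SArith.second_moment hSL hcl hd m hf_nonneg hf_cont hf_supp
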